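/- Let $(\Omega,\mathcal F,\mathsf P)$ be a probability space such that $H=L_2(\Omega,\mathcal F,\mathsf P)$ (complex valued) is infinite dimensional. Let $T>0$, $P>0$, let $d\ge 0$, $N\ge 0$, $\tau\ge 1$ be integers, and let $a:[0,(N+1)T]\to\mathbb C$ be integrable. For $\xi:\mathbb R\to H$ and a step $h$ put $\xi^{(d)}(t,h)=\sum_{l=0}^d(-1)^l\binom dl\,\xi(t-lh)$. Let $d(k)$ be the coefficients of $\big(\sum_{j\ge0}x^j\big)^d$ and $$b(t)=\sum_{k=0}^{[((N+1)T-t)/(\tau T)]}a(t+\tau Tk)\,d(k),\qquad B_{NT}\xi=\int_0^{(N+1)T}b(t)\,\xi^{(d)}(t,\tau T)\,dt .$$ Let $e_k(u)=T^{-1/2}e^{2\pi i(-1)^k[k/2]u/T}$, $k=1,2,\dots$, be the Fourier basis of $L_2[0,T)$, let $\xi_j(u)=\xi^{(d)}(u+jT,\tau T)$, $u\in[0,T)$, $j\in\mathbb Z$, $\xi_{kj}=\langle\xi_j,e_k\rangle$, $\vec\xi_j=(\xi_{kj})_{k\ge1}$, and let $\vec b_j=(b_{kj})_{k\ge1}$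 be the vector $(\beta_{1j},\beta_{3j},\beta_{2j},\beta_{5j},\beta_{4j},\dots)$, where $\beta_{kj}=\int_0^Tb(u+jT)\overline{e_k(u)}\,du$. Let $\mathbf Y$ be the class of $\xi:\mathbb R\to H$ such that $\mathsf E\,\xi^{(d)}(t,\tau T)=0$ and $\mathsf E\,\xi^{(d)}(t+T,\tau T)\overline{\xi^{(d)}(s+T,\tau T)}=\mathsf E\,\xi^{(d)}(t,\tau T)\overline{\xi^{(d)}(s,\tau T)}$ for all $t,s$, and $\xi_j\in L_2([0,T);H)$, $\|\xi_j\|^2=\int_0^T\mathsf E|\xi_j(u)|^2du\le P$ for all $j\in\mathbb Z$. Let $\mathbf Y_c\subset\mathbf Y$ consist of those $\xi\in\mathbf Y$ for which $t\mapsto\xi^{(d)}(t,\tau T)$ is mean-square continuous and the increments $\xi^{(d)}(t,\sigma T)$ with all integer steps $\sigma$ are jointly periodically correlated: $\mathsf E\,\xi^{(d)}(t,\sigma T)$ and $\mathsf E\,\xi^{(d)}(t,\sigma_1T)\overline{\xi^{(d)}(s,\sigma_2T)}$ do not change when $T$ is added to the times $t$, respectively $t$ and $s$. Let $\Lambda$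 be the set of linear estimates: the maps $\hat B:\mathbf Y\to H$ for which some sequence of finite linear combinations $\sum c^{(n)}_{kj}\xi_{kj}$ over $k\ge 1$, $j\le-1$, with coefficients not depending on $\xi$, converges to $\hat B\xi$ in mean square for every $\xi\in\mathbf Y$. Put $\Delta(\xi,\hat B)=\mathsf E|B_{NT}\xi-\hat B\xi|^2$. Assume that $\|\vec b_j\|^2=\sum_k|b_{kj}|^2<\infty$ for $j=0,\dots,N$. Then: 1. The matrix with blocks $Q_N(p,q)$, $p,q=0,\dots,N$, and entries $Q_{kn}(p,q)=\sum_{s=0}^{\min(N-p,N-q)}b_{k,s+p}\overline{b_{n,s+q}}$, $k,n\ge1$, determines a compact self-adjoint operator $Q_N$ in $\ell_2$ (the space of square summable families $x_k(p)$, $0\le p\le N$, $k\ge 1$); it has a greatest eigenvalue, denoted $\nu_N^2$. 2. For each $\xi\in\mathbf Y$, $\inf_{\hat B\in\Lambda}\Delta(\xi,\hat B)$ equals $\Delta_{\min}(\xi)$, the least value of $\mathsf E|B_{NT}\xi-x|^2$ over $x$ in the closed linear span of $\{\xi_{kj}:k\ge1,\ j\le-1\}$, and this least value is attained. The function $\Delta$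 has a saddle point $(\xi^0,\hat B^0)\in\mathbf Y\times\Lambda$, that is, $\Delta(\xi,\hat B^0)\le\Delta(\xi^0,\hat B^0)\le\Delta(\xi^0,\hat B)$ for all $\xi\in\mathbf Y$, $\hat B\in\Lambda$, with $\Delta(\xi^0,\hat B^0)=P\nu_N^2$, and $$\min_{\hat B\in\Lambda}\ \sup_{\xi\in\mathbf Y}\Delta(\xi,\hat B)=\max_{\xi\in\mathbf Y}\ \Delta_{\min}(\xi)=P\,\nu_N^2 .$$ For the subclass $\mathbf Y_c$ also $\min_{\hat B\in\Lambda}\sup_{\xi\in\mathbf Y_c}\Delta(\xi,\hat B)=\sup_{\xi\in\mathbf Y_c}\Delta_{\min}(\xi)=P\nu_N^2$. 3. The least favorable processes, that is, the $\xi\in\mathbf Y$ that maximize $\Delta_{\min}$ over $\mathbf Y$, are those for which $\vec\xi_j$ is a one-sided moving average of order $N$, $$\vec\xi_j=\sum_{s=j-N}^{j}g(j-s)\,\vec\varepsilon(s),\qquad j\in\mathbb Z .\tag{$*$}$$ Here $M$ is finite, $\vec\varepsilon(s)=(\varepsilon_m(s))_{m=1}^M$, $s\in\mathbb Z$, has mean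 zero and orthonormal values, $\mathsf E\,\varepsilon_m(s)\overline{\varepsilon_n(r)}=\delta_{mn}\delta_{sr}$, and the matrices $g(p)=\{g_{km}(p)\}_{k\ge1}^{m\le M}$ satisfy $\sum_{p=0}^N\|g(p)\|^2=\sum_{p,k,m}|g_{km}(p)|^2=P$ and, for each $m$, $\sum_{q=0}^N\sum_{n\ge1}Q_{kn}(p,q)\,\overline{g_{nm}(q)}=\nu_N^2\,\overline{g_{km}(p)}$ for all $k,p$ (each column of $g$, conjugated, is zero or an eigenvector of $Q_N$ for $\nu_N^2$). More precisely: such $g$ and $\vec\varepsilon$ exist with $M=1$; for all such $M$, $g$, $\vec\varepsilon$ there is a $\xi\in\mathbf Y$ satisfying $(*)$, and every $\xi\in\mathbf Y$ satisfying $(*)$ is least favorable; and if $\nu_N^2>0$, then every least favorable $\xi\in\mathbf Y$ satisfies $(*)$ for some such $M$, $g$, $\vec\varepsilon$. -/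

import Mathlib

open MeasureTheory Filter Topology

namespace PCIncrements

noncomputable section

/-- The frequency `(-1)^k [k/2]` of the `k`-th basis function, `k = 1, 2, 3, …`; the index is
shifted by one, so that `freq 0, freq 1, freq 2, …` is `0, 1, -1, 2, -2, …`. -/
def freq (k : ℕ) : ℤ := (-1) ^ (k + 1) * (((k + 1) / 2 : ℕ) : ℤ)

/-- The orthonormal basis `u ↦ T^{-1/2} exp (2 π i freq(k) u / T)` of `L₂([0,T))`. -/
def basisFun (T : ℝ) (k : ℕ) (u : ℝ) : ℂ :=
  (1 / (Real.sqrt T : ℂ)) * Complex.exp (2 * Real.pi * Complex.I * (freq k : ℂ) * u / T)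

/-- The index of the opposite frequency: it exchanges the indices `2l` and `2l+1`, `l ≥ 1`,
of the basis counted from `1`, that is, `2l-1` and `2l` counted from `0`, and fixes `0`. -/
def oppIndex (k : ℕ) : ℕ := if k = 0 then 0 else if k % 2 = 1 then k + 1 else k - 1

theorem freq_oppIndex (k : ℕ) : freq k + freq (oppIndex k) = 0 := by
  unfold freq oppIndex
  rcases Nat.even_or_odd' k with ⟨l, rfl | rfl⟩
  · by_cases h : l = 0
    · subst h; simp
    · have h1 : ¬ (2 * l = 0) := by omega
      have h2 : ¬ (2 * l % 2 = 1) := by omega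
      have h3 : 2 * l - 1 + 1 = 2 * l := by omega
      have h4 : (2 * l + 1) / 2 = l := by omega
      have h5 : 2 * l / 2 = l := by omega
      simp [h1, h3, h4, pow_succ, pow_mul]
  · have h1 : ¬ (2 * l + 1 = 0) := by omega
    have h2 : (2 * l + 1) % 2 = 1 := by omega
    have h4 : (2 * l + 1 + 1) / 2 = l + 1 := by omega
    have h5 : (2 * l + 1 + 1 + 1) / 2 = l + 1 := by omega
    simp [h2, h4, h5, pow_succ, pow_mul]

/-! ### The functional -/

/-- The coefficients `d(k)` of the power series `(∑ x^j)^d`. -/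
def dCoef (d k : ℕ) : ℂ := PowerSeries.coeff k ((PowerSeries.mk fun _ => (1 : ℂ)) ^ d)

/-- `b^{τ,N}(t) = ∑_{k=0}^{[((N+1)T-t)/(τT)]} a(t + τTk) d(k)`. -/
def bFun (T : ℝ) (d τ N : ℕ) (a : ℝ → ℂ) (t : ℝ) : ℂ :=
  ∑ k ∈ Finset.range (⌊((N + 1 : ℝ) * T - t) / (τ * T)⌋₊ + 1), a (t + τ * T * k) * dCoef d k

/-- `b_{kj} = ⟨b_j, e_k⟩` in `L₂([0,T))`, where `b_j(u) = b^{τ,N}(u + jT)`. -/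
def bCoef (T : ℝ) (d τ N : ℕ) (a : ℝ → ℂ) (j k : ℕ) : ℂ :=
  ∫ u in Set.Ico 0 T, bFun T d τ N a (u + j * T) * (starRingEnd ℂ) (basisFun T k u)

/-- The vector `(b_{1j}, b_{3j}, b_{2j}, b_{5j}, b_{4j}, …)`. -/
def bVec (T : ℝ) (d τ N : ℕ) (a : ℝ → ℂ) (j k : ℕ) : ℂ := bCoef T d τ N a j (oppIndex k)

/-- The condition `∑_k |b_{kj}|² < ∞` for `j = 0, …, N`. -/
def CoefCondition (T : ℝ) (d τ N : ℕ) (a : ℝ → ℂ) : Prop :=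
  ∀ j ≤ N, Summable fun k => ‖bVec T d τ N a j k‖ ^ 2

/-- The space `ℓ₂` of square summable families `x_k(p)`, `p = 0, …, N`, `k = 1, 2, …`. -/
abbrev BlockL2 (N : ℕ) : Type := lp (fun _ : Fin (N + 1) × ℕ => ℂ) 2

/-- The entry `Q_{kn}(p,q) = ∑_{s=0}^{min(N-p,N-q)} b_{k,s+p} conj(b_{n,s+q})`, at row `(p,k)`
and column `(q,n)`. -/
def QEntry (T : ℝ) (d τ N : ℕ) (a : ℝ → ℂ) (r c : Fin (N + 1) × ℕ) : ℂ :=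
  ∑ s ∈ Finset.range (min (N - (r.1 : ℕ)) (N - (c.1 : ℕ)) + 1),
    bVec T d τ N a (s + r.1) r.2 * (starRingEnd ℂ) (bVec T d τ N a (s + c.1) c.2)

/-- `Q` is the operator on `ℓ₂` determined by the block matrix `Q_N(p,q)`. -/
def IsQOperator (T : ℝ) (d τ N : ℕ) (a : ℝ → ℂ) (Q : BlockL2 N →L[ℂ] BlockL2 N) : Prop :=
  ∀ (x : BlockL2 N) (r : Fin (N + 1) × ℕ), HasSum (fun c => QEntry T d τ N a r c * x c) (Q x r)

/-! ### Processes, valued in the space of random variables with finite second moment -/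

variable {Ω : Type*} [MeasurableSpace Ω]

/-- The `d`-th increment `ξ^{(d)}(t,h) = ∑_l (-1)^l (d choose l) ξ(t - l h)`. -/
def incr (μ : Measure Ω) (d : ℕ) (h : ℝ) (ξ : ℝ → Lp ℂ 2 μ) (t : ℝ) : Lp ℂ 2 μ :=
  ∑ l ∈ Finset.range (d + 1), ((-1 : ℂ) ^ l * (d.choose l : ℂ)) • ξ (t - l * h)

/-- The component `ξ_{kj} = ⟨ξ_j, e_k⟩` of the generated vector sequence, where
`ξ_j(u) = ξ^{(d)}(u + jT, τT)`, `u ∈ [0,T)`. -/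
def genCoef (μ : Measure Ω) (T : ℝ) (d τ : ℕ) (ξ : ℝ → Lp ℂ 2 μ) (j : ℤ) (k : ℕ) : Lp ℂ 2 μ :=
  ∫ u in Set.Ico 0 T, (starRingEnd ℂ) (basisFun T k u) • incr μ d (τ * T) ξ (u + j * T)

/-- The class `Y`: the increments with step `τT` have mean zero and a correlation function
`E[ξ^{(d)}(t,τT) conj(ξ^{(d)}(s,τT))]` that does not change when `T` is added to both times, and
the functions `ξ_j` belong to `L₂([0,T);H)` and satisfy `‖ξ_j‖² = ∫_0^T E|ξ_j(u)|² du ≤ P`. -/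
structure MemY (μ : Measure Ω) (T : ℝ) (d τ : ℕ) (P : ℝ) (ξ : ℝ → Lp ℂ 2 μ) : Prop where
  mean_zero : ∀ t, ∫ ω, incr μ d (τ * T) ξ t ω ∂μ = 0
  periodic : ∀ t s, inner ℂ (incr μ d (τ * T) ξ (s + T)) (incr μ d (τ * T) ξ (t + T)) =
    inner ℂ (incr μ d (τ * T) ξ s) (incr μ d (τ * T) ξ t)
  memLp : ∀ j : ℤ, MemLp (fun u : ℝ => incr μ d (τ * T) ξ (u + j * T)) 2
    (volume.restrict (Set.Ico 0 T))
  power : ∀ j : ℤ, ∫ u in Set.Ico 0 T, ‖incr μ d (τ * T) ξ (u + j * T)‖ ^ 2 ≤ P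

/-- The processes of the class `Y` whose increment with step `τT` is mean-square continuous and
whose increments with all integer steps are jointly periodically correlated with period `T`. -/
structure MemYCont (μ : Measure Ω) (T : ℝ) (d τ : ℕ) (P : ℝ) (ξ : ℝ → Lp ℂ 2 μ) : Prop
    extends MemY μ T d τ P ξ where
  continuous_incr : Continuous (incr μ d (τ * T) ξ)
  mean_periodic : ∀ (σ : ℤ) (t : ℝ),
    ∫ ω, incr μ d (σ * T) ξ (t + T) ω ∂μ = ∫ ω, incr μ d (σ * T) ξ t ω ∂μ
  jointly_periodic : ∀ (σ₁ σ₂ : ℤ) (t s : ℝ),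
    inner ℂ (incr μ d (σ₂ * T) ξ (s + T)) (incr μ d (σ₁ * T) ξ (t + T)) =
      inner ℂ (incr μ d (σ₂ * T) ξ s) (incr μ d (σ₁ * T) ξ t)

/-- The functional `B_{NT} ξ = ∫_0^{(N+1)T} b^{τ,N}(t) ξ^{(d)}(t,τT) dt`. -/
def BFunctional (μ : Measure Ω) (T : ℝ) (d τ N : ℕ) (a : ℝ → ℂ) (ξ : ℝ → Lp ℂ 2 μ) : Lp ℂ 2 μ :=
  ∫ t in Set.Ico 0 ((N + 1 : ℝ) * T), bFun T d τ N a t • incr μ d (τ * T) ξ t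

/-! ### Linear estimates from the increments at the times `t < 0` -/

/-- A finite linear combination of the past: `∑ c(i,k) ξ_{k,-(i+1)}`, `i ≥ 0`. -/
def finiteRule (μ : Measure Ω) (T : ℝ) (d τ : ℕ) (c : (ℕ × ℕ) →₀ ℂ) (ξ : ℝ → Lp ℂ 2 μ) :
    Lp ℂ 2 μ :=
  c.sum fun i z => z • genCoef μ T d τ ξ (-((i.1 : ℤ) + 1)) i.2

/-- The set `Λ`: an estimate is a rule, the same for all processes of the class, that is the
mean-square limit, on every process of the class, of finite linear combinations of the past. -/
def Estimates (μ : Measure Ω) (T : ℝ) (d τ : ℕ) (P : ℝ) : Set ((ℝ → Lp ℂ 2 μ) → Lp ℂ 2 μ) :=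
  {Bhat | ∃ c : ℕ → ((ℕ × ℕ) →₀ ℂ), ∀ ξ, MemY μ T d τ P ξ →
    Tendsto (fun n => finiteRule μ T d τ (c n) ξ) atTop (𝓝 (Bhat ξ))}

/-- The mean-square error `Δ(ξ, B̂) = E|B_{NT} ξ - B̂ ξ|²`. -/
def mse (μ : Measure Ω) (T : ℝ) (d τ N : ℕ) (a : ℝ → ℂ) (ξ : ℝ → Lp ℂ 2 μ)
    (Bhat : (ℝ → Lp ℂ 2 μ) → Lp ℂ 2 μ) : ℝ :=
  ‖BFunctional μ T d τ N a ξ - Bhat ξ‖ ^ 2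

/-- The closed linear span of the components `ξ_{kj}` with `j ≤ -1`. -/
def pastSpace (μ : Measure Ω) (T : ℝ) (d τ : ℕ) (ξ : ℝ → Lp ℂ 2 μ) : Submodule ℂ (Lp ℂ 2 μ) :=
  (Submodule.span ℂ {x | ∃ j : ℤ, ∃ k : ℕ, j ≤ -1 ∧ x = genCoef μ T d τ ξ j k}).topologicalClosure

/-- The mean-square error of the optimal linear estimate of `B_{NT} ξ` for the process `ξ`, that
is, of the projection of `B_{NT} ξ` on the closed linear span of the past. -/
def optError (μ : Measure Ω) (T : ℝ) (d τ N : ℕ) (a : ℝ → ℂ) (ξ : ℝ → Lp ℂ 2 μ) : ℝ :=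
  (Metric.infDist (BFunctional μ T d τ N a ξ) (pastSpace μ T d τ ξ : Set (Lp ℂ 2 μ))) ^ 2

/-- The process is least favorable in `Y`: its optimal linear estimate has the greatest error. -/
def IsLeastFavorable (μ : Measure Ω) (T : ℝ) (d τ N : ℕ) (P : ℝ) (a : ℝ → ℂ)
    (ξ : ℝ → Lp ℂ 2 μ) : Prop :=
  MemY μ T d τ P ξ ∧ ∀ η, MemY μ T d τ P η → optError μ T d τ N a η ≤ optError μ T d τ N a ξ

/-! ### Moving averages -/

/-- `ε` is an `M`-dimensional stationary sequence with mean zero and orthonormal values. -/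
def IsWhiteNoise (μ : Measure Ω) (M : ℕ) (ε : ℤ → Fin M → Lp ℂ 2 μ) : Prop :=
  (∀ s m, ∫ ω, ε s m ω ∂μ = 0) ∧ Orthonormal ℂ (fun i : ℤ × Fin M => ε i.1 i.2)

/-- The matrices `g(p) = {g_{km}(p)}`, `g_{km}(p) = g m (p,k)`, satisfy
`∑_p ‖g(p)‖² = P`, and each of their columns is an eigenvector for `ν2`, in the form
`∑_{q,n} Q_{kn}(p,q) conj(g_{nm}(q)) = ν2 conj(g_{km}(p))`, or zero. -/
def IsEigenCoef (N M : ℕ) (P ν2 : ℝ) (Q : BlockL2 N →L[ℂ] BlockL2 N)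
    (g : Fin M → BlockL2 N) : Prop :=
  (∀ m, Q (star (g m)) = (ν2 : ℂ) • star (g m)) ∧ ∑ m, ‖g m‖ ^ 2 = P

/-- The generated sequence of `ξ` is the one-sided moving average of order `N`
`ξ_j = ∑_{s=j-N}^{j} g(j-s) ε(s)`; the summation index is `p = j - s`. -/
def IsMovingAverage (μ : Measure Ω) (T : ℝ) (d τ N M : ℕ) (g : Fin M → BlockL2 N)
    (ε : ℤ → Fin M → Lp ℂ 2 μ) (ξ : ℝ → Lp ℂ 2 μ) : Prop :=
  ∀ (j : ℤ) (k : ℕ), genCoef μ T d τ ξ j k =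
    ∑ p : Fin (N + 1), ∑ m : Fin M, (g m (p, k)) • ε (j - ((p : ℕ) : ℤ)) m

end

end PCIncrements

/-! A process of the class acts only through the operators `X j` on `ℓ₂` that send the unit vectors
to the components of its generated sequence (`genOp`). They form a stationary sequence, the square
of the Hilbert–Schmidt norm of each is at most `P`, and the functional becomes `∑_{j ≤ N} X j (b
j)`. Let `Γ = hankel N b` be the operator with the columns `(b_s, …, b_N, 0, …, 0)`. Then `Q = Γ Γ*`
has finite rank, and its greatest eigenvalue is `ν² = ‖Γ‖²`, attained because `Γ` acts on a finite
dimensional space.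

Upper bound. An estimate adds coefficients at negative times, so its error is the output of a filter
whose first `N + 1` coefficients are `b_N, …, b_0` and whose remaining ones are free. By a theorem
of Carathéodory–Fejér and Nehari type they can be chosen so that the convolution operator has norm
at most `‖Γ‖`. The filter then turns input power `P` into output power at most `P ν²`, whatever the
process (`IsStationary.norm_sq_tsum_le`). One rule has to converge on the whole class, so the
coefficients must be absolutely summable. A finite dimensional state-space construction yields such
an extension (`exists_summable_extension`): contractivity comes from an energy inequality,
summability from Cayley–Hamilton.

Lower bound. For a moving average the noise at the times `0, …, N` is orthogonal to the past, and
Bessel's inequality bounds every prediction error below by `∑_m ‖Γ* conj g_m‖²`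
(`le_norm_sq_functional_sub`). This is `P ν²` when the conjugated columns lie in the top eigenspace.
Such processes exist, since every function is a `d`-th increment (`exists_incr_eq`). With the upper
bound this gives the saddle point.

Converse. In general the error is carried by finitely many innovations of the functional, shifted to
the times `0, …, N` (`exists_innovations`). An error equal to `P ν²` forces equality in every
inequality used: the columns are eigenvectors, and Bessel's inequality is sharp for each component,
which makes the sequence a moving average (`exists_movingAverage_of_le`).

Continuous subclass. The least favorable process is approximated by moving averages with continuous
coefficient functions vanishing at the ends of the period. They are driven by smoothed noise, so
that the process itself, and hence every increment of it, is periodically correlated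
(`le_of_optError_le_of_memYCont`). -/

namespace PCIncrements

noncomputable section

open scoped InnerProductSpace ENNReal

/-! ### A Carathéodory–Fejér extension with summable coefficients -/

section Extension

/-- A null sequence that is annihilated by a nonzero polynomial in the left shift is absolutely
summable. -/
theorem summable_norm_of_recurrence {K : Type*} [NormedAddCommGroup K] [NormedSpace ℂ K]
    (L : (ℕ → K) →ₗ[ℂ] (ℕ → K)) (hL : ∀ G n, L G n = G (n + 1)) (n : ℕ) :
    ∀ (χ : Polynomial ℂ), χ ≠ 0 → χ.natDegree = n → ∀ G : ℕ → K, Tendsto G atTop (𝓝 0) →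
      Polynomial.aeval L χ G = 0 → Summable fun i => ‖G i‖ := by
  induction n with
  | zero =>
    intro χ hχ hdeg G _ hG
    rw [Polynomial.eq_C_of_natDegree_eq_zero hdeg] at hχ hG
    have hc : χ.coeff 0 ≠ 0 := fun h => hχ (by rw [h, map_zero])
    have : G = 0 := by
      simpa [Polynomial.aeval_C, Module.algebraMap_end_apply, hc] using hG
    simp [this, summable_zero]
  | succ n ih =>
    intro χ hχ hdeg G hG0 hG
    obtain ⟨z, hz⟩ := IsAlgClosed.exists_root χ (by
      rw [Polynomial.degree_eq_natDegree hχ, hdeg]; exact_mod_cast Nat.succ_ne_zero n)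
    obtain ⟨χ', rfl⟩ := Polynomial.dvd_iff_isRoot.mpr hz
    have hχ' : χ' ≠ 0 := right_ne_zero_of_mul hχ
    have hdeg' : χ'.natDegree = n := by
      rw [Polynomial.natDegree_mul (Polynomial.X_sub_C_ne_zero z) hχ',
        Polynomial.natDegree_X_sub_C] at hdeg
      omega
    have hstep : ∀ (F : ℕ → K) i,
        (Polynomial.aeval L (Polynomial.X - Polynomial.C z) F) i = F (i + 1) - z • F i := by
      intro F i
      simp [hL, Module.algebraMap_end_apply]
    have htail : ∀ (q : Polynomial ℂ) (F : ℕ → K), Tendsto F atTop (𝓝 0) →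
        Tendsto (Polynomial.aeval L q F) atTop (𝓝 0) := by
      intro q
      induction q using Polynomial.induction_on' with
      | add p q hp hq =>
        intro F hF
        have := (hp F hF).add (hq F hF)
        rw [add_zero] at this
        rw [map_add]
        exact this
      | monomial k c =>
        intro F hF
        have hk : ∀ k (F : ℕ → K) i, (L ^ k) F i = F (i + k) := by
          intro k
          induction k with
          | zero => intro F i; simp
          | succ k ihk => intro F i; rw [pow_succ', Module.End.mul_apply, hL, ihk]; ring_nf
        have h1 : Tendsto (fun i => c • F (i + k)) atTop (𝓝 (c • (0 : K))) :=
          ((tendsto_add_atTop_iff_nat k).mpr hF).const_smul c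
        rw [smul_zero] at h1
        refine h1.congr fun i => ?_
        rw [Polynomial.aeval_monomial, Module.End.mul_apply, Module.algebraMap_end_apply,
          Pi.smul_apply, hk]
    -- For a root inside the unit disc, `(L - z) G` is summable by induction and drives a stable
    -- first-order recursion for `G`. For any other root, `χ'(L) G` is a null sequence whose norms
    -- do not decrease, so it vanishes and the degree drops.
    by_cases hz1 : ‖z‖ < 1
    · set H := Polynomial.aeval L (Polynomial.X - Polynomial.C z) G with hH
      have hHs : Summable fun i => ‖H i‖ := by
        refine ih χ' hχ' hdeg' H (htail _ _ hG0) ?_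
        rw [hH, ← Module.End.mul_apply, ← map_mul, mul_comm]; exact hG
      have hb : ∀ i, ‖G (i + 1)‖ ≤ ‖z‖ * ‖G i‖ + ‖H i‖ := by
        intro i
        have : G (i + 1) = z • G i + H i := by rw [hH, hstep]; abel
        rw [this]
        exact (norm_add_le _ _).trans (by rw [norm_smul])
      refine summable_of_sum_range_le (c := (‖G 0‖ + ∑' i, ‖H i‖) / (1 - ‖z‖))
        (fun i => norm_nonneg _) fun m => ?_
      rw [le_div_iff₀ (by linarith)]
      have h1 : ∑ i ∈ Finset.range (m + 1), ‖G i‖ ≤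
          ‖z‖ * ∑ i ∈ Finset.range m, ‖G i‖ + ∑ i ∈ Finset.range m, ‖H i‖ + ‖G 0‖ := by
        rw [Finset.sum_range_succ', Finset.mul_sum, ← Finset.sum_add_distrib]
        gcongr with i
        exact hb i
      have h2 : ∑ i ∈ Finset.range m, ‖H i‖ ≤ ∑' i, ‖H i‖ :=
        hHs.sum_le_tsum _ fun i _ => norm_nonneg _
      rw [Finset.sum_range_succ] at h1
      nlinarith [norm_nonneg (G m)]
    · refine ih χ' hχ' hdeg' G hG0 ?_
      set H := Polynomial.aeval L χ' G with hH
      have hH0 : Tendsto H atTop (𝓝 0) := htail _ _ hG0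
      have hrec : ∀ i, H (i + 1) = z • H i := by
        intro i
        have : Polynomial.aeval L (Polynomial.X - Polynomial.C z) H i = 0 := by
          rw [hH, ← Module.End.mul_apply, ← map_mul, hG]; rfl
        rw [hstep] at this
        exact sub_eq_zero.mp this
      have hmono : ∀ i k, ‖H i‖ ≤ ‖H (i + k)‖ := by
        intro i k
        induction k with
        | zero => simp
        | succ k ihk =>
          rw [← add_assoc, hrec, norm_smul]
          nlinarith [norm_nonneg (H (i + k)), not_lt.mp hz1]
      funext i
      have h1 : Tendsto (fun k => ‖H (i + k)‖) atTop (𝓝 0) := by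
        have := ((tendsto_add_atTop_iff_nat i).mpr hH0).norm
        simpa [add_comm] using this
      have := ge_of_tendsto' h1 (hmono i)
      exact norm_le_zero_iff.mp this

theorem exists_norm_sq_eq_of_isPositive {E : Type*} [NormedAddCommGroup E]
    [InnerProductSpace ℂ E] [CompleteSpace E] (M : E →L[ℂ] E) (hM : M.IsPositive) :
    ∃ D : E →L[ℂ] E, ∀ x, ‖D x‖ ^ 2 = (inner ℂ x (M x)).re := by
  have h0 : 0 ≤ M := (ContinuousLinearMap.nonneg_iff_isPositive M).mpr hM
  refine ⟨CFC.sqrt M, fun x => ?_⟩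
  have hs : IsSelfAdjoint (CFC.sqrt M) := (CFC.sqrt_nonneg M).isSelfAdjoint
  have hadj : ContinuousLinearMap.adjoint (CFC.sqrt M) = CFC.sqrt M := hs.adjoint_eq
  have h2 : M x = CFC.sqrt M (CFC.sqrt M x) := by
    conv_lhs => rw [← CFC.sqrt_mul_sqrt_self M h0]
    rfl
  conv_rhs => rw [h2, ← ContinuousLinearMap.adjoint_inner_left, hadj]
  rw [inner_self_eq_norm_sq_to_K]
  norm_cast

/-- A left shift of the input moves the rows of the Hankel matrix down by one and exposes one new
row, the output at the present time. Nothing is lost at the bottom, because the last row sees only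
`p 0 = 0`, and the appended entry `c` enters only the new row, because `b` vanishes beyond `N`. -/
theorem hankel_shift_energy {K : Type*} [NormedAddCommGroup K] [InnerProductSpace ℂ K]
    (N : ℕ) (b : ℕ → K) (hb : ∀ j, N < j → b j = 0)
    (p : Fin (N + 1) → ℂ) (hp : p 0 = 0) (c : ℂ) :
    ∑ r ∈ Finset.range (N + 1),
        ‖∑ s, (Fin.snoc (Fin.tail p) c : Fin (N + 1) → ℂ) s • b (s + r)‖ ^ 2 =
      ‖∑ s, (Fin.snoc (Fin.tail p) c : Fin (N + 1) → ℂ) s • b s‖ ^ 2 +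
        ∑ r ∈ Finset.range (N + 1), ‖∑ s, p s • b (s + r)‖ ^ 2 := by
  rw [Finset.sum_range_succ', Finset.sum_range_succ (n := N), add_comm]
  have hlast : ∑ s, p s • b (s + N) = 0 := by
    rw [Fin.sum_univ_succ, hp, zero_smul, zero_add]
    refine Finset.sum_eq_zero fun i _ => ?_
    rw [hb _ (by simp), smul_zero]
  rw [hlast, norm_zero, zero_pow two_ne_zero, add_zero]
  simp only [add_zero]
  congr 1
  refine Finset.sum_congr rfl fun r _ => ?_
  rw [Fin.sum_univ_castSucc, Fin.sum_univ_succ, hp, zero_smul, zero_add]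
  simp only [Fin.snoc_castSucc, Fin.snoc_last, Fin.val_castSucc, Fin.val_last, Fin.tail,
    Fin.val_succ]
  rw [hb (N + (r + 1)) (by omega), smul_zero, add_zero]
  congr 2
  refine Finset.sum_congr rfl fun i _ => ?_
  congr 2
  omega

variable {K : Type*} [NormedAddCommGroup K] [InnerProductSpace ℂ K] [CompleteSpace K]

/-- The quadratic form `ν2 ‖p‖² - ‖Γ p‖²` of a Hankel operator `Γ` with `‖Γ‖² ≤ ν2` is the square
of a seminorm. -/
theorem exists_hankel_defect (N : ℕ) (b : ℕ → K) (ν2 : ℝ)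
    (hΓ : ∀ p : Fin (N + 1) → ℂ,
      ∑ r ∈ Finset.range (N + 1), ‖∑ s, p s • b (s + r)‖ ^ 2 ≤ ν2 * ∑ s, ‖p s‖ ^ 2) :
    ∃ D : (Fin (N + 1) → ℂ) →ₗ[ℂ] EuclideanSpace ℂ (Fin (N + 1)), ∀ p,
      ‖D p‖ ^ 2 + ∑ r ∈ Finset.range (N + 1), ‖∑ s, p s • b (s + r)‖ ^ 2 =
        ν2 * ∑ s, ‖p s‖ ^ 2 := by
  let G : EuclideanSpace ℂ (Fin (N + 1)) →L[ℂ] PiLp 2 (fun _ : Fin (N + 1) => K) :=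
    LinearMap.toContinuousLinearMap
      ((WithLp.linearEquiv 2 ℂ (Fin (N + 1) → K)).symm.toLinearMap ∘ₗ
        LinearMap.pi (fun r : Fin (N + 1) => ∑ s : Fin (N + 1),
          (LinearMap.toSpanSingleton ℂ K (b (s + r))) ∘ₗ
            (EuclideanSpace.proj (𝕜 := ℂ) s).toLinearMap))
  have hG : ∀ p r, (G p) r = ∑ s, p s • b (s + r) := by
    intro p r
    simp [G]
  have hGn : ∀ p, ‖G p‖ ^ 2 = ∑ r ∈ Finset.range (N + 1), ‖∑ s, p s • b (s + r)‖ ^ 2 := by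
    intro p
    rw [PiLp.norm_sq_eq_of_L2, ← Fin.sum_univ_eq_sum_range
      (fun r => ‖∑ s, p s • b (s + r)‖ ^ 2)]
    simp [hG]
  let M : EuclideanSpace ℂ (Fin (N + 1)) →L[ℂ] EuclideanSpace ℂ (Fin (N + 1)) :=
    (ν2 : ℂ) • ContinuousLinearMap.id ℂ _ - (ContinuousLinearMap.adjoint G).comp G
  have hMx : ∀ x, (inner ℂ x (M x)).re = ν2 * ‖x‖ ^ 2 - ‖G x‖ ^ 2 := by
    intro x
    simp only [M, sub_apply, smul_apply,
      ContinuousLinearMap.comp_apply, ContinuousLinearMap.id_apply, inner_sub_right,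
      inner_smul_right, ContinuousLinearMap.adjoint_inner_right, inner_self_eq_norm_sq_to_K]
    simp only [Complex.coe_algebraMap, ← Complex.ofReal_pow, ← Complex.ofReal_mul,
      ← Complex.ofReal_sub, Complex.ofReal_re]
  have hM : M.IsPositive := by
    rw [ContinuousLinearMap.isPositive_def']
    constructor
    · refine IsSelfAdjoint.sub ?_ (ContinuousLinearMap.isPositive_adjoint_comp_self G).isSelfAdjoint
      refine IsSelfAdjoint.smul ?_ (IsSelfAdjoint.one _)
      exact Complex.conj_ofReal ν2
    · intro x
      rw [ContinuousLinearMap.reApplyInnerSelf_apply, inner_re_symm]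
      change 0 ≤ (inner ℂ x (M x)).re
      rw [hMx, hGn, EuclideanSpace.norm_sq_eq]
      linarith [hΓ x]
  obtain ⟨D, hD⟩ := exists_norm_sq_eq_of_isPositive M hM
  refine ⟨D.toLinearMap ∘ₗ (WithLp.linearEquiv 2 ℂ (Fin (N + 1) → ℂ)).symm.toLinearMap,
    fun p => ?_⟩
  have h := hD (WithLp.toLp 2 p)
  rw [hMx, hGn, EuclideanSpace.norm_sq_eq (WithLp.toLp 2 p)] at h
  simp only [LinearMap.coe_comp, Function.comp_apply, ContinuousLinearMap.coe_coe,
    LinearEquiv.coe_coe, WithLp.coe_symm_linearEquiv]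
  rw [h]
  simp

/-- A finite sequence `b_N, …, b_0` of vectors whose Hankel operator has norm at most `√ν2`
extends to an absolutely summable sequence whose convolution operator has norm at most `√ν2`. -/
theorem exists_summable_extension (N : ℕ) (b : ℕ → K) (hb : ∀ j, N < j → b j = 0) (ν2 : ℝ)
    (hΓ : ∀ p : Fin (N + 1) → ℂ,
      ∑ r ∈ Finset.range (N + 1), ‖∑ s, p s • b (s + r)‖ ^ 2 ≤ ν2 * ∑ s, ‖p s‖ ^ 2) :
    ∃ F : ℕ → K, (∀ j ≤ N, F j = b (N - j)) ∧ (Summable fun j => ‖F j‖) ∧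
      ∀ (n : ℕ) (p : ℕ → ℂ),
        ∑ m ∈ Finset.range n, ‖∑ i ∈ Finset.range (m + 1), p i • F (m - i)‖ ^ 2 ≤
          ν2 * ∑ i ∈ Finset.range n, ‖p i‖ ^ 2 := by
  obtain ⟨D, hD⟩ := exists_hankel_defect N b ν2 hΓ
  let S : Submodule ℂ (Fin (N + 1) → ℂ) := LinearMap.ker (LinearMap.proj 0)
  -- Vectors of `Fin (N + 1) → ℂ` serve as states, with stored energy `‖D p‖²`. Before a shift the
  -- coordinate `p 0` has to be cleared. Subtracting `p 0 • e0` does this without raising the stored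
  -- energy, because `D e0` is orthogonal to `D S`.
  obtain ⟨y, hyS, hy⟩ : ∃ y ∈ S, ∀ s ∈ S, inner ℂ (D s) (D (Pi.single 0 1 - y)) = 0 := by
    obtain ⟨y, hyS, hy⟩ := Submodule.mem_map.mp
      ((S.map D).starProjection_apply_mem (D (Pi.single 0 1)))
    refine ⟨y, hyS, fun s hs => ?_⟩
    rw [map_sub, hy]
    exact Submodule.inner_right_of_mem_orthogonal (Submodule.mem_map_of_mem hs)
      ((S.map D).sub_starProjection_mem_orthogonal _)
  have hy0 : y 0 = 0 := hyS
  let e0 : Fin (N + 1) → ℂ := Pi.single 0 1 - y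
  have he0 : e0 0 = 1 := by simp [e0, hy0]
  let Pr : (Fin (N + 1) → ℂ) →ₗ[ℂ] (Fin (N + 1) → ℂ) :=
    LinearMap.id - (LinearMap.toSpanSingleton ℂ _ e0) ∘ₗ (LinearMap.proj 0)
  have hPr : ∀ p, Pr p = p - p 0 • e0 := fun p => by simp [Pr]
  have hPr0 : ∀ p, Pr p 0 = 0 := fun p => by simp [hPr, he0]
  let sh : (Fin (N + 1) → ℂ) →ₗ[ℂ] (Fin (N + 1) → ℂ) :=
    { toFun := fun p => Fin.snoc (Fin.tail p) 0
      map_add' := fun p q => by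
        ext i; refine Fin.lastCases ?_ (fun i => ?_) i <;> simp [Fin.tail]
      map_smul' := fun c p => by
        ext i; refine Fin.lastCases ?_ (fun i => ?_) i <;> simp [Fin.tail] }
  have hsh : ∀ p (c : ℂ), sh p + c • (Pi.single (Fin.last N) 1 : Fin (N + 1) → ℂ) =
      Fin.snoc (Fin.tail p) c := by
    intro p c
    ext i
    refine Fin.lastCases ?_ (fun i => ?_) i
    · simp [sh]
    · simp [sh, Fin.tail]
  -- The extension is the impulse response of the system `x ↦ A x + c • e` with the output `β` of
  -- the new state: clear the first slot, shift, and feed the input into the last slot.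
  let A := sh ∘ₗ Pr
  let e : Fin (N + 1) → ℂ := Pi.single (Fin.last N) 1
  let β : (Fin (N + 1) → ℂ) →ₗ[ℂ] K :=
    ∑ s : Fin (N + 1), (LinearMap.toSpanSingleton ℂ K (b s)) ∘ₗ LinearMap.proj s
  have hβ : ∀ p, β p = ∑ s, p s • b s := fun p => by simp [β]
  -- the energy inequality
  have hproj : ∀ p, ‖D (Pr p)‖ ^ 2 ≤ ‖D p‖ ^ 2 := by
    intro p
    have h1 : D p = D (Pr p) + p 0 • D e0 := by rw [hPr, map_sub, map_smul]; abel
    have h2 : inner ℂ (D (Pr p)) (p 0 • D e0) = 0 := by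
      rw [inner_smul_right, hy (Pr p) (hPr0 p), mul_zero]
    rw [h1, @norm_add_sq ℂ, h2]
    simp only [map_zero, mul_zero, add_zero]
    nlinarith [sq_nonneg ‖p 0 • D e0‖]
  -- The defect identities at `Pr x` and at the new state differ, by the shift identity, exactly by
  -- the output energy and the input energy `ν2 ‖c‖²`. The system is therefore dissipative, and
  -- summing along a trajectory bounds the convolution operator.
  have henergy : ∀ x (c : ℂ), ‖D (A x + c • e)‖ ^ 2 + ‖β (A x + c • e)‖ ^ 2 ≤
      ‖D x‖ ^ 2 + ν2 * ‖c‖ ^ 2 := by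
    intro x c
    have hx : A x + c • e = Fin.snoc (Fin.tail (Pr x)) c := hsh _ _
    have h1 := hD (A x + c • e)
    have h2 := hD (Pr x)
    have h3 := hankel_shift_energy N b hb (Pr x) (hPr0 x) c
    have h4 : ∑ s, ‖(A x + c • e) s‖ ^ 2 = ∑ s, ‖Pr x s‖ ^ 2 + ‖c‖ ^ 2 := by
      rw [hx, Fin.sum_univ_castSucc, Fin.sum_univ_succ (fun s => ‖Pr x s‖ ^ 2), hPr0]
      simp [Fin.tail]
    rw [← hx, ← hβ] at h3
    rw [h4, h3] at h1
    have := hproj x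
    nlinarith
  let F : ℕ → K := fun j => β ((A ^ j) e)
  have hconv : ∀ (p : ℕ → ℂ) m, ∑ i ∈ Finset.range (m + 1), p i • F (m - i) =
      β (∑ i ∈ Finset.range (m + 1), p i • (A ^ (m - i)) e) := by
    intro p m
    simp [F, map_sum]
  have hstate : ∀ (p : ℕ → ℂ) m, ∑ i ∈ Finset.range (m + 1 + 1), p i • (A ^ (m + 1 - i)) e =
      A (∑ i ∈ Finset.range (m + 1), p i • (A ^ (m - i)) e) + p (m + 1) • e := by
    intro p m
    rw [Finset.sum_range_succ, map_sum]
    congr 1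
    · refine Finset.sum_congr rfl fun i hi => ?_
      have : m + 1 - i = (m - i) + 1 := by have := Finset.mem_range.mp hi; omega
      rw [this, pow_succ', map_smul, Module.End.mul_apply]
    · simp
  have hbound : ∀ (p : ℕ → ℂ) n,
      ‖D (∑ i ∈ Finset.range (n + 1), p i • (A ^ (n - i)) e)‖ ^ 2 +
        ∑ m ∈ Finset.range (n + 1), ‖∑ i ∈ Finset.range (m + 1), p i • F (m - i)‖ ^ 2 ≤
          ν2 * ∑ i ∈ Finset.range (n + 1), ‖p i‖ ^ 2 := by
    intro p n
    induction n with
    | zero =>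
      have := henergy 0 (p 0)
      simp only [map_zero, zero_add, norm_zero, zero_pow two_ne_zero] at this
      simpa [F] using this
    | succ n ih =>
      have := henergy (∑ i ∈ Finset.range (n + 1), p i • (A ^ (n - i)) e) (p (n + 1))
      rw [Finset.sum_range_succ (fun m => ‖∑ i ∈ Finset.range (m + 1), p i • F (m - i)‖ ^ 2) (n + 1),
        Finset.sum_range_succ (fun i => ‖p i‖ ^ 2) (n + 1), hconv p (n + 1), hstate]
      linarith
  have hop : ∀ (n : ℕ) (p : ℕ → ℂ),
      ∑ m ∈ Finset.range n, ‖∑ i ∈ Finset.range (m + 1), p i • F (m - i)‖ ^ 2 ≤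
        ν2 * ∑ i ∈ Finset.range n, ‖p i‖ ^ 2 := by
    intro n p
    cases n with
    | zero => simp
    | succ n => nlinarith [hbound p n,
        sq_nonneg ‖D (∑ i ∈ Finset.range (n + 1), p i • (A ^ (n - i)) e)‖]
  refine ⟨F, ?_, ?_, hop⟩
  -- The impulse moves down one slot per step and reaches slot `0` only at the time `N`. Until then
  -- the clearing map `Pr` does nothing, so the outputs are the prescribed `b (N - j)`.
  · have hpow : ∀ j (hj : j ≤ N), (A ^ j) e = Pi.single ⟨N - j, by omega⟩ 1 := by
      intro j
      induction j with
      | zero => intro _; rfl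
      | succ j ih =>
        intro hj
        rw [pow_succ', Module.End.mul_apply, ih (by omega)]
        have h0 : (Pi.single (⟨N - j, by omega⟩ : Fin (N + 1)) (1 : ℂ) : Fin (N + 1) → ℂ) 0 = 0 := by
          rw [Pi.single_apply, if_neg]
          intro h
          have := congrArg Fin.val h
          simp at this
          omega
        change sh (Pr _) = _
        rw [hPr, h0, zero_smul, sub_zero]
        ext i
        refine Fin.lastCases ?_ (fun i => ?_) i
        · have : Fin.last N ≠ ⟨N - (j + 1), by omega⟩ := by
            intro h
            have := congrArg Fin.val h
            simp at this
            omega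
          simp [sh, this]
        · simp only [sh, LinearMap.coe_mk, AddHom.coe_mk, Fin.snoc_castSucc, Fin.tail,
            Pi.single_apply, Fin.ext_iff, Fin.val_succ, Fin.val_castSucc]
          congr 1
          simp only [eq_iff_iff]
          omega
    intro j hj
    change β ((A ^ j) e) = _
    rw [hpow j hj, hβ]
    simp [Pi.single_apply]
  -- The unit impulse as input turns the operator bound into square summability, hence `F → 0`. The
  -- recurrence lemma upgrades this to absolute summability.
  · have hsq : Summable fun j => ‖F j‖ ^ 2 := by
      refine summable_of_sum_range_le (c := ν2) (fun j => sq_nonneg _) fun n => ?_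
      have := hop n (fun i => if i = 0 then 1 else 0)
      have h1 : ∀ m, ∑ i ∈ Finset.range (m + 1),
          (if i = 0 then (1 : ℂ) else 0) • F (m - i) = F m := by
        intro m
        simp [ite_smul]
      simp only [h1] at this
      refine this.trans ?_
      have hν : 0 ≤ ν2 := by
        have h := hop 1 (fun i => 1)
        simp at h
        exact (sq_nonneg _).trans h
      cases n with
      | zero => simpa using hν
      | succ n =>
        rw [Finset.sum_range_succ']
        simp
    have h0 : Tendsto F atTop (𝓝 0) := by
      rw [tendsto_zero_iff_norm_tendsto_zero]
      have h := hsq.tendsto_atTop_zero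
      have h2 := (Real.continuous_sqrt.tendsto 0).comp h
      simpa [Function.comp_def, Real.sqrt_sq] using h2
    -- A left shift of `F` applies `A` to the state, so by Cayley–Hamilton the characteristic
    -- polynomial of `A` in `L` annihilates `F`.
    let L : (ℕ → K) →ₗ[ℂ] (ℕ → K) := LinearMap.funLeft ℂ K Nat.succ
    refine summable_norm_of_recurrence L (fun G n => rfl) _ A.charpoly
      A.charpoly_monic.ne_zero rfl F h0 ?_
    have hq : ∀ (q : Polynomial ℂ) (x : Fin (N + 1) → ℂ) j,
        Polynomial.aeval L q (fun j => β ((A ^ j) x)) j =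
          β ((A ^ j) (Polynomial.aeval A q x)) := by
      intro q
      induction q using Polynomial.induction_on' with
      | add p q hp hq => intro x j; simp [hp, hq]
      | monomial k c =>
        intro x j
        have hk : ∀ k (G : ℕ → K) i, (L ^ k) G i = G (i + k) := by
          intro k
          induction k with
          | zero => intro F i; simp
          | succ k ihk =>
            intro F i
            rw [pow_succ', Module.End.mul_apply]
            change (L ^ k) F (i + 1) = _
            rw [ihk]; ring_nf
        simp [Polynomial.aeval_monomial, Module.algebraMap_end_apply, hk, pow_add]
    funext j
    rw [show F = fun j => β ((A ^ j) e) from rfl, hq, LinearMap.aeval_self_charpoly]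
    simp

end Extension

/-! ### Filtering of stationary sequences of Hilbert–Schmidt operators -/

section Filtering

theorem enorm_sq_eq_ofReal {E : Type*} [SeminormedAddCommGroup E] (x : E) :
    ‖x‖ₑ ^ 2 = ENNReal.ofReal (‖x‖ ^ 2) := by
  rw [ENNReal.ofReal_pow (norm_nonneg x), ofReal_norm]

variable {K H : Type*} [NormedAddCommGroup K] [InnerProductSpace ℂ K]
  [NormedAddCommGroup H] [InnerProductSpace ℂ H]

theorem hasSum_norm_sq_inner {ι : Type*} (η : HilbertBasis ι ℂ H) (x : H) :
    HasSum (fun i => ‖inner ℂ (η i) x‖ ^ 2) (‖x‖ ^ 2) := by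
  have h := η.hasSum_inner_mul_inner x x
  rw [inner_self_eq_norm_sq_to_K] at h
  rw [← Complex.hasSum_ofReal]
  push_cast
  have e : (fun i => inner ℂ x (η i) * inner ℂ (η i) x) =
      fun i => ((‖inner ℂ (η i) x‖ : ℂ)) ^ 2 := by
    funext i
    rw [← inner_conj_symm, Complex.conj_mul']
  rw [← e]
  exact h

theorem enorm_sq_eq_tsum_inner {ι : Type*} (η : HilbertBasis ι ℂ H) (x : H) :
    ‖x‖ₑ ^ 2 = ∑' i, ‖inner ℂ (η i) x‖ₑ ^ 2 := by
  have h := hasSum_norm_sq_inner η x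
  simp only [enorm_sq_eq_ofReal]
  rw [← h.tsum_eq, ENNReal.ofReal_tsum_of_nonneg (fun i => sq_nonneg _) h.summable]

/-- The Hilbert–Schmidt norms of an operator and of its adjoint agree. -/
theorem tsum_enorm_sq_adjoint [CompleteSpace K] [CompleteSpace H] {ι ι' : Type*}
    (κ : HilbertBasis ι ℂ K) (η : HilbertBasis ι' ℂ H) (X : K →L[ℂ] H) :
    ∑' i, ‖ContinuousLinearMap.adjoint X (η i)‖ₑ ^ 2 = ∑' k, ‖X (κ k)‖ₑ ^ 2 := by
  simp_rw [enorm_sq_eq_tsum_inner κ, enorm_sq_eq_tsum_inner η (X _)]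
  rw [ENNReal.tsum_comm]
  refine tsum_congr fun k => tsum_congr fun i => ?_
  rw [ContinuousLinearMap.adjoint_inner_right, ← inner_conj_symm, RCLike.enorm_conj]

theorem sum_range_triangle_reflect {M : Type*} [AddCommMonoid M] (n : ℕ) (f : ℕ → ℕ → M) :
    ∑ t ∈ Finset.range n, ∑ s ∈ Finset.range (t + 1), f s t =
      ∑ s ∈ Finset.range n, ∑ i ∈ Finset.range (n - 1 - s + 1), f s (n - 1 - i) := by
  rw [Finset.sum_sigma', Finset.sum_sigma']
  refine Finset.sum_nbij' (fun x => ⟨x.2, n - 1 - x.1⟩) (fun x => ⟨n - 1 - x.2, x.1⟩) ?_ ?_ ?_ ?_ ?_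
  · rintro ⟨t, s⟩ h; simp only [Finset.mem_sigma, Finset.mem_range] at h ⊢; omega
  · rintro ⟨t, s⟩ h; simp only [Finset.mem_sigma, Finset.mem_range] at h ⊢; omega
  · rintro ⟨t, s⟩ h
    simp only [Finset.mem_sigma, Finset.mem_range] at h ⊢
    rw [Nat.sub_sub_self (by omega)]
  · rintro ⟨t, s⟩ h
    simp only [Finset.mem_sigma, Finset.mem_range] at h ⊢
    rw [Nat.sub_sub_self (by omega)]
  · rintro ⟨t, s⟩ h
    simp only [Finset.mem_sigma, Finset.mem_range] at h ⊢
    rw [Nat.sub_sub_self (by omega)]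

/-- A bound on a convolution operator bounds the transposed convolution operator. -/
theorem transposed_convolution_bound (F : ℕ → K) (ν2 : ℝ) (hν : 0 ≤ ν2)
    (hF : ∀ (n : ℕ) (p : ℕ → ℂ),
        ∑ m ∈ Finset.range n, ‖∑ i ∈ Finset.range (m + 1), p i • F (m - i)‖ ^ 2 ≤
          ν2 * ∑ i ∈ Finset.range n, ‖p i‖ ^ 2) (n : ℕ) (y : ℕ → K) :
    ∑ t ∈ Finset.range n, ‖∑ s ∈ Finset.range (t + 1), inner ℂ (y s) (F (t - s))‖ ^ 2 ≤
      ν2 * ∑ s ∈ Finset.range n, ‖y s‖ ^ 2 := by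
  -- Duality: `R = ∑ ‖z t‖²` is the pairing of `y` with `w`, where `w` is the convolution of `F`
  -- with the conjugated, time-reversed `z`, read backwards. The hypothesis gives `∑ ‖w s‖² ≤ ν2 R`,
  -- and Cauchy–Schwarz yields `R² ≤ (∑ ‖y s‖²) ν2 R`.
  set z : ℕ → ℂ := fun t => ∑ s ∈ Finset.range (t + 1), inner ℂ (y s) (F (t - s)) with hz
  set p : ℕ → ℂ := fun i => (starRingEnd ℂ) (z (n - 1 - i)) with hp
  set w : ℕ → K := fun s => ∑ i ∈ Finset.range (n - 1 - s + 1), p i • F (n - 1 - s - i) with hw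
  set R := ∑ t ∈ Finset.range n, ‖z t‖ ^ 2 with hR
  have h1 : (R : ℂ) = ∑ s ∈ Finset.range n, inner ℂ (y s) (w s) := by
    rw [hR]
    push_cast
    have : ∀ t, ((‖z t‖ : ℂ)) ^ 2 =
        ∑ s ∈ Finset.range (t + 1), (starRingEnd ℂ) (z t) * inner ℂ (y s) (F (t - s)) := by
      intro t
      rw [← Finset.mul_sum, ← Complex.conj_mul']
    simp_rw [this]
    rw [sum_range_triangle_reflect n
      (fun s t => (starRingEnd ℂ) (z t) * inner ℂ (y s) (F (t - s)))]
    refine Finset.sum_congr rfl fun s hs => ?_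
    rw [hw, inner_sum]
    refine Finset.sum_congr rfl fun i hi => ?_
    rw [inner_smul_right, Nat.sub_right_comm (n - 1) s i]
  have h2 : R ≤ ∑ s ∈ Finset.range n, ‖y s‖ * ‖w s‖ := by
    have hR0 : 0 ≤ R := Finset.sum_nonneg fun t _ => sq_nonneg _
    have : R = ‖(R : ℂ)‖ := by rw [Complex.norm_real, Real.norm_of_nonneg hR0]
    rw [this, h1]
    refine (norm_sum_le _ _).trans (Finset.sum_le_sum fun s _ => norm_inner_le_norm _ _)
  have h3 : ∑ s ∈ Finset.range n, ‖w s‖ ^ 2 ≤ ν2 * R := by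
    have h := hF n p
    rw [← Finset.sum_range_reflect,
      ← Finset.sum_range_reflect (fun i => ‖p i‖ ^ 2)] at h
    refine h.trans (le_of_eq ?_)
    congr 1
    refine Finset.sum_congr rfl fun i hi => ?_
    have : n - 1 - (n - 1 - i) = i := by have := Finset.mem_range.mp hi; omega
    simp only [hp, RCLike.norm_conj, this]
  have h4 := Finset.sum_mul_sq_le_sq_mul_sq (Finset.range n) (fun s => ‖y s‖) (fun s => ‖w s‖)
  have hR0 : 0 ≤ R := Finset.sum_nonneg fun t _ => sq_nonneg _
  have hY0 : 0 ≤ ∑ s ∈ Finset.range n, ‖y s‖ ^ 2 := Finset.sum_nonneg fun t _ => sq_nonneg _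
  rcases hR0.eq_or_lt with h0 | h0
  · rw [← h0]; positivity
  · have h5 : R ^ 2 ≤ (∑ s ∈ Finset.range n, ‖y s‖ ^ 2) * (ν2 * R) :=
      (pow_le_pow_left₀ hR0 h2 2).trans (h4.trans (by gcongr))
    nlinarith

/-- The sequence of operators is stationary: its Gram function is invariant under the shift. -/
def IsStationary (X : ℤ → K →L[ℂ] H) : Prop :=
  ∀ i j f g, inner ℂ (X (i + 1) f) (X (j + 1) g) = inner ℂ (X i f) (X j g)

namespace IsStationary

variable {X : ℤ → K →L[ℂ] H}

theorem inner_add (hX : IsStationary X) (c i j : ℤ) (f g : K) :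
    inner ℂ (X (i + c) f) (X (j + c) g) = inner ℂ (X i f) (X j g) := by
  induction c with
  | zero => simp
  | succ c ih => rw [← ih, ← add_assoc, ← add_assoc, hX]
  | pred c ih =>
    rw [← ih, ← hX]
    congr 3 <;> ring

theorem norm_sum_add (hX : IsStationary X) {ι : Type*} (s : Finset ι) (n : ι → ℤ) (f : ι → K)
    (c : ℤ) : ‖∑ i ∈ s, X (n i + c) (f i)‖ = ‖∑ i ∈ s, X (n i) (f i)‖ := by
  rw [← sq_eq_sq₀ (norm_nonneg _) (norm_nonneg _)]
  have : ∀ x : H, ‖x‖ ^ 2 = (inner ℂ x x).re := fun x => by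
    rw [inner_self_eq_norm_sq_to_K]; norm_cast
  rw [this, this]
  simp only [sum_inner, inner_sum, hX.inner_add]

theorem norm_apply (hX : IsStationary X) (j : ℤ) (f : K) : ‖X j f‖ = ‖X 0 f‖ := by
  simpa using hX.norm_sum_add {()} (fun _ => 0) (fun _ => f) j

theorem summable_norm_apply (hX : IsStationary X) {F : ℕ → K} (hF : Summable fun j => ‖F j‖)
    (n : ℕ → ℤ) : Summable fun j => ‖X (n j) (F j)‖ :=
  Summable.of_nonneg_of_le (fun _ => norm_nonneg _)
    (fun j => by rw [hX.norm_apply]; exact (X 0).le_opNorm _) (hF.mul_left ‖X 0‖)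

/-- A time-domain substitute for integrating a spectral density against the squared symbol of the
filter. The filter is started at time `0`. Against each vector of an orthonormal basis of `H` its
output is a transposed convolution applied to the vectors `(X s)* η`, and summing over the basis
replaces these by Hilbert–Schmidt norms. The first `n` outputs thus have total power at most `n P
ν2`. By stationarity the output at time `t` has the norm of a partial sum of the series, so the
Cesàro means converge to the required quantity. -/
theorem norm_sq_tsum_le [CompleteSpace K] [CompleteSpace H] (hX : IsStationary X) {ι : Type*}
    (κ : HilbertBasis ι ℂ K) (P : ℝ) (hP : 0 ≤ P)
    (hXP : ∀ j, ∑' k, ‖X j (κ k)‖ₑ ^ 2 ≤ ENNReal.ofReal P)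
    (F : ℕ → K) (hFs : Summable fun j => ‖F j‖) (ν2 : ℝ) (hν : 0 ≤ ν2)
    (hF : ∀ (n : ℕ) (p : ℕ → ℂ),
        ∑ m ∈ Finset.range n, ‖∑ i ∈ Finset.range (m + 1), p i • F (m - i)‖ ^ 2 ≤
          ν2 * ∑ i ∈ Finset.range n, ‖p i‖ ^ 2) (n₀ : ℤ) :
    ‖∑' j : ℕ, X (n₀ - j) (F j)‖ ^ 2 ≤ P * ν2 := by
  obtain ⟨w, η, -⟩ := exists_hilbertBasis ℂ H
  set Z : ℕ → H := fun t => ∑ s ∈ Finset.range (t + 1), X s (F (t - s)) with hZ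
  have hZn : ∀ t, ‖Z t‖ = ‖∑ j ∈ Finset.range (t + 1), X (n₀ - j) (F j)‖ := by
    intro t
    rw [hZ]
    simp only
    rw [← Finset.sum_range_reflect,
      ← hX.norm_sum_add _ (fun j : ℕ => n₀ - j) F (t - n₀)]
    congr 1
    refine Finset.sum_congr rfl fun j hj => ?_
    have hj' : j ≤ t := by have := Finset.mem_range.mp hj; omega
    have h1 : t - (t + 1 - 1 - j) = j := by omega
    have h2 : (((t + 1 - 1 - j : ℕ)) : ℤ) = n₀ - j + (t - n₀) := by
      rw [Nat.add_sub_cancel, Nat.cast_sub hj']; ring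
    rw [h1, h2]
  have hbound : ∀ n : ℕ, ∑ t ∈ Finset.range n, ‖Z t‖ ^ 2 ≤ n * (P * ν2) := by
    intro n
    have hE : ∑ t ∈ Finset.range n, ‖Z t‖ₑ ^ 2 ≤
        ENNReal.ofReal ν2 * (n * ENNReal.ofReal P) := by
      calc ∑ t ∈ Finset.range n, ‖Z t‖ₑ ^ 2
          = ∑' h, ∑ t ∈ Finset.range n, ‖inner ℂ (η h) (Z t)‖ₑ ^ 2 := by
            simp_rw [enorm_sq_eq_tsum_inner η (Z _)]
            rw [Summable.tsum_finsetSum fun _ _ => ENNReal.summable]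
        _ ≤ ∑' h, ENNReal.ofReal ν2 * ∑ s ∈ Finset.range n,
              ‖ContinuousLinearMap.adjoint (X s) (η h)‖ₑ ^ 2 := by
            refine ENNReal.tsum_le_tsum fun h => ?_
            have := transposed_convolution_bound F ν2 hν hF n
              (fun s => ContinuousLinearMap.adjoint (X s) (η h))
            simp only [ContinuousLinearMap.adjoint_inner_left] at this
            simp only [enorm_sq_eq_ofReal]
            rw [← ENNReal.ofReal_sum_of_nonneg fun _ _ => sq_nonneg _,
              ← ENNReal.ofReal_sum_of_nonneg fun _ _ => sq_nonneg _, ← ENNReal.ofReal_mul hν]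
            refine ENNReal.ofReal_le_ofReal ?_
            simpa only [hZ, inner_sum] using this
        _ = ENNReal.ofReal ν2 * ∑ s ∈ Finset.range n, ∑' k, ‖X s (κ k)‖ₑ ^ 2 := by
            rw [ENNReal.tsum_mul_left, Summable.tsum_finsetSum fun _ _ => ENNReal.summable]
            simp_rw [tsum_enorm_sq_adjoint κ η]
        _ ≤ ENNReal.ofReal ν2 * (n * ENNReal.ofReal P) := by
            gcongr
            refine (Finset.sum_le_sum (g := fun _ => ENNReal.ofReal P)
              fun (s : ℕ) _ => hXP s).trans ?_
            simp
    simp only [enorm_sq_eq_ofReal] at hE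
    rw [← ENNReal.ofReal_sum_of_nonneg fun _ _ => sq_nonneg _, ← ENNReal.ofReal_natCast,
      ← ENNReal.ofReal_mul (Nat.cast_nonneg n), ← ENNReal.ofReal_mul hν,
      ENNReal.ofReal_le_ofReal_iff (by positivity)] at hE
    linarith
  have hlim : Tendsto (fun t => ‖Z t‖ ^ 2) atTop (𝓝 (‖∑' j : ℕ, X (n₀ - j) (F j)‖ ^ 2)) := by
    have hs : Summable fun j : ℕ => X (n₀ - j) (F j) :=
      (hX.summable_norm_apply hFs _).of_norm
    have := ((tendsto_add_atTop_iff_nat 1).mpr hs.hasSum.tendsto_sum_nat).norm.pow 2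
    exact this.congr fun t => by rw [hZn]
  have hces := hlim.cesaro
  refine le_of_tendsto hces ?_
  filter_upwards [eventually_gt_atTop 0] with n hn
  have : (0 : ℝ) < n := Nat.cast_pos.mpr hn
  rw [inv_mul_le_iff₀ this]
  exact hbound n

end IsStationary

end Filtering

/-! ### The operator of the matrix `Q` -/

section BlockOperator

/-- Where an operator attains its norm, `‖A* A x - ‖A‖² x‖²` expands to `‖A* A x‖² - 2‖A‖²‖A x‖² +
‖A‖⁴‖x‖²`, which is at most `0`. -/
theorem adjoint_apply_apply_of_norm_eq {E F : Type*} [NormedAddCommGroup E]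
    [InnerProductSpace ℂ E] [CompleteSpace E] [NormedAddCommGroup F] [InnerProductSpace ℂ F]
    [CompleteSpace F] (A : E →L[ℂ] F) (x : E) (hx : ‖A‖ ^ 2 * ‖x‖ ^ 2 ≤ ‖A x‖ ^ 2) :
    ContinuousLinearMap.adjoint A (A x) = ((‖A‖ ^ 2 : ℝ) : ℂ) • x := by
  rw [← sub_eq_zero, ← norm_eq_zero, ← sq_eq_zero_iff]
  refine le_antisymm ?_ (sq_nonneg _)
  rw [@norm_sub_sq ℂ, inner_smul_right, ContinuousLinearMap.adjoint_inner_left,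
    inner_self_eq_norm_sq_to_K, norm_smul, Complex.norm_real,
    Real.norm_of_nonneg (sq_nonneg _)]
  have h1 : ‖ContinuousLinearMap.adjoint A (A x)‖ ^ 2 ≤ ‖A‖ ^ 2 * ‖A x‖ ^ 2 := by
    rw [← mul_pow]
    refine pow_le_pow_left₀ (norm_nonneg _) ?_ 2
    have := (ContinuousLinearMap.adjoint A).le_opNorm (A x)
    rwa [LinearIsometryEquiv.norm_map] at this
  have h2 : RCLike.re (((‖A‖ ^ 2 : ℝ) : ℂ) * ((‖A x‖ : ℝ) : ℂ) ^ 2) = ‖A‖ ^ 2 * ‖A x‖ ^ 2 := by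
    rw [← Complex.ofReal_pow, ← Complex.ofReal_mul]; exact Complex.ofReal_re _
  erw [h2]
  nlinarith [mul_le_mul_of_nonneg_left hx (sq_nonneg ‖A‖)]

theorem exists_norm_apply_eq_opNorm {E F : Type*} [NormedAddCommGroup E] [InnerProductSpace ℂ E]
    [FiniteDimensional ℂ E] [Nontrivial E] [NormedAddCommGroup F] [InnerProductSpace ℂ F]
    (A : E →L[ℂ] F) : ∃ x, ‖x‖ = 1 ∧ ‖A x‖ = ‖A‖ := by
  have : ProperSpace E := FiniteDimensional.proper ℂ E
  obtain ⟨x₀, hx₀⟩ := exists_norm_eq E (zero_le_one (α := ℝ))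
  obtain ⟨x, hx, hmax⟩ := (isCompact_sphere (0 : E) 1).exists_isMaxOn
    ⟨x₀, by simpa using hx₀⟩ (A.continuous.norm.continuousOn)
  have hx1 : ‖x‖ = 1 := by simpa using hx
  refine ⟨x, hx1, le_antisymm ?_ ?_⟩
  · simpa [hx1] using A.le_opNorm x
  · refine A.opNorm_le_bound (norm_nonneg _) fun y => ?_
    rcases eq_or_ne y 0 with rfl | hy
    · simp
    · have hy' : ‖y‖ ≠ 0 := norm_ne_zero_iff.mpr hy
      have h := hmax (a := ((‖y‖⁻¹ : ℝ) : ℂ) • y) (by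
        rw [mem_sphere_zero_iff_norm, norm_smul, Complex.norm_real, norm_inv, norm_norm,
          inv_mul_cancel₀ hy'])
      simp only [Set.mem_ofPred_eq, map_smul, norm_smul, Complex.norm_real, norm_inv, norm_norm] at h
      rwa [inv_mul_le_iff₀ (norm_pos_iff.mpr hy), mul_comm] at h

/-- The top of the spectrum of `A A^*` for an operator `A` on a finite dimensional space. -/
theorem isGreatest_eigenvalue_comp_adjoint {E F : Type*} [NormedAddCommGroup E]
    [InnerProductSpace ℂ E] [CompleteSpace E] [FiniteDimensional ℂ E] [Nontrivial E]
    [NormedAddCommGroup F]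
    [InnerProductSpace ℂ F] [CompleteSpace F] [Nontrivial F] (A : E →L[ℂ] F) :
    IsGreatest {x : ℝ | Module.End.HasEigenvalue
      ((A.comp (ContinuousLinearMap.adjoint A) : F →L[ℂ] F) : F →ₗ[ℂ] F) (x : ℂ)} (‖A‖ ^ 2) := by
  constructor
  -- For `A ≠ 0` the image of a norming vector is an eigenvector. For `A = 0` that image vanishes,
  -- and nontriviality of `F` supplies an eigenvector for `0`.
  · rcases eq_or_ne A 0 with rfl | hA
    · obtain ⟨y, hy⟩ := exists_ne (0 : F)
      refine Module.End.hasEigenvalue_of_hasEigenvector (x := y)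
        ⟨Module.End.mem_eigenspace_iff.mpr ?_, hy⟩
      simp
    · obtain ⟨x, hx1, hx⟩ := exists_norm_apply_eq_opNorm A
      have hA' : ‖A‖ ≠ 0 := norm_ne_zero_iff.mpr hA
      refine Module.End.hasEigenvalue_of_hasEigenvector (x := A x)
        ⟨Module.End.mem_eigenspace_iff.mpr ?_, ?_⟩
      · change A (ContinuousLinearMap.adjoint A (A x)) = _
        rw [adjoint_apply_apply_of_norm_eq A x (by rw [hx1, hx]; simp), map_smul]
      · rw [← norm_ne_zero_iff, hx]; exact hA'
  · intro z hz
    obtain ⟨y, hy⟩ := hz.exists_hasEigenvector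
    have h1 : A (ContinuousLinearMap.adjoint A y) = (z : ℂ) • y := hy.apply_eq_smul
    have h2 : ‖ContinuousLinearMap.adjoint A y‖ ^ 2 = z * ‖y‖ ^ 2 := by
      have h3 : inner ℂ y (A (ContinuousLinearMap.adjoint A y)) = (z : ℂ) * (‖y‖ : ℂ) ^ 2 := by
        rw [h1, inner_smul_right, inner_self_eq_norm_sq_to_K]; rfl
      rw [← ContinuousLinearMap.adjoint_inner_left, inner_self_eq_norm_sq_to_K] at h3
      exact Complex.ofReal_injective (by push_cast; exact h3)
    have h4 := (ContinuousLinearMap.adjoint A).le_opNorm y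
    rw [LinearIsometryEquiv.norm_map] at h4
    have h5 : 0 < ‖y‖ ^ 2 := pow_pos (norm_pos_iff.mpr hy.2) 2
    have h6 := pow_le_pow_left₀ (norm_nonneg _) h4 2
    rw [h2, mul_pow] at h6
    exact le_of_mul_le_mul_right h6 h5

/-- The space `ℓ₂` of square summable sequences. -/
abbrev SeqL2 : Type := lp (fun _ : ℕ => ℂ) 2

theorem memℓp_two_iff {ι : Type*} (f : ι → ℂ) :
    Memℓp f 2 ↔ Summable fun i => ‖f i‖ ^ 2 := by
  rw [memℓp_gen_iff (by norm_num)]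
  simp

variable {N : ℕ}

/-- The family of square summable sequences, as an element of the space of families. -/
def blockMk (f : Fin (N + 1) → SeqL2) : BlockL2 N :=
  ⟨fun i => f i.1 i.2, by
    change Memℓp (fun i : Fin (N + 1) × ℕ => f i.1 i.2) 2
    rw [memℓp_two_iff, summable_prod_of_nonneg fun _ => sq_nonneg _]
    exact ⟨fun p => (memℓp_two_iff _).mp (lp.memℓp (f p)), (hasSum_fintype _).summable⟩⟩

@[simp] theorem blockMk_apply (f : Fin (N + 1) → SeqL2) (i : Fin (N + 1) × ℕ) :
    blockMk f i = f i.1 i.2 := rfl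

/-- The `p`-th sequence of a family. -/
def blockPart (x : BlockL2 N) (p : Fin (N + 1)) : SeqL2 :=
  ⟨fun k => x (p, k), by
    change Memℓp (fun k : ℕ => x (p, k)) 2
    rw [memℓp_two_iff]
    have h := (memℓp_two_iff _).mp (lp.memℓp x)
    exact h.comp_injective (i := fun k => (p, k)) fun a b h => (Prod.mk.inj h).2⟩

@[simp] theorem blockPart_apply (x : BlockL2 N) (p : Fin (N + 1)) (k : ℕ) :
    blockPart x p k = x (p, k) := rfl

@[simp] theorem blockPart_blockMk (f : Fin (N + 1) → SeqL2) (p : Fin (N + 1)) :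
    blockPart (blockMk f) p = f p := rfl

theorem inner_eq_sum_blockPart (x y : BlockL2 N) :
    inner ℂ x y = ∑ p, inner ℂ (blockPart x p) (blockPart y p) :=
  ((lp.hasSum_inner x y).prod_fiberwise fun p =>
    lp.hasSum_inner (blockPart x p) (blockPart y p)).unique (hasSum_fintype _)

theorem norm_sq_eq_sum_blockPart (x : BlockL2 N) : ‖x‖ ^ 2 = ∑ p, ‖blockPart x p‖ ^ 2 := by
  have h := inner_eq_sum_blockPart x x
  simp only [inner_self_eq_norm_sq_to_K] at h
  exact_mod_cast h

/-- The vector with blocks `b_s, …, b_N, 0, …, 0`. -/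
def shiftVec (N : ℕ) (b : ℕ → SeqL2) (s : ℕ) : BlockL2 N := blockMk fun p => b (s + p)

/-- The Hankel operator with the columns `shiftVec N b s`. -/
def hankel (N : ℕ) (b : ℕ → SeqL2) : EuclideanSpace ℂ (Fin (N + 1)) →L[ℂ] BlockL2 N :=
  ∑ s : Fin (N + 1), (EuclideanSpace.proj (𝕜 := ℂ) s).smulRight (shiftVec N b s)

theorem hankel_apply (b : ℕ → SeqL2) (p : EuclideanSpace ℂ (Fin (N + 1))) :
    hankel N b p = ∑ s, p s • shiftVec N b s := by
  simp [hankel]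

theorem adjoint_hankel_apply (b : ℕ → SeqL2) (x : BlockL2 N) (s : Fin (N + 1)) :
    (ContinuousLinearMap.adjoint (hankel N b) x) s = inner ℂ (shiftVec N b s) x := by
  have h := ContinuousLinearMap.adjoint_inner_right (hankel N b) (EuclideanSpace.single s 1) x
  rw [EuclideanSpace.inner_single_left, hankel_apply] at h
  simpa [ite_smul] using h

/-- Identifies the quadratic form in the extension theorem, so that its hypothesis reads `‖Γ‖² ≤
ν2`. -/
theorem norm_sq_hankel_apply (b : ℕ → SeqL2) (p : Fin (N + 1) → ℂ) :
    ‖hankel N b (WithLp.toLp 2 p)‖ ^ 2 =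
      ∑ r ∈ Finset.range (N + 1), ‖∑ s, p s • b (s + r)‖ ^ 2 := by
  rw [norm_sq_eq_sum_blockPart, ← Fin.sum_univ_eq_sum_range
      (fun r => ‖∑ s, p s • b (s + r)‖ ^ 2)]
  refine Finset.sum_congr rfl fun r _ => ?_
  congr 2
  ext k
  rw [blockPart_apply, hankel_apply, lp.coeFn_sum, lp.coeFn_sum, Finset.sum_apply,
    Finset.sum_apply]
  rfl

/-- The operator of the matrix `Q`. -/
def QOp (N : ℕ) (b : ℕ → SeqL2) : BlockL2 N →L[ℂ] BlockL2 N :=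
  (hankel N b).comp (ContinuousLinearMap.adjoint (hankel N b))

theorem QOp_apply (b : ℕ → SeqL2) (x : BlockL2 N) :
    QOp N b x = ∑ s : Fin (N + 1), inner ℂ (shiftVec N b s) x • shiftVec N b s := by
  rw [QOp, ContinuousLinearMap.comp_apply, hankel_apply]
  simp only [adjoint_hankel_apply]

theorem sum_norm_sq_inner_shiftVec (b : ℕ → SeqL2) (x : BlockL2 N) :
    ∑ s : Fin (N + 1), ‖inner ℂ (shiftVec N b s) x‖ ^ 2 =
      ‖ContinuousLinearMap.adjoint (hankel N b) x‖ ^ 2 := by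
  rw [EuclideanSpace.norm_sq_eq]
  simp only [adjoint_hankel_apply]

theorem sum_norm_sq_inner_shiftVec_le (b : ℕ → SeqL2) (x : BlockL2 N) :
    ∑ s : Fin (N + 1), ‖inner ℂ (shiftVec N b s) x‖ ^ 2 ≤ ‖hankel N b‖ ^ 2 * ‖x‖ ^ 2 := by
  rw [sum_norm_sq_inner_shiftVec, ← mul_pow]
  refine pow_le_pow_left₀ (norm_nonneg _) ?_ 2
  have := (ContinuousLinearMap.adjoint (hankel N b)).le_opNorm x
  rwa [LinearIsometryEquiv.norm_map] at this

/-- The zero vector and the top eigenvectors are exactly the vectors on which `Γ*` attains its norm.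
This turns equality of energies into the eigenvector equation and back, without spectral theory. -/
theorem QOp_apply_eq_smul_iff (b : ℕ → SeqL2) (x : BlockL2 N) :
    QOp N b x = ((‖hankel N b‖ ^ 2 : ℝ) : ℂ) • x ↔
      ∑ s : Fin (N + 1), ‖inner ℂ (shiftVec N b s) x‖ ^ 2 = ‖hankel N b‖ ^ 2 * ‖x‖ ^ 2 := by
  constructor
  · intro h
    have h3 : inner ℂ x (QOp N b x) = ((‖hankel N b‖ ^ 2 : ℝ) : ℂ) * (‖x‖ : ℂ) ^ 2 := by
      rw [h, inner_smul_right, inner_self_eq_norm_sq_to_K]; rfl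
    rw [QOp, ContinuousLinearMap.comp_apply, ← ContinuousLinearMap.adjoint_inner_left,
      inner_self_eq_norm_sq_to_K] at h3
    rw [sum_norm_sq_inner_shiftVec]
    exact Complex.ofReal_injective (by push_cast at h3 ⊢; exact h3)
  · intro h
    rw [sum_norm_sq_inner_shiftVec] at h
    have := adjoint_apply_apply_of_norm_eq (ContinuousLinearMap.adjoint (hankel N b)) x
      (by rw [LinearIsometryEquiv.norm_map, h])
    rwa [ContinuousLinearMap.adjoint_adjoint, LinearIsometryEquiv.norm_map] at this

/-- `Q` factors through the finite dimensional domain of `Γ`. -/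
theorem isCompactOperator_QOp (b : ℕ → SeqL2) : IsCompactOperator (QOp N b) := by
  have h : IsCompactOperator (hankel N b) := by
    have : ProperSpace (EuclideanSpace ℂ (Fin (N + 1))) := inferInstance
    have h1 : IsCompactOperator (ContinuousLinearMap.id ℂ (EuclideanSpace ℂ (Fin (N + 1)))) :=
      ⟨Metric.closedBall 0 1, isCompact_closedBall 0 1, Metric.closedBall_mem_nhds 0 one_pos⟩
    exact h1.clm_comp (hankel N b)
  exact h.comp_clm (ContinuousLinearMap.adjoint (hankel N b))

theorem isSelfAdjoint_QOp (b : ℕ → SeqL2) : IsSelfAdjoint (QOp N b) :=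
  (ContinuousLinearMap.isPositive_self_comp_adjoint (hankel N b)).isSelfAdjoint

theorem nontrivial_blockL2 (N : ℕ) : Nontrivial (BlockL2 N) := by
  refine ⟨⟨lp.single 2 (0, 0) 1, 0, fun h => ?_⟩⟩
  have := congrArg (fun x : BlockL2 N => x (0, 0)) h
  simp at this

theorem isGreatest_eigenvalue_QOp (b : ℕ → SeqL2) :
    IsGreatest {x : ℝ | Module.End.HasEigenvalue (QOp N b : BlockL2 N →ₗ[ℂ] BlockL2 N) (x : ℂ)}
      (‖hankel N b‖ ^ 2) := by
  have := nontrivial_blockL2 N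
  exact isGreatest_eigenvalue_comp_adjoint (hankel N b)

/-- With `b` extended by zero beyond `N`, the upper limit `min (N - p) (N - q)` may be replaced by
`N`. The matrix is then visibly that of `Γ Γ*`. -/
theorem QEntry_eq_sum {T : ℝ} {d τ : ℕ} {a : ℝ → ℂ} (b : ℕ → SeqL2)
    (hb : ∀ j ≤ N, ∀ k, b j k = bVec T d τ N a j k) (hb0 : ∀ j, N < j → b j = 0)
    (r c : Fin (N + 1) × ℕ) :
    QEntry T d τ N a r c =
      ∑ s : Fin (N + 1), shiftVec N b s r * (starRingEnd ℂ) (shiftVec N b s c) := by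
  rw [QEntry, Fin.sum_univ_eq_sum_range
    (fun s => shiftVec N b s r * (starRingEnd ℂ) (shiftVec N b s c)) (N + 1)]
  have hr := r.1.2
  have hc := c.1.2
  have hsub : Finset.range (min (N - (r.1 : ℕ)) (N - (c.1 : ℕ)) + 1) ⊆ Finset.range (N + 1) := by
    intro s hs; rw [Finset.mem_range] at hs ⊢; omega
  rw [← Finset.sum_subset hsub]
  · refine Finset.sum_congr rfl fun s hs => ?_
    rw [Finset.mem_range] at hs
    rw [shiftVec, blockMk_apply, blockMk_apply, hb _ (by omega), hb _ (by omega)]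
  · intro s _ hs
    rw [Finset.mem_range] at hs
    rw [shiftVec, blockMk_apply, blockMk_apply]
    rcases lt_or_ge N (s + r.1) with h | h
    · rw [hb0 _ h, lp.coeFn_zero, Pi.zero_apply, zero_mul]
    · rw [hb0 (s + c.1) (by omega), lp.coeFn_zero, Pi.zero_apply, map_zero, mul_zero]

theorem hasSum_inner_blockL2 (x y : BlockL2 N) :
    HasSum (fun c => (starRingEnd ℂ) (x c) * y c) (inner ℂ x y) := by
  have h := lp.hasSum_inner (𝕜 := ℂ) x y
  simp only [RCLike.inner_apply'] at h
  exact h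

theorem isQOperator_QOp {T : ℝ} {d τ : ℕ} {a : ℝ → ℂ} (b : ℕ → SeqL2)
    (hb : ∀ j ≤ N, ∀ k, b j k = bVec T d τ N a j k) (hb0 : ∀ j, N < j → b j = 0) :
    IsQOperator T d τ N a (QOp N b) := by
  intro x r
  have h : (fun c => QEntry T d τ N a r c * x c) = fun c => ∑ s : Fin (N + 1),
      (starRingEnd ℂ) (shiftVec N b s c) * x c * shiftVec N b s r := by
    funext c
    rw [QEntry_eq_sum b hb hb0, Finset.sum_mul]
    exact Finset.sum_congr rfl fun s _ => by ring
  have h2 : QOp N b x r = ∑ s : Fin (N + 1), inner ℂ (shiftVec N b s) x * shiftVec N b s r := by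
    rw [QOp_apply, lp.coeFn_sum, Finset.sum_apply]
    rfl
  rw [h, h2]
  exact hasSum_sum fun s _ => (hasSum_inner_blockL2 (shiftVec N b s) x).mul_right _

end BlockOperator

/-! ### Prediction of stationary sequences of operators -/

section Prediction

variable {H : Type*} [NormedAddCommGroup H] [InnerProductSpace ℂ H] {N : ℕ}

/-- The standard unit vector of `ℓ₂`. -/
def unitSeq (k : ℕ) : SeqL2 := lp.single 2 k 1

theorem hasSum_unitSeq (f : SeqL2) : HasSum (fun k => f k • unitSeq k) f := by
  have h := lp.hasSum_single (E := fun _ : ℕ => ℂ) (p := 2) (by norm_num) f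
  convert h using 2 with k
  rw [unitSeq, ← lp.single_smul, smul_eq_mul, mul_one]

theorem clm_ext_unitSeq {E : Type*} [NormedAddCommGroup E] [NormedSpace ℂ E]
    {A A' : SeqL2 →L[ℂ] E} (h : ∀ k, A (unitSeq k) = A' (unitSeq k)) : A = A' := by
  ext f
  have h1 := (hasSum_unitSeq f).mapL A
  have h2 := (hasSum_unitSeq f).mapL A'
  simp only [map_smul, h] at h1 h2
  exact h1.unique h2

theorem inner_unitSeq_right (f : SeqL2) (k : ℕ) : inner ℂ f (unitSeq k) = (starRingEnd ℂ) (f k) := by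
  rw [unitSeq, lp.inner_single_right, RCLike.inner_apply, one_mul]

/-- The value of the functional `∑_j ξ_j b_j`. -/
def functional (X : ℤ → SeqL2 →L[ℂ] H) (b : ℕ → SeqL2) (N : ℕ) : H :=
  ∑ j ∈ Finset.range (N + 1), X j (b j)

/-- For an innovation `η` at time `s`, the terms `X j (b j)` with `j < s` drop out, and those with
`j = s + p ≤ N` pair block by block with `b (s + p)`. The blocks of `v` with `s + p > N` meet only
zeros of `shiftVec`, so nothing is assumed about them. -/
theorem inner_functional (X : ℤ → SeqL2 →L[ℂ] H) (b : ℕ → SeqL2) (hb0 : ∀ j, N < j → b j = 0)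
    (s : ℕ) (hs : s ≤ N) (η : H) (v : BlockL2 N)
    (h0 : ∀ j < s, ∀ k, inner ℂ η (X j (unitSeq k)) = 0)
    (h1 : ∀ p : Fin (N + 1), s + p ≤ N →
      ∀ k, inner ℂ η (X (s + p) (unitSeq k)) = (starRingEnd ℂ) (v (p, k))) :
    inner ℂ η (functional X b N) = inner ℂ v (shiftVec N b s) := by
  have h0' : ∀ j < s, ∀ f, inner ℂ η (X j f) = 0 := by
    intro j hj f
    have : (innerSL ℂ η).comp (X j) = 0 := clm_ext_unitSeq fun k => h0 j hj k
    exact congrArg (fun A : SeqL2 →L[ℂ] ℂ => A f) this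
  have h1' : ∀ p : Fin (N + 1), s + p ≤ N →
      ∀ f, inner ℂ η (X (s + p) f) = inner ℂ (blockPart v p) f := by
    intro p hp f
    have : (innerSL ℂ η).comp (X (s + p)) = innerSL ℂ (blockPart v p) :=
      clm_ext_unitSeq fun k => by
        rw [innerSL_apply_apply, inner_unitSeq_right]; exact h1 p hp k
    exact congrArg (fun A : SeqL2 →L[ℂ] ℂ => A f) this
  rw [inner_eq_sum_blockPart, functional, inner_sum]
  simp only [shiftVec, blockPart_blockMk]
  rw [← Finset.sum_range_add_sum_Ico _ (show s ≤ N + 1 by omega),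
    Finset.sum_eq_zero fun j hj => h0' j (Finset.mem_range.mp hj) (b j), zero_add,
    Finset.sum_Ico_eq_sum_range]
  rw [Finset.sum_fin_eq_sum_range]
  rw [← Finset.sum_subset (s₁ := Finset.range (N + 1 - s)) (s₂ := Finset.range (N + 1))]
  · refine Finset.sum_congr rfl fun p hp => ?_
    rw [Finset.mem_range] at hp
    have hp' : p < N + 1 := by omega
    rw [dif_pos hp', ← h1' ⟨p, hp'⟩ (by simp only; omega)]
    push_cast
    rfl
  · intro p hp; rw [Finset.mem_range] at hp ⊢; omega
  · intro p hp1 hp2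
    rw [Finset.mem_range] at hp1 hp2
    rw [dif_pos hp1]
    simp only
    rw [hb0 _ (by omega), inner_zero_right]

/-- The closed linear span of the values at the times before `s`. -/
def past (X : ℤ → SeqL2 →L[ℂ] H) (s : ℤ) : Submodule ℂ H :=
  (Submodule.span ℂ {x | ∃ j < s, ∃ k, x = X j (unitSeq k)}).topologicalClosure

theorem apply_mem_past (X : ℤ → SeqL2 →L[ℂ] H) {j s : ℤ} (h : j < s) (f : SeqL2) :
    X j f ∈ past X s := by
  have h1 := (hasSum_unitSeq f).mapL (X j)
  refine (Submodule.isClosed_topologicalClosure _).mem_of_tendsto h1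
    (Eventually.of_forall fun S => ?_)
  refine Submodule.sum_mem _ fun k _ => ?_
  rw [map_smul]
  exact Submodule.smul_mem _ _
    (Submodule.le_topologicalClosure _ (Submodule.subset_span ⟨j, h, k, rfl⟩))

theorem functional_mem_past (X : ℤ → SeqL2 →L[ℂ] H) (b : ℕ → SeqL2) :
    functional X b N ∈ past X (N + 1) :=
  Submodule.sum_mem _ fun j hj => apply_mem_past X
    (by have := Finset.mem_range.mp hj; omega) _

theorem past_mono (X : ℤ → SeqL2 →L[ℂ] H) {s t : ℤ} (h : s ≤ t) : past X s ≤ past X t :=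
  Submodule.topologicalClosure_mono (Submodule.span_mono
    fun _ ⟨j, hj, k, hx⟩ => ⟨j, hj.trans_le h, k, hx⟩)

theorem inner_eq_zero_of_mem_past {X : ℤ → SeqL2 →L[ℂ] H} {s : ℤ} {η : H}
    (h : ∀ j < s, ∀ k, inner ℂ η (X j (unitSeq k)) = 0) {x : H} (hx : x ∈ past X s) :
    inner ℂ η x = 0 := by
  have : past X s ≤ LinearMap.ker (innerSL ℂ η).toLinearMap := by
    refine Submodule.topologicalClosure_minimal _ ?_ (innerSL ℂ η).isClosed_ker
    rw [Submodule.span_le]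
    rintro _ ⟨j, hj, k, rfl⟩
    exact h j hj k
  exact this hx

theorem inner_movingAverage {M : ℕ} (X : ℤ → SeqL2 →L[ℂ] H) (g : Fin M → BlockL2 N)
    (ε : ℤ → Fin M → H) (hε : Orthonormal ℂ (fun i : ℤ × Fin M => ε i.1 i.2))
    (hX : ∀ j k, X j (unitSeq k) =
      ∑ p : Fin (N + 1), ∑ m : Fin M, (g m (p, k)) • ε (j - ((p : ℕ) : ℤ)) m)
    (s j : ℤ) (m : Fin M) (k : ℕ) : inner ℂ (ε s m) (X j (unitSeq k)) =
      ∑ p : Fin (N + 1), if j - ((p : ℕ) : ℤ) = s then g m (p, k) else 0 := by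
  rw [hX, inner_sum]
  refine Finset.sum_congr rfl fun p _ => ?_
  rw [inner_sum]
  simp only [inner_smul_right]
  have : ∀ m', inner ℂ (ε s m) (ε (j - ((p : ℕ) : ℤ)) m') =
      if ((s, m) : ℤ × Fin M) = (j - ((p : ℕ) : ℤ), m') then (1 : ℂ) else 0 := fun m' =>
    (orthonormal_iff_ite.mp hε) (s, m) (j - ((p : ℕ) : ℤ), m')
  simp only [this, Prod.mk.injEq]
  by_cases hs : j - ((p : ℕ) : ℤ) = s
  · simp [hs]
  · simp [hs, Ne.symm hs]

theorem inner_eq_zero_of_movingAverage {M : ℕ} (X : ℤ → SeqL2 →L[ℂ] H) (g : Fin M → BlockL2 N)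
    (ε : ℤ → Fin M → H) (hε : Orthonormal ℂ (fun i : ℤ × Fin M => ε i.1 i.2))
    (hX : ∀ j k, X j (unitSeq k) =
      ∑ p : Fin (N + 1), ∑ m : Fin M, (g m (p, k)) • ε (j - ((p : ℕ) : ℤ)) m)
    {x : H} (hx : x ∈ past X 0) (s : Fin (N + 1)) (m : Fin M) :
    inner ℂ (ε ((s : ℕ) : ℤ) m) x = 0 := by
  refine inner_eq_zero_of_mem_past (fun j hj k => ?_) hx
  rw [inner_movingAverage X g ε hε hX]
  exact Finset.sum_eq_zero fun p _ => if_neg (by omega)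

/-- The error of a moving average is at least that of the innovations at the times `0, …, N`. -/
theorem le_norm_sq_functional_sub {M : ℕ} (X : ℤ → SeqL2 →L[ℂ] H) (b : ℕ → SeqL2)
    (hb0 : ∀ j, N < j → b j = 0) (g : Fin M → BlockL2 N) (ε : ℤ → Fin M → H)
    (hε : Orthonormal ℂ (fun i : ℤ × Fin M => ε i.1 i.2))
    (hX : ∀ j k, X j (unitSeq k) =
      ∑ p : Fin (N + 1), ∑ m : Fin M, (g m (p, k)) • ε (j - ((p : ℕ) : ℤ)) m)
    (x : H) (hx : ∀ (s : Fin (N + 1)) m, inner ℂ (ε ((s : ℕ) : ℤ) m) x = 0) :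
    ∑ m, ∑ s : Fin (N + 1), ‖inner ℂ (shiftVec N b s) (star (g m))‖ ^ 2 ≤
      ‖functional X b N - x‖ ^ 2 := by
  have hin := inner_movingAverage X g ε hε hX
  -- The pairing of `ε s` with `X (s + p) (unitSeq k)` is `g m (p, k)` itself, while the inner
  -- product with `v` conjugates `v`. Hence the functional sees the vector `star (g m)`, the source
  -- of the conjugation in the eigenvector equation.
  have hfun : ∀ (s : Fin (N + 1)) m, inner ℂ (ε ((s : ℕ) : ℤ) m) (functional X b N - x) =
      inner ℂ (star (g m)) (shiftVec N b s) := by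
    intro s m
    rw [inner_sub_right, hx, sub_zero]
    refine inner_functional X b hb0 s (by omega) _ _ (fun j hj k => ?_) (fun p hp k => ?_)
    · rw [hin]
      exact Finset.sum_eq_zero fun p _ => if_neg (by omega)
    · rw [hin, Finset.sum_eq_single p]
      · rw [if_pos (by omega), lp.star_apply]
        exact (star_star _).symm
      · intro q _ hq
        exact if_neg fun h => hq (Fin.ext (by omega))
      · simp
  have hε' : Orthonormal ℂ (fun i : Fin (N + 1) × Fin M => ε ((i.1 : ℕ) : ℤ) i.2) := by
    refine hε.comp (fun i : Fin (N + 1) × Fin M => ((((i.1 : ℕ) : ℤ), i.2) : ℤ × Fin M)) ?_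
    rintro ⟨p, m⟩ ⟨q, n⟩ h
    simp only [Prod.mk.injEq] at h
    exact Prod.ext (Fin.ext (by exact_mod_cast h.1)) h.2
  have hB := hε'.sum_inner_products_le (functional X b N - x) (s := Finset.univ)
  refine le_trans (le_of_eq ?_) hB
  rw [Fintype.sum_prod_type, Finset.sum_comm]
  refine Finset.sum_congr rfl fun s _ => Finset.sum_congr rfl fun m _ => ?_
  rw [hfun, norm_inner_symm]

/-- The case of equality in Bessel's inequality: the squared distance to the projection is the
difference of the two sides. -/
theorem eq_sum_inner_smul_of_norm_sq_le {ι : Type*} [Fintype ι] {e : ι → H}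
    (he : Orthonormal ℂ e) (x : H) (hx : ‖x‖ ^ 2 ≤ ∑ i, ‖inner ℂ (e i) x‖ ^ 2) :
    x = ∑ i, inner ℂ (e i) x • e i := by
  rw [← sub_eq_zero, ← norm_eq_zero, ← sq_eq_zero_iff]
  refine le_antisymm ?_ (sq_nonneg _)
  have h1 : ∀ y : H, ‖y‖ ^ 2 = (inner ℂ y y).re := fun y => by
    rw [inner_self_eq_norm_sq_to_K]; norm_cast
  have h2 : inner ℂ (∑ i, inner ℂ (e i) x • e i) (∑ i, inner ℂ (e i) x • e i) =
      ((∑ i, ‖inner ℂ (e i) x‖ ^ 2 : ℝ) : ℂ) := by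
    rw [he.inner_sum]
    push_cast
    exact Finset.sum_congr rfl fun i _ => Complex.conj_mul' _
  have h3 : inner ℂ (∑ i, inner ℂ (e i) x • e i) x =
      ((∑ i, ‖inner ℂ (e i) x‖ ^ 2 : ℝ) : ℂ) := by
    rw [sum_inner]
    push_cast
    exact Finset.sum_congr rfl fun i _ => by rw [inner_smul_left, Complex.conj_mul']
  have h4 : inner ℂ x (∑ i, inner ℂ (e i) x • e i) =
      ((∑ i, ‖inner ℂ (e i) x‖ ^ 2 : ℝ) : ℂ) := by
    rw [← inner_conj_symm, h3, Complex.conj_ofReal]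
  rw [h1, inner_sub_left, inner_sub_right, inner_sub_right, h2, h3, h4]
  simp only [sub_self, sub_zero, Complex.sub_re, Complex.ofReal_re]
  rw [← h1]
  linarith

theorem zpow_apply (X : ℤ → SeqL2 →L[ℂ] H) (U : H ≃ₗᵢ[ℂ] H)
    (hU : ∀ j f, U (X j f) = X (j + 1) f) (c j : ℤ) (f : SeqL2) :
    (U ^ c) (X j f) = X (j + c) f := by
  induction c generalizing j f with
  | zero => simp
  | succ c ih =>
    rw [zpow_add_one]
    change (U ^ (c : ℤ)) (U (X j f)) = _
    rw [hU, ih]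
    congr 2; ring
  | pred c ih =>
    have : X j f = U (X (j - 1) f) := by rw [hU]; congr 2; ring
    rw [zpow_sub_one, this]
    change (U ^ (-(c : ℤ))) (U.symm (U _)) = _
    rw [LinearIsometryEquiv.symm_apply_apply, ih]
    congr 2; ring

theorem past_zpow (X : ℤ → SeqL2 →L[ℂ] H) (U : H ≃ₗᵢ[ℂ] H)
    (hU : ∀ j f, U (X j f) = X (j + 1) f) (c s : ℤ) {x : H} (hx : x ∈ past X s) :
    (U ^ c) x ∈ past X (s + c) := by
  have h2 : past X s ≤ (past X (s + c)).comap (U ^ c).toLinearEquiv.toLinearMap := by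
    refine Submodule.topologicalClosure_minimal _ ?_ ?_
    · rw [Submodule.span_le]
      rintro _ ⟨j, hj, k, rfl⟩
      change (U ^ c) (X j (unitSeq k)) ∈ past X (s + c)
      rw [zpow_apply X U hU]
      exact apply_mem_past X (by omega) _
    · exact (Submodule.isClosed_topologicalClosure _).preimage (U ^ c).continuous
  exact h2 hx

end Prediction

/-! ### Stationary sequences with the greatest error are moving averages -/

section Converse

variable {H : Type*} [NormedAddCommGroup H] [InnerProductSpace ℂ H] {N : ℕ}

/-- The innovations of the functional: a finite orthonormal family of innovations at the time `0`
whose translates carry the whole error of the optimal prediction of the functional. -/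
theorem exists_innovations [CompleteSpace H] (X : ℤ → SeqL2 →L[ℂ] H) (U : H ≃ₗᵢ[ℂ] H)
    (hU : ∀ j f, U (X j f) = X (j + 1) f) (b : ℕ → SeqL2) :
    ∃ (M : ℕ) (w : Fin M → H), Orthonormal ℂ w ∧ (∀ m, w m ∈ past X 1) ∧
      (∀ m, ∀ x ∈ past X 0, inner ℂ (w m) x = 0) ∧
      ∃ x ∈ past X 0, ‖functional X b N - x‖ ^ 2 =
        ∑ s : Fin (N + 1), ∑ m, ‖inner ℂ ((U ^ ((s : ℕ) : ℤ)) (w m)) (functional X b N)‖ ^ 2 := by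
  set B := functional X b N with hB
  have hc : ∀ s, (past X s).HasOrthogonalProjection := fun s => by
    have : CompleteSpace (past X s) :=
      (Submodule.isClosed_topologicalClosure _).completeSpace_coe
    infer_instance
  let Pp : ℤ → H := fun s => (past X s).starProjection B
  have hPp : ∀ s, ∀ y ∈ past X s, inner ℂ y (Pp s) = inner ℂ y B := by
    intro s y hy
    have := Submodule.inner_right_of_mem_orthogonal hy
      ((past X s).sub_starProjection_mem_orthogonal B)
    rw [inner_sub_right, sub_eq_zero] at this
    exact this.symm
  have hPm : ∀ s, Pp s ∈ past X s := fun s => (past X s).starProjection_apply_mem B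
  -- As information up to time `s` is added, the best approximation changes by the orthogonal
  -- increments `D s`. They telescope to the prediction error, since the functional lies in `past X
  -- (N + 1)`.
  let D : ℕ → H := fun s => Pp (s + 1) - Pp s
  have hDm : ∀ s : ℕ, D s ∈ past X (s + 1) := fun s =>
    Submodule.sub_mem _ (hPm _) (past_mono X (by omega) (hPm _))
  have hDo : ∀ s : ℕ, ∀ y ∈ past X s, inner ℂ y (D s) = 0 := by
    intro s y hy
    rw [inner_sub_right, hPp s y hy, hPp _ y (past_mono X (by omega) hy), sub_self]
  have hsum : B - Pp 0 = ∑ s ∈ Finset.range (N + 1), D s := by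
    have h := Finset.sum_range_sub (fun s : ℕ => Pp s) (N + 1)
    push_cast at h
    rw [show ∑ s ∈ Finset.range (N + 1), D s = _ from h]
    congr 1
    exact (Submodule.starProjection_eq_self_iff.mpr (by exact_mod_cast functional_mem_past X b)).symm
  have hDD : ∀ s t : ℕ, s < t → inner ℂ (D s) (D t) = 0 := fun s t hst =>
    hDo t _ (past_mono X (by omega) (hDm s))
  have hDD' : ∀ s t : ℕ, s ≠ t → inner ℂ (D s) (D t) = 0 := by
    intro s t hst
    rcases lt_or_gt_of_ne hst with h | h
    · exact hDD s t h
    · rw [← inner_conj_symm, hDD t s h, map_zero]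
  have hnorm : ‖B - Pp 0‖ ^ 2 = ∑ s ∈ Finset.range (N + 1), ‖D s‖ ^ 2 := by
    have h1 : (inner ℂ (B - Pp 0) (B - Pp 0) : ℂ) =
        ∑ s ∈ Finset.range (N + 1), inner ℂ (D s) (D s) := by
      rw [hsum, sum_inner]
      refine Finset.sum_congr rfl fun s hs => ?_
      rw [inner_sum]
      exact Finset.sum_eq_single_of_mem s hs fun t _ ht => hDD' s t ht.symm
    simp only [inner_self_eq_norm_sq_to_K] at h1
    exact Complex.ofReal_injective (by push_cast; exact h1)
  have hDsub : ∀ (s : ℕ) y, y ∈ past X (s + 1) → (∀ x ∈ past X s, inner ℂ y x = 0) →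
      inner ℂ y (D s) = inner ℂ y B := by
    intro s y hy hyo
    rw [inner_sub_right, hPp _ y hy, hyo _ (hPm s), sub_zero]
  let d : ℕ → H := fun s => (U ^ (-(s : ℤ))) (D s)
  have hUd : ∀ s : ℕ, (U ^ (s : ℤ)) (d s) = D s := by
    intro s
    change (U ^ (s : ℤ) * U ^ (-(s : ℤ))) (D s) = D s
    rw [zpow_neg, mul_inv_cancel]
    rfl
  have hdm : ∀ s : ℕ, d s ∈ past X 1 := fun s => by
    have := past_zpow X U hU (-(s : ℤ)) _ (hDm s)
    rwa [show ((s : ℤ) + 1 + -(s : ℤ)) = 1 by ring] at this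
  have hdo : ∀ s : ℕ, ∀ y ∈ past X 0, inner ℂ (d s) y = 0 := by
    intro s y hy
    have h1 := past_zpow X U hU (s : ℤ) _ hy
    rw [zero_add] at h1
    rw [← LinearIsometryEquiv.inner_map_map (U ^ (s : ℤ)), hUd, ← inner_conj_symm, hDo s _ h1,
      map_zero]
  -- All `N + 1` increments, moved back to time `0`, span a finite dimensional space of innovations
  -- at that time. An orthonormal basis of it is the finite family sought, with at most `N + 1`
  -- members.
  let W : Submodule ℂ H := Submodule.span ℂ (d '' (Finset.range (N + 1) : Set ℕ))
  have : FiniteDimensional ℂ W :=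
    FiniteDimensional.span_of_finite ℂ ((Finset.finite_toSet _).image d)
  let e := stdOrthonormalBasis ℂ W
  have hWm : W ≤ past X 1 := by
    rw [Submodule.span_le]
    rintro _ ⟨s, _, rfl⟩
    exact hdm s
  have hWo : ∀ w ∈ W, ∀ y ∈ past X 0, inner ℂ w y = 0 := by
    intro w hw y hy
    have : W ≤ LinearMap.ker (innerSL ℂ y).toLinearMap := by
      rw [Submodule.span_le]
      rintro _ ⟨s, _, rfl⟩
      change inner ℂ y (d s) = 0
      rw [← inner_conj_symm, hdo s y hy, map_zero]
    have h2 : inner ℂ y w = 0 := this hw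
    rw [← inner_conj_symm, h2, map_zero]
  refine ⟨Module.finrank ℂ W, fun m => (e m : H), ?_, fun m => hWm (e m).2,
    fun m => hWo _ (e m).2, Pp 0, hPm 0, ?_⟩
  · exact e.orthonormal.comp_linearIsometry W.subtypeₗᵢ
  · rw [hnorm, Finset.sum_range]
    refine Finset.sum_congr rfl fun s _ => ?_
    have hds : d s ∈ W := Submodule.subset_span ⟨s, by simp; omega, rfl⟩
    have h1 : ‖D s‖ = ‖(⟨d s, hds⟩ : W)‖ := by
      rw [← hUd, LinearIsometryEquiv.norm_map]; rfl
    rw [h1, ← e.sum_sq_norm_inner_right]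
    refine Finset.sum_congr rfl fun m _ => ?_
    have h2 : inner ℂ (e m) (⟨d s, hds⟩ : W) = inner ℂ (e m : H) (d s) := rfl
    rw [h2, ← LinearIsometryEquiv.inner_map_map (U ^ ((s : ℕ) : ℤ)), hUd, hDsub]
    · have := past_zpow X U hU ((s : ℕ) : ℤ) _ (hWm (e m).2)
      rwa [add_comm] at this
    · intro x hx
      have h3 := past_zpow X U hU (-((s : ℕ) : ℤ)) _ hx
      rw [add_neg_cancel] at h3
      have h4 := hWo _ (e m).2 _ h3
      rw [← LinearIsometryEquiv.inner_map_map (U ^ ((s : ℕ) : ℤ))] at h4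
      change inner ℂ _ ((U ^ ((s : ℕ) : ℤ) * U ^ (-((s : ℕ) : ℤ))) x) = 0 at h4
      rw [zpow_neg, mul_inv_cancel] at h4
      exact h4

/-- Wandering vectors: `w m` belongs to the past up to time `0` and is orthogonal to everything
before it, so translates at different times are orthogonal. -/
theorem orthonormal_zpow (X : ℤ → SeqL2 →L[ℂ] H) (U : H ≃ₗᵢ[ℂ] H)
    (hU : ∀ j f, U (X j f) = X (j + 1) f) {M : ℕ} (w : Fin M → H) (hw : Orthonormal ℂ w)
    (hw1 : ∀ m, w m ∈ past X 1) (hw0 : ∀ m, ∀ x ∈ past X 0, inner ℂ (w m) x = 0) :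
    Orthonormal ℂ (fun i : ℤ × Fin M => (U ^ i.1) (w i.2)) := by
  have key : ∀ s t : ℤ, ∀ m n, s < t → inner ℂ ((U ^ t) (w n)) ((U ^ s) (w m)) = 0 := by
    intro s t m n hst
    have h1 : (U ^ s) (w m) = (U ^ t) ((U ^ (s - t)) (w m)) := by
      change _ = (U ^ t * U ^ (s - t)) (w m)
      rw [← zpow_add, add_sub_cancel]
    rw [h1, LinearIsometryEquiv.inner_map_map]
    refine hw0 n _ (past_mono X ?_ (past_zpow X U hU (s - t) 1 (hw1 m)))
    omega
  rw [orthonormal_iff_ite]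
  rintro ⟨s, m⟩ ⟨t, n⟩
  simp only [Prod.mk.injEq]
  rcases lt_trichotomy s t with h | h | h
  · rw [if_neg fun h' => h.ne h'.1, ← inner_conj_symm, key s t m n h, map_zero]
  · subst h
    rw [LinearIsometryEquiv.inner_map_map, orthonormal_iff_ite.mp hw]
    simp
  · rw [if_neg fun h' => h.ne' h'.1, key t s n m h]

/-- If no predictor has an error below `P ‖Γ‖²`, the sequence is a moving average of order `N`
whose columns are eigenvectors. -/
theorem exists_movingAverage_of_le [CompleteSpace H] (X : ℤ → SeqL2 →L[ℂ] H) (U : H ≃ₗᵢ[ℂ] H)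
    (hU : ∀ j f, U (X j f) = X (j + 1) f) (b : ℕ → SeqL2) (hb0 : ∀ j, N < j → b j = 0)
    (P : ℝ) (hXs : Summable fun k => ‖X 0 (unitSeq k)‖ ^ 2)
    (hXP : ∑' k, ‖X 0 (unitSeq k)‖ ^ 2 ≤ P) (hν : 0 < ‖hankel N b‖ ^ 2)
    (herr : ∀ x ∈ past X 0, P * ‖hankel N b‖ ^ 2 ≤ ‖functional X b N - x‖ ^ 2) :
    ∃ (M : ℕ) (g : Fin M → BlockL2 N) (ε : ℤ → Fin M → H),
      (∀ m, QOp N b (star (g m)) = ((‖hankel N b‖ ^ 2 : ℝ) : ℂ) • star (g m)) ∧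
      ∑ m, ‖g m‖ ^ 2 = P ∧ Orthonormal ℂ (fun i : ℤ × Fin M => ε i.1 i.2) ∧
      ∀ j k, X j (unitSeq k) =
        ∑ p : Fin (N + 1), ∑ m : Fin M, (g m (p, k)) • ε (j - ((p : ℕ) : ℤ)) m := by
  obtain ⟨M, w, hwo, hw1, hw0, x, hx, hxe⟩ := exists_innovations (N := N) X U hU b
  set ν2 := ‖hankel N b‖ ^ 2 with hν2
  have hε := orthonormal_zpow X U hU w hwo hw1 hw0
  -- The blocks of `v m` collect the response of `X p` to the innovation `w m` after `p` steps. They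
  -- are the conjugated coefficients of the moving average to be found.
  let v : Fin M → BlockL2 N := fun m =>
    blockMk fun p => ContinuousLinearMap.adjoint (X ((p : ℕ) : ℤ)) (w m)
  have hv : ∀ m (p : Fin (N + 1)) k, (starRingEnd ℂ) (v m (p, k)) =
      inner ℂ (w m) (X ((p : ℕ) : ℤ) (unitSeq k)) := by
    intro m p k
    rw [← ContinuousLinearMap.adjoint_inner_left, inner_unitSeq_right]
    rfl
  have hUin : ∀ (s j : ℤ) m k, inner ℂ ((U ^ s) (w m)) (X j (unitSeq k)) =
      inner ℂ (w m) (X (j - s) (unitSeq k)) := by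
    intro s j m k
    have : X j (unitSeq k) = (U ^ s) (X (j - s) (unitSeq k)) := by
      rw [zpow_apply X U hU, sub_add_cancel]
    rw [this, LinearIsometryEquiv.inner_map_map]
  have hfun : ∀ (s : Fin (N + 1)) m,
      inner ℂ ((U ^ ((s : ℕ) : ℤ)) (w m)) (functional X b N) =
        inner ℂ (v m) (shiftVec N b s) := by
    intro s m
    refine inner_functional X b hb0 s (by omega) _ _ (fun j hj k => ?_) (fun p hp k => ?_)
    · rw [hUin]
      exact hw0 m _ (apply_mem_past X (by omega) _)
    · rw [hUin, hv, add_sub_cancel_left]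
  -- the power of the sequence bounds the norms of the columns
  have hcol : ∀ m, HasSum (fun k => ∑ p : Fin (N + 1),
      ‖inner ℂ ((U ^ (-((p : ℕ) : ℤ))) (w m)) (X 0 (unitSeq k))‖ ^ 2) (‖v m‖ ^ 2) := by
    intro m
    rw [norm_sq_eq_sum_blockPart]
    refine hasSum_sum fun p _ => ?_
    have h1 := lp.hasSum_norm (p := 2) (by norm_num) (blockPart (v m) p)
    simp only [ENNReal.toReal_ofNat, Real.rpow_ofNat] at h1
    convert h1 using 2 with k
    rw [hUin, zero_sub, neg_neg, ← hv, RCLike.norm_conj, blockPart_apply]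
  have hcols : HasSum (fun k => ∑ m, ∑ p : Fin (N + 1),
      ‖inner ℂ ((U ^ (-((p : ℕ) : ℤ))) (w m)) (X 0 (unitSeq k))‖ ^ 2) (∑ m, ‖v m‖ ^ 2) :=
    hasSum_sum fun m _ => hcol m
  have hε' : Orthonormal ℂ (fun i : Fin M × Fin (N + 1) =>
      (U ^ (-((i.2 : ℕ) : ℤ))) (w i.1)) := by
    refine hε.comp (fun i : Fin M × Fin (N + 1) => ((-((i.2 : ℕ) : ℤ), i.1) : ℤ × Fin M)) ?_
    rintro ⟨p, m⟩ ⟨q, n⟩ h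
    simp only [Prod.mk.injEq, neg_inj] at h
    exact Prod.ext h.2 (Fin.ext (by exact_mod_cast h.1))
  have hbess : ∀ k, ∑ m, ∑ p : Fin (N + 1),
      ‖inner ℂ ((U ^ (-((p : ℕ) : ℤ))) (w m)) (X 0 (unitSeq k))‖ ^ 2 ≤ ‖X 0 (unitSeq k)‖ ^ 2 := by
    intro k
    have h := hε'.sum_inner_products_le (X 0 (unitSeq k)) (s := Finset.univ)
    rwa [Fintype.sum_prod_type] at h
  have hle1 : ∑ m, ‖v m‖ ^ 2 ≤ ∑' k, ‖X 0 (unitSeq k)‖ ^ 2 :=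
    hasSum_le hbess hcols hXs.hasSum
  have hterm : ∀ m, ∑ s : Fin (N + 1), ‖inner ℂ (shiftVec N b s) (v m)‖ ^ 2 ≤ ν2 * ‖v m‖ ^ 2 :=
    fun m => sum_norm_sq_inner_shiftVec_le b (v m)
  -- The chain is `P ν2 ≤ ∑ ‖Γ* v m‖² ≤ ν2 ∑ ‖v m‖² ≤ ν2 ∑ ‖X 0 (unitSeq k)‖² ≤ ν2 P`, so equality
  -- holds throughout. Equality in the second link makes each `v m` zero or an eigenvector. The
  -- positivity of `ν2` allows it to be cancelled, giving `∑ ‖v m‖² = P`.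
  have herr' : P * ν2 ≤ ∑ m, ∑ s : Fin (N + 1), ‖inner ℂ (shiftVec N b s) (v m)‖ ^ 2 := by
    refine (herr x hx).trans (le_of_eq ?_)
    rw [hxe, Finset.sum_comm]
    refine Finset.sum_congr rfl fun m _ => Finset.sum_congr rfl fun s _ => ?_
    rw [hfun, norm_inner_symm]
  have hle2 : ∑ m, ∑ s : Fin (N + 1), ‖inner ℂ (shiftVec N b s) (v m)‖ ^ 2 ≤
      ∑ m, ν2 * ‖v m‖ ^ 2 := Finset.sum_le_sum fun m _ => hterm m
  have hvP : ∑ m, ‖v m‖ ^ 2 = P := by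
    refine le_antisymm (hle1.trans hXP) ?_
    rw [← Finset.mul_sum] at hle2
    nlinarith
  have heig : ∀ m, ∑ s : Fin (N + 1), ‖inner ℂ (shiftVec N b s) (v m)‖ ^ 2 = ν2 * ‖v m‖ ^ 2 := by
    have h : ∑ m, ∑ s : Fin (N + 1), ‖inner ℂ (shiftVec N b s) (v m)‖ ^ 2 =
        ∑ m, ν2 * ‖v m‖ ^ 2 := by
      refine le_antisymm hle2 ?_
      rw [← Finset.mul_sum, hvP, mul_comm]
      exact herr'
    intro m
    exact (Finset.sum_eq_sum_iff_of_le fun m _ => hterm m).mp h m (Finset.mem_univ m)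
  -- The termwise Bessel inequalities have equal sums, hence each is an equality. Every component at
  -- time `0` therefore lies in the span of the noise at the times `-N, …, 0`.
  have hbeq : ∀ k, ‖X 0 (unitSeq k)‖ ^ 2 = ∑ m, ∑ p : Fin (N + 1),
      ‖inner ℂ ((U ^ (-((p : ℕ) : ℤ))) (w m)) (X 0 (unitSeq k))‖ ^ 2 := by
    have h1 := hXs.hasSum.sub hcols
    have h2 : ∑' k, ‖X 0 (unitSeq k)‖ ^ 2 - ∑ m, ‖v m‖ ^ 2 = 0 := by linarith
    rw [h2, hasSum_zero_iff_of_nonneg fun k => sub_nonneg.mpr (hbess k)] at h1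
    intro k
    exact sub_eq_zero.mp (congrFun h1 k)
  refine ⟨M, fun m => star (v m), fun s m => (U ^ s) (w m), fun m => ?_, ?_, hε, fun j k => ?_⟩
  · simp only [star_star]
    exact (QOp_apply_eq_smul_iff b (v m)).mpr (heig m)
  · simp only [norm_star]
    exact hvP
  · have h1 := eq_sum_inner_smul_of_norm_sq_le hε' (X 0 (unitSeq k)) (by
      rw [Fintype.sum_prod_type]; exact (hbeq k).le)
    have h2 : X j (unitSeq k) = (U ^ j) (X 0 (unitSeq k)) := by
      rw [zpow_apply X U hU, zero_add]
    rw [h2, h1, map_sum, Fintype.sum_prod_type, Finset.sum_comm]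
    refine Finset.sum_congr rfl fun p _ => Finset.sum_congr rfl fun m _ => ?_
    rw [map_smul, hUin, zero_sub, neg_neg, ← hv, lp.star_apply]
    congr 1
    change (U ^ j * U ^ (-((p : ℕ) : ℤ))) (w m) = _
    rw [← zpow_add, sub_eq_add_neg]

/-- The closed linear span of a sequence of operators. -/
def total (X : ℤ → SeqL2 →L[ℂ] H) : Submodule ℂ H :=
  (Submodule.span ℂ {x | ∃ j f, x = X j f}).topologicalClosure

theorem apply_mem_total (X : ℤ → SeqL2 →L[ℂ] H) (j : ℤ) (f : SeqL2) : X j f ∈ total X :=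
  Submodule.le_topologicalClosure _ (Submodule.subset_span ⟨j, f, rfl⟩)

/-- A stationary sequence, as a sequence in its closed linear span. -/
def toTotal (X : ℤ → SeqL2 →L[ℂ] H) (j : ℤ) : SeqL2 →L[ℂ] total X :=
  (X j).codRestrict (total X) (apply_mem_total X j)

theorem coe_toTotal (X : ℤ → SeqL2 →L[ℂ] H) (j : ℤ) (f : SeqL2) :
    (toTotal X j f : H) = X j f := rfl

/-- Stationarity makes the shift of finite combinations norm preserving, and it is bijective on
formal combinations. It therefore extends to a unitary operator of the closed span; on all of `H` no
shift need be given. -/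
theorem IsStationary.exists_shift [CompleteSpace H] {X : ℤ → SeqL2 →L[ℂ] H}
    (hX : IsStationary X) :
    ∃ U : total X ≃ₗᵢ[ℂ] total X, ∀ j f, U (toTotal X j f) = toTotal X (j + 1) f := by
  have : CompleteSpace (total X) :=
    (Submodule.isClosed_topologicalClosure _).completeSpace_coe
  let e : (ℤ →₀ SeqL2) →ₗ[ℂ] total X := Finsupp.lsum ℂ fun j => (toTotal X j).toLinearMap
  let f : (ℤ →₀ SeqL2) ≃ₗ[ℂ] (ℤ →₀ SeqL2) := Finsupp.domLCongr (Equiv.addRight 1)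
  have he : ∀ j x, e (Finsupp.single j x) = toTotal X j x := fun j x => by simp [e]
  have hf : ∀ j x, f (Finsupp.single j x) = Finsupp.single (j + 1) x := fun j x => by simp [f]
  have hd : DenseRange e := by
    intro y
    have h1 : Set.range e = ((LinearMap.range e : Submodule ℂ (total X)) : Set (total X)) := rfl
    rw [h1, Topology.IsInducing.subtypeVal.closure_eq_preimage_closure_image]
    refine closure_mono ?_ y.2
    have h2 : Submodule.span ℂ {x | ∃ j f, x = X j f} ≤
        (LinearMap.range e).map (total X).subtype := by
      rw [Submodule.span_le]
      rintro _ ⟨j, x, rfl⟩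
      exact ⟨toTotal X j x, ⟨Finsupp.single j x, he j x⟩, rfl⟩
    exact fun y hy => h2 hy
  have hn : ∀ x, ‖e (f x)‖ = ‖e x‖ := by
    intro x
    have h1 : e (f x) = ∑ j ∈ x.support, toTotal X (j + 1) (x j) := by
      conv_lhs => rw [← x.sum_single, Finsupp.sum, map_sum, map_sum]
      exact Finset.sum_congr rfl fun j _ => by rw [hf, he]
    have h2 : e x = ∑ j ∈ x.support, toTotal X j (x j) := by
      conv_lhs => rw [← x.sum_single, Finsupp.sum, map_sum]
      exact Finset.sum_congr rfl fun j _ => he _ _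
    rw [h1, h2]
    change ‖((∑ j ∈ x.support, toTotal X (j + 1) (x j) : total X) : H)‖ =
      ‖((∑ j ∈ x.support, toTotal X j (x j) : total X) : H)‖
    simp only [Submodule.coe_sum, coe_toTotal]
    exact hX.norm_sum_add _ _ _ _
  refine ⟨f.extendOfIsometry e e hd hd hn, fun j x => ?_⟩
  rw [← he, LinearEquiv.extendOfIsometry_eq, hf, he]

/-- The unitary case applied inside `total X`. The noise is thereby found in the closed span of the
sequence, and so inherits mean zero from it. -/
theorem exists_movingAverage_of_isStationary [CompleteSpace H] {X : ℤ → SeqL2 →L[ℂ] H}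
    (hX : IsStationary X) (b : ℕ → SeqL2) (hb0 : ∀ j, N < j → b j = 0)
    (P : ℝ) (hXs : Summable fun k => ‖X 0 (unitSeq k)‖ ^ 2)
    (hXP : ∑' k, ‖X 0 (unitSeq k)‖ ^ 2 ≤ P) (hν : 0 < ‖hankel N b‖ ^ 2)
    (herr : ∀ x ∈ past X 0, P * ‖hankel N b‖ ^ 2 ≤ ‖functional X b N - x‖ ^ 2) :
    ∃ (M : ℕ) (g : Fin M → BlockL2 N) (ε : ℤ → Fin M → H),
      (∀ m, QOp N b (star (g m)) = ((‖hankel N b‖ ^ 2 : ℝ) : ℂ) • star (g m)) ∧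
      ∑ m, ‖g m‖ ^ 2 = P ∧ Orthonormal ℂ (fun i : ℤ × Fin M => ε i.1 i.2) ∧
      (∀ s m, ε s m ∈ total X) ∧ ∀ j k, X j (unitSeq k) =
        ∑ p : Fin (N + 1), ∑ m : Fin M, (g m (p, k)) • ε (j - ((p : ℕ) : ℤ)) m := by
  have : CompleteSpace (total X) :=
    (Submodule.isClosed_topologicalClosure _).completeSpace_coe
  obtain ⟨U, hU⟩ := hX.exists_shift
  have hF : ((functional (toTotal X) b N : total X) : H) = functional X b N := by
    rw [functional, Submodule.coe_sum]
    rfl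
  have hpast : ∀ x ∈ past (toTotal X) 0, (x : H) ∈ past X 0 := by
    have : past (toTotal X) 0 ≤ (past X 0).comap (total X).subtype := by
      refine Submodule.topologicalClosure_minimal _ ?_ ?_
      · rw [Submodule.span_le]
        rintro _ ⟨j, hj, k, rfl⟩
        exact apply_mem_past X hj _
      · exact (Submodule.isClosed_topologicalClosure _).preimage continuous_subtype_val
    exact fun x hx => this hx
  obtain ⟨M, g, ε, hg, hP, hε, hma⟩ := exists_movingAverage_of_le (toTotal X) U hU b hb0 P
    hXs hXP hν fun x hx => by
      have := herr x (hpast x hx)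
      rwa [← hF] at this
  refine ⟨M, g, fun s m => ε s m, hg, hP, hε.comp_linearIsometry (total X).subtypeₗᵢ,
    fun s m => (ε s m).2, fun j k => ?_⟩
  have := congrArg (Subtype.val) (hma j k)
  simpa [coe_toTotal] using this

end Converse

/-! ### The Fourier basis of `L₂([0,T))` -/

section FourierBasis

theorem freq_surjective (n : ℤ) : ∃ k, freq k = n := by
  rcases lt_or_ge 0 n with h | h
  · obtain ⟨m, rfl⟩ : ∃ m : ℕ, n = m + 1 := ⟨(n - 1).toNat, by omega⟩
    refine ⟨2 * m + 1, ?_⟩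
    have h1 : (2 * m + 1 + 1) / 2 = m + 1 := by omega
    have h2 : (-1 : ℤ) ^ (2 * m + 1 + 1) = 1 := Even.neg_one_pow ⟨m + 1, by ring⟩
    rw [freq, h1, h2]
    push_cast
    ring
  · obtain ⟨m, rfl⟩ : ∃ m : ℕ, n = -m := ⟨(-n).toNat, by omega⟩
    refine ⟨2 * m, ?_⟩
    have h1 : (2 * m + 1) / 2 = m := by omega
    have h2 : (-1 : ℤ) ^ (2 * m + 1) = -1 := Odd.neg_one_pow ⟨m, rfl⟩
    rw [freq, h1, h2]
    ring

theorem freq_injective : Function.Injective freq := by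
  have hodd : ∀ m, freq (2 * m + 1) = m + 1 := by
    intro m
    have h1 : (2 * m + 1 + 1) / 2 = m + 1 := by omega
    have h2 : (-1 : ℤ) ^ (2 * m + 1 + 1) = 1 := Even.neg_one_pow ⟨m + 1, by ring⟩
    rw [freq, h1, h2]
    push_cast
    ring
  have heven : ∀ m, freq (2 * m) = -m := by
    intro m
    have h1 : (2 * m + 1) / 2 = m := by omega
    have h2 : (-1 : ℤ) ^ (2 * m + 1) = -1 := Odd.neg_one_pow ⟨m, rfl⟩
    rw [freq, h1, h2]
    ring
  intro k l h
  rcases Nat.even_or_odd' k with ⟨m, rfl | rfl⟩ <;> rcases Nat.even_or_odd' l with ⟨n, rfl | rfl⟩ <;>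
    simp only [hodd, heven] at h <;> omega

variable {T : ℝ}

theorem continuous_basisFun (T : ℝ) (k : ℕ) : Continuous (basisFun T k) := by
  unfold basisFun
  fun_prop

theorem conj_basisFun (T : ℝ) (k : ℕ) (u : ℝ) :
    (starRingEnd ℂ) (basisFun T k u) = basisFun T (oppIndex k) u := by
  have h : (freq (oppIndex k) : ℂ) = -freq k := by
    have := freq_oppIndex k
    exact_mod_cast eq_neg_of_add_eq_zero_right this
  rw [basisFun, basisFun, h, map_mul, ← Complex.exp_conj]
  simp only [map_div₀, map_one, map_mul, Complex.conj_ofReal, Complex.conj_I, map_ofNat,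
    Complex.conj_ofReal, map_intCast]
  congr 2
  ring

theorem norm_basisFun_le (T : ℝ) (k : ℕ) (u : ℝ) : ‖basisFun T k u‖ ≤ 1 / Real.sqrt T := by
  have : 2 * Real.pi * Complex.I * (freq k : ℂ) * u / T =
      ((2 * Real.pi * freq k * u / T : ℝ) : ℂ) * Complex.I := by
    push_cast; ring
  rw [basisFun, norm_mul, this, Complex.norm_exp_ofReal_mul_I, mul_one, norm_div, norm_one,
    Complex.norm_real, Real.norm_of_nonneg (Real.sqrt_nonneg T)]

theorem integral_conj_basisFun_mul (hT : 0 < T) (k n : ℕ) :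
    ∫ u in Set.Ico 0 T, (starRingEnd ℂ) (basisFun T k u) * basisFun T n u =
      if k = n then 1 else 0 := by
  have hT' : (T : ℂ) ≠ 0 := Complex.ofReal_ne_zero.mpr hT.ne'
  have hsq : (1 / (Real.sqrt T : ℂ)) * (1 / (Real.sqrt T : ℂ)) = 1 / T := by
    rw [div_mul_div_comm, one_mul, ← Complex.ofReal_mul, Real.mul_self_sqrt hT.le]
  have h1 : ∀ u : ℝ, (starRingEnd ℂ) (basisFun T k u) * basisFun T n u =
      1 / T * Complex.exp ((2 * Real.pi * Complex.I * ((freq n - freq k : ℤ) : ℂ) / T) * u) := by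
    intro u
    have h : (freq (oppIndex k) : ℂ) = -freq k := by
      have := freq_oppIndex k
      exact_mod_cast eq_neg_of_add_eq_zero_right this
    rw [conj_basisFun, basisFun, basisFun, h, mul_mul_mul_comm, hsq, ← Complex.exp_add]
    congr 2
    push_cast
    ring
  simp only [h1]
  rw [integral_Ico_eq_integral_Ioc, ← intervalIntegral.integral_of_le hT.le,
    intervalIntegral.integral_const_mul]
  by_cases hkn : k = n
  · subst hkn
    simp [hT.ne']
  · rw [if_neg hkn]
    have hf : freq n - freq k ≠ 0 := sub_ne_zero.mpr fun h => hkn (freq_injective h.symm)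
    rw [integral_exp_mul_complex]
    · have h2 : (2 * Real.pi * Complex.I * ((freq n - freq k : ℤ) : ℂ) / T) * T =
          ((freq n - freq k : ℤ) : ℂ) * (2 * Real.pi * Complex.I) := by
        field_simp
      rw [h2, Complex.exp_int_mul_two_pi_mul_I]
      simp
    · have : ((freq n - freq k : ℤ) : ℂ) ≠ 0 := Int.cast_ne_zero.mpr hf
      exact div_ne_zero (mul_ne_zero Complex.two_pi_I_ne_zero this) hT'

/-- An integrable function on `[0,T)` is determined by its Fourier coefficients. -/
theorem ae_eq_zero_of_fourier_eq_zero (hT : 0 < T) (f : ℝ → ℂ)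
    (hf : IntegrableOn f (Set.Ico 0 T))
    (h0 : ∀ k, ∫ u in Set.Ico 0 T, basisFun T k u * f u = 0) :
    f =ᵐ[volume.restrict (Set.Ico 0 T)] 0 := by
  have : Fact (0 < T) := ⟨hT⟩
  have hbd : ∀ g : C(AddCircle T, ℂ),
      IntegrableOn (fun u : ℝ => g u * f u) (Set.Ico 0 T) := fun g =>
    hf.bdd_mul (c := ‖g‖) (by fun_prop) (Eventually.of_forall fun u => g.norm_coe_le_norm _)
  -- Integration against `f` is continuous for the uniform norm and vanishes on trigonometric
  -- polynomials, which are uniformly dense. Only integrability of `f` is used.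
  let Φ : C(AddCircle T, ℂ) →L[ℂ] ℂ := LinearMap.mkContinuous
    { toFun := fun g => ∫ u in Set.Ico 0 T, g u * f u
      map_add' := fun g g' => by
        simp only [ContinuousMap.add_apply, add_mul]
        exact integral_add (hbd g) (hbd g')
      map_smul' := fun c g => by
        simp only [ContinuousMap.smul_apply, smul_mul_assoc, RingHom.id_apply]
        exact integral_smul c _ }
    (∫ u in Set.Ico 0 T, ‖f u‖) fun g => by
      rw [mul_comm, ← integral_const_mul]
      refine norm_integral_le_of_norm_le (hf.norm.const_mul _) (Eventually.of_forall fun u => ?_)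
      rw [norm_mul]
      exact mul_le_mul_of_nonneg_right (g.norm_coe_le_norm _) (norm_nonneg _)
  have hΦ0 : ∀ g, Φ g = 0 := by
    have h1 : Submodule.span ℂ (Set.range (@fourier T)) ≤ LinearMap.ker Φ.toLinearMap := by
      rw [Submodule.span_le]
      rintro _ ⟨n, rfl⟩
      obtain ⟨k, rfl⟩ := freq_surjective n
      change ∫ u in Set.Ico 0 T, fourier (freq k) (u : AddCircle T) * f u = 0
      have h2 : ∀ u : ℝ, fourier (freq k) (u : AddCircle T) * f u =
          (Real.sqrt T : ℂ) * (basisFun T k u * f u) := by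
        intro u
        have : (Real.sqrt T : ℂ) ≠ 0 :=
          Complex.ofReal_ne_zero.mpr (Real.sqrt_pos.mpr hT).ne'
        rw [fourier_coe_apply, basisFun]
        field_simp
      simp only [h2]
      rw [integral_const_mul, h0, mul_zero]
    have h3 := Submodule.topologicalClosure_minimal _ h1 Φ.isClosed_ker
    rw [span_fourier_closure_eq_top] at h3
    exact fun g => h3 Submodule.mem_top
  have h4 : ∀ᵐ x ∂(volume : Measure ℝ), x ∈ Set.Ioo 0 T → f x = 0 := by
    refine isOpen_Ioo.ae_eq_zero_of_integral_contDiff_smul_eq_zero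
      ((hf.mono_set Set.Ioo_subset_Ico_self).locallyIntegrableOn) fun g hg _ hgU => ?_
    have hg0 : ∀ x ∉ Set.Ioo 0 T, g x = 0 := fun x hx =>
      image_eq_zero_of_notMem_tsupport fun h => hx (hgU h)
    -- A test function with support inside `(0,T)` extends periodically to a continuous function on
    -- the circle.
    let G : C(AddCircle T, ℂ) := ⟨AddCircle.liftIco T 0 fun u => (g u : ℂ),
      AddCircle.liftIco_zero_continuous (by rw [hg0 0 (by simp), hg0 T (by simp)])
        (Complex.continuous_ofReal.comp hg.continuous).continuousOn⟩
    have h5 : ∫ u in Set.Ico 0 T, G u * f u = 0 := hΦ0 G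
    rw [← h5, ← setIntegral_eq_integral_of_forall_compl_eq_zero (s := Set.Ico 0 T)]
    · refine setIntegral_congr_fun measurableSet_Ico fun u hu => ?_
      have hu' : u ∈ Set.Ico 0 (0 + T) := by rwa [zero_add]
      have : G u = (g u : ℂ) := 
        AddCircle.liftIco_coe_apply (f := fun u => (g u : ℂ)) hu'
      simp only [this, Complex.real_smul]
    · intro x hx
      rw [hg0 x fun h => hx (Set.Ioo_subset_Ico_self h), zero_smul]
  rw [Filter.EventuallyEq, Measure.restrict_congr_set Ioo_ae_eq_Ico.symm,
    ae_restrict_iff' measurableSet_Ioo]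
  exact h4

/-- The space `L₂([0,T))`. -/
abbrev PeriodL2 (T : ℝ) : Type := Lp ℂ 2 (volume.restrict (Set.Ico 0 T))

theorem memLp_conj_basisFun (T : ℝ) (k : ℕ) :
    MemLp (fun u => (starRingEnd ℂ) (basisFun T k u)) 2 (volume.restrict (Set.Ico 0 T)) := by
  simp only [conj_basisFun]
  exact MemLp.of_bound (continuous_basisFun T _).aestronglyMeasurable _
    (Eventually.of_forall (norm_basisFun_le T _))

theorem orthonormal_conj_basisFun (hT : 0 < T) :
    Orthonormal ℂ (fun k => (memLp_conj_basisFun T k).toLp : ℕ → PeriodL2 T) := by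
  rw [orthonormal_iff_ite]
  intro k n
  rw [L2.inner_def]
  have h : ∀ᵐ u ∂(volume.restrict (Set.Ico 0 T)),
      inner ℂ ((memLp_conj_basisFun T k).toLp _ u) ((memLp_conj_basisFun T n).toLp _ u) =
        (starRingEnd ℂ) (basisFun T n u) * basisFun T k u := by
    filter_upwards [(memLp_conj_basisFun T k).coeFn_toLp, (memLp_conj_basisFun T n).coeFn_toLp]
      with u h1 h2
    rw [h1, h2, RCLike.inner_apply, Complex.conj_conj]
  rw [integral_congr_ae h, integral_conj_basisFun_mul hT]
  simp only [eq_comm]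

/-- The Hilbert basis of the functions `conj e_k` of `L₂([0,T))`. -/
def conjBasis (hT : 0 < T) : HilbertBasis ℕ ℂ (PeriodL2 T) :=
  HilbertBasis.mkOfOrthogonalEqBot (orthonormal_conj_basisFun hT) (by
    rw [Submodule.eq_bot_iff]
    intro f hf
    rw [Lp.eq_zero_iff_ae_eq_zero]
    refine ae_eq_zero_of_fourier_eq_zero hT f ((Lp.memLp f).integrable (by norm_num)) fun k => ?_
    have h := Submodule.inner_right_of_mem_orthogonal
      (Submodule.subset_span (Set.mem_range_self k)) hf
    rw [L2.inner_def] at h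
    rw [← h]
    refine integral_congr_ae ?_
    filter_upwards [(memLp_conj_basisFun T k).coeFn_toLp] with u h1
    rw [h1, RCLike.inner_apply, Complex.conj_conj, mul_comm])

theorem conjBasis_apply (hT : 0 < T) (k : ℕ) :
    conjBasis hT k = (memLp_conj_basisFun T k).toLp := by
  rw [conjBasis, HilbertBasis.coe_mkOfOrthogonalEqBot]

theorem conjBasis_repr_apply (hT : 0 < T) (f : PeriodL2 T) (k : ℕ) :
    (conjBasis hT).repr f k = ∫ u in Set.Ico 0 T, f u * basisFun T k u := by
  rw [HilbertBasis.repr_apply_apply, conjBasis_apply, L2.inner_def]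
  refine integral_congr_ae ?_
  filter_upwards [(memLp_conj_basisFun T k).coeFn_toLp] with u h1
  rw [h1, RCLike.inner_apply, Complex.conj_conj]

theorem conjBasis_repr_symm_unitSeq (hT : 0 < T) (k : ℕ) :
    (conjBasis hT).repr.symm (unitSeq k) = (memLp_conj_basisFun T k).toLp := by
  rw [unitSeq, HilbertBasis.repr_symm_single, conjBasis_apply]

/-- An integrable function on `[0,T)` with square summable Fourier coefficients is square
integrable. -/
theorem ae_eq_repr_symm (hT : 0 < T) (f : ℝ → ℂ) (hf : IntegrableOn f (Set.Ico 0 T)) (c : SeqL2)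
    (hc : ∀ k, c k = ∫ u in Set.Ico 0 T, f u * basisFun T k u) :
    f =ᵐ[volume.restrict (Set.Ico 0 T)] ((conjBasis hT).repr.symm c : PeriodL2 T) := by
  set h := (conjBasis hT).repr.symm c with hh
  have hi : IntegrableOn (h : ℝ → ℂ) (Set.Ico 0 T) := (Lp.memLp h).integrable (by norm_num)
  have hcoef : ∀ k, ∫ u in Set.Ico 0 T, h u * basisFun T k u = c k := by
    intro k
    rw [← conjBasis_repr_apply hT, hh, LinearIsometryEquiv.apply_symm_apply]
  have hbm : ∀ (g : ℝ → ℂ), IntegrableOn g (Set.Ico 0 T) → ∀ k,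
      IntegrableOn (fun u => basisFun T k u * g u) (Set.Ico 0 T) := fun g hg k =>
    hg.bdd_mul (c := 1 / Real.sqrt T) (continuous_basisFun T k).aestronglyMeasurable
      (Eventually.of_forall (norm_basisFun_le T k))
  have h0 := ae_eq_zero_of_fourier_eq_zero hT (fun u => f u - h u) (hf.sub hi) fun k => by
    simp only [mul_sub]
    rw [integral_sub (hbm _ hf k) (hbm _ hi k), sub_eq_zero]
    simp only [mul_comm (basisFun T k _)]
    rw [hcoef, hc]
  filter_upwards [h0] with u hu
  exact sub_eq_zero.mp hu

end FourierBasis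

/-! ### The operators generated by a process -/

section Pairing

variable {H : Type*} [NormedAddCommGroup H] [InnerProductSpace ℂ H] {T : ℝ}

theorem integrable_smul_of_memLp {α : Type*} [MeasurableSpace α] {ν : Measure α} {f : α → ℂ}
    {X : α → H} (hf : MemLp f 2 ν) (hX : MemLp X 2 ν) : Integrable (fun u => f u • X u) ν :=
  memLp_one_iff_integrable.mp (hX.smul hf)

/-- The operator `f ↦ ∫ f(u) X(u) du` on `L₂([0,T))`. -/
def pairing [CompleteSpace H] (X : ℝ → H) (hX : MemLp X 2 (volume.restrict (Set.Ico 0 T))) :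
    PeriodL2 T →L[ℂ] H :=
  LinearMap.mkContinuous
    { toFun := fun f => ∫ u in Set.Ico 0 T, f u • X u
      map_add' := fun f g => by
        rw [← integral_add (integrable_smul_of_memLp (Lp.memLp f) hX)
          (integrable_smul_of_memLp (Lp.memLp g) hX)]
        refine integral_congr_ae ?_
        filter_upwards [Lp.coeFn_add f g] with u hu
        rw [hu, Pi.add_apply, add_smul]
      map_smul' := fun c f => by
        rw [RingHom.id_apply, ← integral_smul]
        refine integral_congr_ae ?_
        filter_upwards [Lp.coeFn_smul c f] with u hu
        rw [hu, Pi.smul_apply, smul_assoc] }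
    (eLpNorm X 2 (volume.restrict (Set.Ico 0 T))).toReal fun f => by
      have hf := Lp.memLp f
      have h1 : ‖∫ u in Set.Ico 0 T, f u • X u‖ ≤
          (eLpNorm (fun u => f u • X u) 1 (volume.restrict (Set.Ico 0 T))).toReal := by
        rw [eLpNorm_one_eq_lintegral_enorm]
        simpa only [ofReal_norm] using norm_integral_le_lintegral_norm (fun u => f u • X u)
      refine h1.trans ?_
      rw [Lp.norm_def, mul_comm, ← ENNReal.toReal_mul]
      refine ENNReal.toReal_mono (ENNReal.mul_ne_top hf.2.ne hX.2.ne) ?_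
      exact eLpNorm_smul_le_mul_eLpNorm hX.1 hf.1

/-- The inner product passes through one integral at a time, so no joint measurability is needed.
The result depends on `F` and `G` only through the inner products of their values. -/
theorem inner_integral_integral [CompleteSpace H] {α : Type*} [MeasurableSpace α] {ν : Measure α} {F G : α → H}
    (hF : Integrable F ν) (hG : Integrable G ν) :
    inner ℂ (∫ u, F u ∂ν) (∫ v, G v ∂ν) = ∫ v, (starRingEnd ℂ) (∫ u, inner ℂ (G v) (F u) ∂ν) ∂ν := by
  rw [← integral_inner hG]
  refine integral_congr_ae (Eventually.of_forall fun v => ?_)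
  simp only
  rw [integral_inner hF, inner_conj_symm]

theorem norm_sq_eq_integral {α : Type*} [MeasurableSpace α] {ν : Measure α} (f : Lp H 2 ν) :
    ‖f‖ ^ 2 = ∫ u, ‖f u‖ ^ 2 ∂ν := by
  have h1 : ((‖f‖ ^ 2 : ℝ) : ℂ) = inner ℂ f f := by
    rw [inner_self_eq_norm_sq_to_K]; norm_cast
  have h2 : inner ℂ f f = ((∫ u, ‖f u‖ ^ 2 ∂ν : ℝ) : ℂ) := by
    rw [L2.inner_def, ← integral_complex_ofReal]
    refine integral_congr_ae (Eventually.of_forall fun u => ?_)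
    simp only
    rw [inner_self_eq_norm_sq_to_K]
    norm_cast
  exact Complex.ofReal_injective (h1.trans h2)

theorem norm_sq_toLp {α : Type*} [MeasurableSpace α] {ν : Measure α} {X : α → H}
    (hX : MemLp X 2 ν) : ‖hX.toLp‖ ^ 2 = ∫ u, ‖X u‖ ^ 2 ∂ν := by
  rw [norm_sq_eq_integral]
  refine integral_congr_ae ?_
  filter_upwards [hX.coeFn_toLp] with u hu
  rw [hu]

/-- Bessel's inequality for functions with values in a Hilbert space. -/
theorem sum_norm_sq_integral_conj_basisFun_le [CompleteSpace H] (hT : 0 < T) (X : ℝ → H)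
    (hX : MemLp X 2 (volume.restrict (Set.Ico 0 T))) (S : Finset ℕ) :
    ∑ k ∈ S, ‖∫ u in Set.Ico 0 T, (starRingEnd ℂ) (basisFun T k u) • X u‖ ^ 2 ≤
      ∫ u in Set.Ico 0 T, ‖X u‖ ^ 2 := by
  set x : ℕ → H := fun k => ∫ u in Set.Ico 0 T, (starRingEnd ℂ) (basisFun T k u) • X u with hx
  have hE : ∀ k, MemLp (fun u => basisFun T k u • x k) 2 (volume.restrict (Set.Ico 0 T)) := by
    intro k
    refine MemLp.of_bound ((continuous_basisFun T k).smul continuous_const).aestronglyMeasurable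
      (1 / Real.sqrt T * ‖x k‖) (Eventually.of_forall fun u => ?_)
    rw [norm_smul]
    exact mul_le_mul_of_nonneg_right (norm_basisFun_le T k u) (norm_nonneg _)
  -- The functions `E k = e_k ⊗ x k` are pairwise orthogonal, with `‖E k‖ = ‖x k‖` and `⟨E k, X⟩ =
  -- ‖x k‖²`. Cauchy–Schwarz for `∑ E k` and `X` then gives the bound.
  let E : ℕ → Lp H 2 (volume.restrict (Set.Ico 0 T)) := fun k => (hE k).toLp
  let Xv : Lp H 2 (volume.restrict (Set.Ico 0 T)) := hX.toLp
  have h1 : ∀ k n, inner ℂ (E k) (E n) = if k = n then inner ℂ (x k) (x n) else 0 := by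
    intro k n
    rw [L2.inner_def]
    have : ∀ᵐ u ∂(volume.restrict (Set.Ico 0 T)), inner ℂ (E k u) (E n u) =
        (starRingEnd ℂ) (basisFun T k u) * basisFun T n u * inner ℂ (x k) (x n) := by
      filter_upwards [(hE k).coeFn_toLp, (hE n).coeFn_toLp] with u h1 h2
      rw [h1, h2, inner_smul_left, inner_smul_right, mul_assoc]
    rw [integral_congr_ae this, integral_mul_const, integral_conj_basisFun_mul hT]
    split_ifs <;> simp
  have h2 : ∀ k, inner ℂ (E k) Xv = inner ℂ (x k) (x k) := by
    intro k
    rw [L2.inner_def]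
    have : ∀ᵐ u ∂(volume.restrict (Set.Ico 0 T)), inner ℂ (E k u) (Xv u) =
        inner ℂ (x k) ((starRingEnd ℂ) (basisFun T k u) • X u) := by
      filter_upwards [(hE k).coeFn_toLp, hX.coeFn_toLp] with u h1 h2
      rw [h1, h2, inner_smul_left, inner_smul_right]
    rw [integral_congr_ae this, integral_inner]
    refine integrable_smul_of_memLp (memLp_conj_basisFun T k) hX
  have hself : ∀ y : H, inner ℂ y y = ((‖y‖ ^ 2 : ℝ) : ℂ) := fun y => by
    rw [inner_self_eq_norm_sq_to_K]; norm_cast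
  have h3 : ((‖∑ k ∈ S, E k‖ ^ 2 : ℝ) : ℂ) = ((∑ k ∈ S, ‖x k‖ ^ 2 : ℝ) : ℂ) := by
    have : inner ℂ (∑ k ∈ S, E k) (∑ k ∈ S, E k) = ((‖∑ k ∈ S, E k‖ ^ 2 : ℝ) : ℂ) := by
      rw [inner_self_eq_norm_sq_to_K]; norm_cast
    rw [← this, sum_inner]
    push_cast
    refine Finset.sum_congr rfl fun k hk => ?_
    rw [inner_sum]
    simp only [h1]
    rw [Finset.sum_ite_eq, if_pos hk, hself]
    push_cast
    rfl
  have h3' := Complex.ofReal_injective h3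
  have h4 : ((∑ k ∈ S, ‖x k‖ ^ 2 : ℝ) : ℂ) = inner ℂ (∑ k ∈ S, E k) Xv := by
    rw [sum_inner]
    push_cast
    refine Finset.sum_congr rfl fun k _ => ?_
    rw [h2, hself]
    push_cast
    rfl
  have h5 : ∑ k ∈ S, ‖x k‖ ^ 2 ≤ ‖∑ k ∈ S, E k‖ * ‖Xv‖ := by
    have h0 : 0 ≤ ∑ k ∈ S, ‖x k‖ ^ 2 := Finset.sum_nonneg fun _ _ => sq_nonneg _
    have := norm_inner_le_norm (𝕜 := ℂ) (∑ k ∈ S, E k) Xv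
    rwa [← h4, Complex.norm_real, Real.norm_of_nonneg h0] at this
  have h6 : ‖Xv‖ ^ 2 = ∫ u in Set.Ico 0 T, ‖X u‖ ^ 2 := norm_sq_toLp hX
  rw [← h6]
  nlinarith [norm_nonneg (∑ k ∈ S, E k), norm_nonneg Xv]

end Pairing

section GeneratedOperators

variable {Ω : Type*} [MeasurableSpace Ω] {μ : Measure Ω} {T P : ℝ} {d τ N : ℕ}
  {ξ : ℝ → Lp ℂ 2 μ}

/-- The operators `f ↦ ∑_k f_k ξ_{kj}` of a process of the class. -/
def genOp (hT : 0 < T) (hξ : MemY μ T d τ P ξ) (j : ℤ) : SeqL2 →L[ℂ] Lp ℂ 2 μ :=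
  (pairing _ (hξ.memLp j)).comp (conjBasis hT).repr.symm.toContinuousLinearEquiv.toContinuousLinearMap

theorem genOp_apply (hT : 0 < T) (hξ : MemY μ T d τ P ξ) (j : ℤ) (f : SeqL2) :
    genOp hT hξ j f = ∫ u in Set.Ico 0 T,
      (((conjBasis hT).repr.symm f : PeriodL2 T) : ℝ → ℂ) u •
        incr μ d (τ * T) ξ (u + j * T) := rfl

theorem genOp_unitSeq (hT : 0 < T) (hξ : MemY μ T d τ P ξ) (j : ℤ) (k : ℕ) :
    genOp hT hξ j (unitSeq k) = genCoef μ T d τ ξ j k := by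
  rw [genOp_apply, conjBasis_repr_symm_unitSeq, genCoef]
  refine integral_congr_ae ?_
  filter_upwards [(memLp_conj_basisFun T k).coeFn_toLp] with u hu
  rw [hu]

/-- The inner products are iterated integrals of the correlation function of the increments, and
that function is unchanged when both times are moved by a period. -/
theorem isStationary_genOp (hT : 0 < T) (hξ : MemY μ T d τ P ξ) : IsStationary (genOp hT hξ) := by
  intro i j f g
  simp only [genOp_apply]
  have hi : ∀ (f : SeqL2) (j : ℤ), Integrable (fun u =>
      (((conjBasis hT).repr.symm f : PeriodL2 T) : ℝ → ℂ) u • incr μ d (τ * T) ξ (u + j * T))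
      (volume.restrict (Set.Ico 0 T)) :=
    fun f j => integrable_smul_of_memLp (Lp.memLp _) (hξ.memLp j)
  refine (inner_integral_integral (hi f (i + 1)) (hi g (j + 1))).trans
    (Eq.trans ?_ (inner_integral_integral (hi f i) (hi g j)).symm)
  have : ∀ u v : ℝ, inner ℂ (incr μ d (τ * T) ξ (v + (j + 1 : ℤ) * T))
      (incr μ d (τ * T) ξ (u + (i + 1 : ℤ) * T)) =
        inner ℂ (incr μ d (τ * T) ξ (v + j * T)) (incr μ d (τ * T) ξ (u + i * T)) := by
    intro u v
    rw [show v + ((j + 1 : ℤ) : ℝ) * T = v + j * T + T by push_cast; ring,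
      show u + ((i + 1 : ℤ) : ℝ) * T = u + i * T + T by push_cast; ring, hξ.periodic]
  simp only [inner_smul_left, inner_smul_right, this]

theorem sum_norm_sq_genOp_le (hT : 0 < T) (hξ : MemY μ T d τ P ξ) (j : ℤ) (S : Finset ℕ) :
    ∑ k ∈ S, ‖genOp hT hξ j (unitSeq k)‖ ^ 2 ≤ P := by
  simp only [genOp_unitSeq]
  exact (sum_norm_sq_integral_conj_basisFun_le hT _ (hξ.memLp j) S).trans (hξ.power j)

theorem summable_norm_sq_genOp (hT : 0 < T) (hξ : MemY μ T d τ P ξ) (j : ℤ) :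
    Summable fun k => ‖genOp hT hξ j (unitSeq k)‖ ^ 2 :=
  summable_of_sum_le (fun _ => sq_nonneg _) (sum_norm_sq_genOp_le hT hξ j)

theorem tsum_norm_sq_genOp_le (hT : 0 < T) (hξ : MemY μ T d τ P ξ) (j : ℤ) :
    ∑' k, ‖genOp hT hξ j (unitSeq k)‖ ^ 2 ≤ P :=
  (summable_norm_sq_genOp hT hξ j).tsum_le_of_sum_le (sum_norm_sq_genOp_le hT hξ j)

theorem pastSpace_eq_past (hT : 0 < T) (hξ : MemY μ T d τ P ξ) :
    pastSpace μ T d τ ξ = past (genOp hT hξ) 0 := by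
  rw [pastSpace, past]
  congr 2
  ext x
  constructor
  · rintro ⟨j, k, hj, rfl⟩
    exact ⟨j, by omega, k, (genOp_unitSeq hT hξ j k).symm⟩
  · rintro ⟨j, hj, k, rfl⟩
    exact ⟨j, k, by omega, genOp_unitSeq hT hξ j k⟩

end GeneratedOperators

/-! ### The functional expressed through the generated operators. -/

section Functional

variable {T : ℝ} {d τ N : ℕ} {a : ℝ → ℂ}

theorem integrableOn_bFun (hT : 0 < T) (hτ : 0 < τ)
    (ha : IntegrableOn a (Set.Icc 0 ((N + 1 : ℝ) * T))) :
    IntegrableOn (bFun T d τ N a) (Set.Ico 0 ((N + 1 : ℝ) * T)) := by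
  -- Extending `a` by zero makes the cut-off in the number of terms automatic: the floor admits
  -- exactly the `k` with `t + τ T k ≤ (N + 1) T`. A fixed finite sum of translates can then be used
  -- for all `t`.
  set A := (Set.Icc 0 ((N + 1 : ℝ) * T)).indicator a with hA
  have hAi : Integrable A := ha.integrable_indicator measurableSet_Icc
  have hτT : 0 < τ * T := mul_pos (Nat.cast_pos.mpr hτ) hT
  set n := ⌊((N + 1 : ℝ) * T) / (τ * T)⌋₊ + 1 with hn
  have h : Integrable fun t => ∑ k ∈ Finset.range n, A (t + τ * T * k) * dCoef d k :=
    integrable_finsetSum _ fun k _ => (hAi.comp_add_right _).mul_const _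
  refine h.integrableOn.congr_fun (fun t ht => ?_) measurableSet_Ico
  rw [bFun]
  have hk : ∀ k : ℕ, k ∈ Finset.range (⌊((N + 1 : ℝ) * T - t) / (τ * T)⌋₊ + 1) ↔
      t + τ * T * k ≤ (N + 1 : ℝ) * T := by
    intro k
    have h0 : 0 ≤ ((N + 1 : ℝ) * T - t) / (τ * T) :=
      div_nonneg (by linarith [ht.2]) hτT.le
    rw [Finset.mem_range, Nat.lt_succ_iff, Nat.le_floor_iff h0, le_div_iff₀ hτT]
    constructor <;> intro h <;> linarith
  have hsub : Finset.range (⌊((N + 1 : ℝ) * T - t) / (τ * T)⌋₊ + 1) ⊆ Finset.range n := by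
    refine Finset.range_mono (Nat.succ_le_succ (Nat.floor_mono ?_))
    have := ht.1
    gcongr
    linarith
  symm
  simp only
  rw [← Finset.sum_subset hsub]
  · refine Finset.sum_congr rfl fun k hk' => ?_
    rw [hA, Set.indicator_of_mem]
    have := ht.1
    exact ⟨by positivity, (hk k).mp hk'⟩
  · intro k _ hk'
    rw [hk] at hk'
    rw [hA, Set.indicator_of_notMem fun h => hk' h.2, zero_mul]

theorem integrableOn_bFun_add (hT : 0 < T) (hτ : 0 < τ)
    (ha : IntegrableOn a (Set.Icc 0 ((N + 1 : ℝ) * T))) (j : ℕ) (hj : j ≤ N) :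
    IntegrableOn (fun u => bFun T d τ N a (u + j * T)) (Set.Ico 0 T) := by
  have h1 : IntegrableOn (bFun T d τ N a) (Set.Ico (0 + j * T) (T + j * T)) := by
    refine (integrableOn_bFun hT hτ ha).mono_set (Set.Ico_subset_Ico (by positivity) ?_)
    have : (j : ℝ) ≤ N := Nat.cast_le.mpr hj
    nlinarith
  have hmp := measurePreserving_add_right (volume : Measure ℝ) (j * T)
  have h2 := (hmp.integrableOn_comp_preimage (measurableEmbedding_addRight _)).mpr h1
  rwa [Set.preimage_add_const_Ico, add_sub_cancel_right, add_sub_cancel_right] at h2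

/-- The sequences `(b_{kj})_k`, extended by zero to `j > N`. -/
def bSeq (hb : CoefCondition T d τ N a) (j : ℕ) : SeqL2 :=
  if h : j ≤ N then ⟨bVec T d τ N a j, (memℓp_two_iff _).mpr (hb j h)⟩ else 0

theorem bSeq_apply (hb : CoefCondition T d τ N a) {j : ℕ} (hj : j ≤ N) (k : ℕ) :
    bSeq hb j k = bVec T d τ N a j k := by
  rw [bSeq, dif_pos hj]

theorem bSeq_of_lt (hb : CoefCondition T d τ N a) (j : ℕ) (hj : N < j) : bSeq hb j = 0 :=
  dif_neg hj.not_ge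

/-- The pairing with the process is bilinear, and `conj e_k` is sent to the `k`-th component, so
`b_j` is expanded in the conjugated basis. Its coefficients there are `∫ b_j e_k`, the Fourier
coefficients at the opposite frequency. This is why the entries of the vector `b_j` are permuted. -/
theorem bFun_ae_eq (hT : 0 < T) (hτ : 0 < τ)
    (ha : IntegrableOn a (Set.Icc 0 ((N + 1 : ℝ) * T))) (hb : CoefCondition T d τ N a)
    (j : ℕ) (hj : j ≤ N) :
    (fun u => bFun T d τ N a (u + j * T)) =ᵐ[volume.restrict (Set.Ico 0 T)]
      ((conjBasis hT).repr.symm (bSeq hb j) : PeriodL2 T) := by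
  refine ae_eq_repr_symm hT _ (integrableOn_bFun_add hT hτ ha j hj) _ fun k => ?_
  rw [bSeq_apply hb hj, bVec, bCoef]
  refine integral_congr_ae (Eventually.of_forall fun u => ?_)
  simp only
  rw [← conj_basisFun, Complex.conj_conj]

variable {Ω : Type*} [MeasurableSpace Ω] {μ : Measure Ω} {P : ℝ} {ξ : ℝ → Lp ℂ 2 μ}

/-- The integral is cut into the `N + 1` periods. Square summability of the coefficients makes `b`
square integrable on each, so the pairing with the increment is integrable. -/
theorem BFunctional_eq_functional (hT : 0 < T) (hτ : 0 < τ)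
    (ha : IntegrableOn a (Set.Icc 0 ((N + 1 : ℝ) * T))) (hb : CoefCondition T d τ N a)
    (hξ : MemY μ T d τ P ξ) :
    BFunctional μ T d τ N a ξ = functional (genOp hT hξ) (bSeq hb) N := by
  set F : ℝ → Lp ℂ 2 μ := fun t => bFun T d τ N a t • incr μ d (τ * T) ξ t with hF
  have hae : ∀ j : ℕ, j ≤ N → (fun u => F (u + j * T)) =ᵐ[volume.restrict (Set.Ico 0 T)]
      fun u => (((conjBasis hT).repr.symm (bSeq hb j) : PeriodL2 T) : ℝ → ℂ) u •
        incr μ d (τ * T) ξ (u + (j : ℤ) * T) := by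
    intro j hj
    filter_upwards [bFun_ae_eq hT hτ ha hb j hj] with u hu
    simp only [hF]
    rw [hu]
    rfl
  have hint : ∀ j : ℕ, j ≤ N → IntegrableOn F (Set.Ico (j * T) ((j + 1 : ℕ) * T)) := by
    intro j hj
    have h1 : IntegrableOn (fun u => F (u + j * T)) (Set.Ico 0 T) :=
      (integrable_smul_of_memLp (Lp.memLp _) (hξ.memLp j)).congr (hae j hj).symm
    have hmp := measurePreserving_add_right (volume : Measure ℝ) (j * T)
    refine (hmp.integrableOn_comp_preimage (measurableEmbedding_addRight _)).mp ?_
    rw [Set.preimage_add_const_Ico, sub_self]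
    have h2 : ((j + 1 : ℕ) : ℝ) * T - j * T = T := by push_cast; ring
    rw [h2]
    exact h1
  have hle : ∀ j : ℕ, (j : ℝ) * T ≤ ((j + 1 : ℕ) : ℝ) * T := fun j => by
    push_cast; nlinarith
  have hval : ∀ j : ℕ, j ≤ N → ∫ t in (j * T)..((j + 1 : ℕ) * T), F t =
      genOp hT hξ j (bSeq hb j) := by
    intro j hj
    have h2 : ((j + 1 : ℕ) : ℝ) * T = T + j * T := by push_cast; ring
    rw [genOp_apply, ← integral_congr_ae (hae j hj), integral_Ico_eq_integral_Ioc,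
      ← intervalIntegral.integral_of_le hT.le, intervalIntegral.integral_comp_add_right, zero_add,
      h2]
  have hsum := intervalIntegral.sum_integral_adjacent_intervals (μ := volume) (f := F)
    (a := fun j : ℕ => (j : ℝ) * T) (n := N + 1) fun j hj => by
      rw [intervalIntegrable_iff_integrableOn_Ico_of_le (hle j)]
      exact hint j (by omega)
  have h0 : (0 : ℝ) ≤ (N + 1 : ℝ) * T := by positivity
  rw [BFunctional, integral_Ico_eq_integral_Ioc, ← intervalIntegral.integral_of_le h0, functional]
  rw [Nat.cast_zero, zero_mul, Nat.cast_add, Nat.cast_one] at hsum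
  rw [← hsum]
  exact Finset.sum_congr rfl fun j hj => hval j (by have := Finset.mem_range.mp hj; omega)

end Functional

/-! ### Estimates -/

section Estimate

/-- The first `n` terms of a sequence. -/
def truncSeq (n : ℕ) (f : SeqL2) : SeqL2 := ∑ k ∈ Finset.range n, f k • unitSeq k

theorem tendsto_truncSeq (f : SeqL2) : Tendsto (fun n => truncSeq n f) atTop (𝓝 f) :=
  (hasSum_unitSeq f).tendsto_sum_nat

theorem norm_truncSeq_le (n : ℕ) (f : SeqL2) : ‖truncSeq n f‖ ≤ ‖f‖ := by
  have h1 : truncSeq n f = ∑ k ∈ Finset.range n, lp.single 2 k (f k) := by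
    refine Finset.sum_congr rfl fun k _ => ?_
    rw [unitSeq, ← lp.single_smul, smul_eq_mul, mul_one]
  have h2 := lp.norm_sum_single (E := fun _ : ℕ => ℂ) (p := 2) (by norm_num) f (Finset.range n)
  have h3 := lp.sum_rpow_le_norm_rpow (p := 2) (by norm_num) f (Finset.range n)
  rw [← h2, ← h1] at h3
  simp only [ENNReal.toReal_ofNat, Real.rpow_ofNat] at h3
  exact le_of_sq_le_sq h3 (norm_nonneg _)

variable {Ω : Type*} [MeasurableSpace Ω] {μ : Measure Ω} {T P : ℝ} {d τ N : ℕ} {a : ℝ → ℂ}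
  {ξ : ℝ → Lp ℂ 2 μ}

theorem finiteRule_eq_linearCombination (c : (ℕ × ℕ) →₀ ℂ) :
    finiteRule μ T d τ c ξ = Finsupp.linearCombination ℂ
      (fun i : ℕ × ℕ => genCoef μ T d τ ξ (-((i.1 : ℤ) + 1)) i.2) c := rfl

theorem finiteRule_mem_pastSpace (c : (ℕ × ℕ) →₀ ℂ) :
    finiteRule μ T d τ c ξ ∈ pastSpace μ T d τ ξ := by
  refine Submodule.le_topologicalClosure _ (Submodule.sum_mem _ fun i _ => ?_)
  exact Submodule.smul_mem _ _ (Submodule.subset_span ⟨_, _, by omega, rfl⟩)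

theorem exists_finiteRule_eq {x : Lp ℂ 2 μ}
    (hx : x ∈ Submodule.span ℂ {x | ∃ j : ℤ, ∃ k : ℕ, j ≤ -1 ∧ x = genCoef μ T d τ ξ j k}) :
    ∃ c, finiteRule μ T d τ c ξ = x := by
  have h : Submodule.span ℂ {x | ∃ j : ℤ, ∃ k : ℕ, j ≤ -1 ∧ x = genCoef μ T d τ ξ j k} ≤
      LinearMap.range (Finsupp.linearCombination ℂ
        (fun i : ℕ × ℕ => genCoef μ T d τ ξ (-((i.1 : ℤ) + 1)) i.2)) := by
    rw [Submodule.span_le]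
    rintro _ ⟨j, k, hj, rfl⟩
    refine ⟨Finsupp.single ((-j - 1).toNat, k) 1, ?_⟩
    rw [Finsupp.linearCombination_single, one_smul]
    congr 1
    simp only
    omega
  exact h hx

theorem Estimates.apply_mem_pastSpace {Bhat : (ℝ → Lp ℂ 2 μ) → Lp ℂ 2 μ}
    (hB : Bhat ∈ Estimates μ T d τ P) (hξ : MemY μ T d τ P ξ) :
    Bhat ξ ∈ pastSpace μ T d τ ξ := by
  obtain ⟨c, hc⟩ := hB
  exact (Submodule.isClosed_topologicalClosure _).mem_of_tendsto (hc ξ hξ)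
    (Eventually.of_forall fun n => finiteRule_mem_pastSpace _)

theorem optError_le {x : Lp ℂ 2 μ} (hx : x ∈ pastSpace μ T d τ ξ) :
    optError μ T d τ N a ξ ≤ ‖BFunctional μ T d τ N a ξ - x‖ ^ 2 := by
  rw [optError]
  refine pow_le_pow_left₀ Metric.infDist_nonneg ?_ 2
  rw [← dist_eq_norm]
  exact Metric.infDist_le_dist_of_mem hx

theorem exists_optError_eq :
    ∃ x ∈ pastSpace μ T d τ ξ,
      optError μ T d τ N a ξ = ‖BFunctional μ T d τ N a ξ - x‖ ^ 2 := by
  have hc : IsClosed (pastSpace μ T d τ ξ : Set (Lp ℂ 2 μ)) :=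
    Submodule.isClosed_topologicalClosure _
  have : CompleteSpace (pastSpace μ T d τ ξ) := hc.completeSpace_coe
  set B := BFunctional μ T d τ N a ξ
  have hm := (pastSpace μ T d τ ξ).starProjection_apply_mem B
  refine ⟨_, hm, le_antisymm (optError_le hm) ?_⟩
  refine pow_le_pow_left₀ (norm_nonneg _) ?_ 2
  refine (Metric.le_infDist ⟨0, Submodule.zero_mem _⟩).mpr fun y hy => ?_
  rw [dist_eq_norm]
  set p := (pastSpace μ T d τ ξ).starProjection B
  have h1 : B - y = (B - p) + (p - y) := by abel
  have h2 : inner ℂ (B - p) (p - y) = 0 :=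
    Submodule.inner_left_of_mem_orthogonal (Submodule.sub_mem _ hm hy)
      ((pastSpace μ T d τ ξ).sub_starProjection_mem_orthogonal B)
  have h3 : ‖B - y‖ ^ 2 = ‖B - p‖ ^ 2 + ‖p - y‖ ^ 2 := by
    rw [h1, @norm_add_sq ℂ, h2]
    simp
  refine le_of_sq_le_sq ?_ (norm_nonneg _)
  rw [h3]
  linarith [sq_nonneg ‖p - y‖]

theorem isLeast_optError :
    IsLeast ((fun x => ‖BFunctional μ T d τ N a ξ - x‖ ^ 2) ''
      (pastSpace μ T d τ ξ : Set (Lp ℂ 2 μ))) (optError μ T d τ N a ξ) := by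
  obtain ⟨x, hx, h⟩ := exists_optError_eq (μ := μ) (T := T) (d := d) (τ := τ) (N := N) (a := a) (ξ := ξ)
  refine ⟨⟨x, hx, h.symm⟩, ?_⟩
  rintro _ ⟨y, hy, rfl⟩
  exact optError_le hy

theorem optError_le_mse {Bhat : (ℝ → Lp ℂ 2 μ) → Lp ℂ 2 μ}
    (hB : Bhat ∈ Estimates μ T d τ P) (hξ : MemY μ T d τ P ξ) :
    optError μ T d τ N a ξ ≤ mse μ T d τ N a ξ Bhat :=
  optError_le (Estimates.apply_mem_pastSpace hB hξ)

/-- A finite combination is already an estimate, through a constant sequence of rules, and its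
values on `ξ` are dense in the past space. Only an infimum over estimates is asserted. -/
theorem isGLB_mse (hξ : MemY μ T d τ P ξ) :
    IsGLB (mse μ T d τ N a ξ '' Estimates μ T d τ P) (optError μ T d τ N a ξ) := by
  refine ⟨?_, fun z hz => ?_⟩
  · rintro _ ⟨Bhat, hB, rfl⟩
    exact optError_le_mse hB hξ
  · obtain ⟨x, hx, h⟩ :=
      exists_optError_eq (μ := μ) (T := T) (d := d) (τ := τ) (N := N) (a := a) (ξ := ξ)
    rw [h]
    have hcl : IsClosed {x : Lp ℂ 2 μ | z ≤ ‖BFunctional μ T d τ N a ξ - x‖ ^ 2} :=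
      isClosed_le continuous_const (by fun_prop)
    refine hcl.closure_subset_iff.mpr ?_ hx
    intro y hy
    obtain ⟨c, rfl⟩ := exists_finiteRule_eq hy
    exact hz ⟨finiteRule μ T d τ c, ⟨fun _ => c, fun _ _ => tendsto_const_nhds⟩, rfl⟩

/-- The coefficients of the `n`-th approximation of the estimate with the coefficients `G`. -/
def ruleApprox (G : ℕ → SeqL2) (n : ℕ) : (ℕ × ℕ) →₀ ℂ :=
  ∑ i ∈ Finset.range n, ∑ k ∈ Finset.range n, Finsupp.single (i, k) (G i k)

theorem finiteRule_ruleApprox (hT : 0 < T) (hξ : MemY μ T d τ P ξ) (G : ℕ → SeqL2) (n : ℕ) :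
    finiteRule μ T d τ (ruleApprox G n) ξ =
      ∑ i ∈ Finset.range n, genOp hT hξ (-((i : ℤ) + 1)) (truncSeq n (G i)) := by
  rw [finiteRule_eq_linearCombination, ruleApprox, map_sum]
  refine Finset.sum_congr rfl fun i _ => ?_
  rw [map_sum, truncSeq, map_sum]
  refine Finset.sum_congr rfl fun k _ => ?_
  rw [Finsupp.linearCombination_single, map_smul, genOp_unitSeq]

/-- The reason for demanding summable coefficients: all `X j` have the norm of `X 0`, so `‖X 0‖ ‖G
i‖` dominates the series for every process, while the coefficients do not depend on the process. -/
theorem tendsto_finiteRule (hT : 0 < T) (hξ : MemY μ T d τ P ξ) (G : ℕ → SeqL2)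
    (hG : Summable fun i => ‖G i‖) :
    Tendsto (fun n => finiteRule μ T d τ (ruleApprox G n) ξ) atTop
      (𝓝 (∑' i : ℕ, genOp hT hξ (-((i : ℤ) + 1)) (G i))) := by
  have hst := isStationary_genOp hT hξ
  let f : ℕ → ℕ → Lp ℂ 2 μ := fun n i =>
    if i < n then genOp hT hξ (-((i : ℤ) + 1)) (truncSeq n (G i)) else 0
  have h1 : ∀ n, finiteRule μ T d τ (ruleApprox G n) ξ = ∑' i, f n i := by
    intro n
    rw [finiteRule_ruleApprox hT hξ, tsum_eq_sum (s := Finset.range n)]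
    · exact Finset.sum_congr rfl fun i hi => (if_pos (Finset.mem_range.mp hi)).symm
    · exact fun i hi => if_neg fun h => hi (Finset.mem_range.mpr h)
  simp only [h1]
  refine tendsto_tsum_of_dominated_convergence (hG.mul_left ‖genOp hT hξ 0‖) (fun i => ?_)
    (Eventually.of_forall fun n i => ?_)
  · have h2 := ((genOp hT hξ (-((i : ℤ) + 1))).continuous.tendsto _).comp (tendsto_truncSeq (G i))
    refine h2.congr' ?_
    filter_upwards [eventually_gt_atTop i] with n hn
    exact (if_pos hn).symm
  · simp only [f]
    split_ifs
    · rw [hst.norm_apply]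
      exact ((genOp hT hξ 0).le_opNorm _).trans
        (mul_le_mul_of_nonneg_left (norm_truncSeq_le _ _) (norm_nonneg _))
    · rw [norm_zero]; positivity

theorem norm_sq_tsum_genOp_le (hT : 0 < T) (hP : 0 < P) (hξ : MemY μ T d τ P ξ)
    (F : ℕ → SeqL2) (hFs : Summable fun j => ‖F j‖) (ν2 : ℝ) (hν : 0 ≤ ν2)
    (hF : ∀ (n : ℕ) (p : ℕ → ℂ),
        ∑ m ∈ Finset.range n, ‖∑ i ∈ Finset.range (m + 1), p i • F (m - i)‖ ^ 2 ≤
          ν2 * ∑ i ∈ Finset.range n, ‖p i‖ ^ 2) (n₀ : ℤ) :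
    ‖∑' j : ℕ, genOp hT hξ (n₀ - j) (F j)‖ ^ 2 ≤ P * ν2 := by
  classical
  refine (isStationary_genOp hT hξ).norm_sq_tsum_le
    (HilbertBasis.ofRepr (LinearIsometryEquiv.refl ℂ SeqL2)) P hP.le
    (fun j => ?_) F hFs _ hν hF n₀
  have hu : ∀ k, (HilbertBasis.ofRepr (LinearIsometryEquiv.refl ℂ SeqL2)) k = unitSeq k := by
    intro k
    rw [← HilbertBasis.repr_symm_single]
    rfl
  simp only [hu, enorm_sq_eq_ofReal]
  rw [← ENNReal.ofReal_tsum_of_nonneg (fun _ => sq_nonneg _) (summable_norm_sq_genOp hT hξ j)]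
  exact ENNReal.ofReal_le_ofReal (tsum_norm_sq_genOp_le hT hξ j)

/-- The filter output at time `N` is split at time `0`: the coefficients `b (N - j)` at the times `N
- j ≥ 0` form the functional, and the later ones use only the past. -/
theorem tsum_genOp_eq (hT : 0 < T) (hξ : MemY μ T d τ P ξ) (b F : ℕ → SeqL2)
    (hF0 : ∀ j ≤ N, F j = b (N - j)) (hFs : Summable fun j => ‖F j‖) :
    ∑' j : ℕ, genOp hT hξ ((N : ℤ) - j) (F j) = functional (genOp hT hξ) b N +
      ∑' i : ℕ, genOp hT hξ (-((i : ℤ) + 1)) (F (i + (N + 1))) := by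
  have hs := ((isStationary_genOp hT hξ).summable_norm_apply hFs fun j : ℕ => (N : ℤ) - j).of_norm
  rw [← hs.sum_add_tsum_nat_add (N + 1)]
  congr 1
  · rw [functional, ← Finset.sum_range_reflect]
    refine Finset.sum_congr rfl fun j hj => ?_
    have hj' : j ≤ N := by have := Finset.mem_range.mp hj; omega
    have h1 : N + 1 - 1 - j = N - j := by omega
    have h2 : (N : ℤ) - ((N - j : ℕ) : ℤ) = j := by omega
    rw [h1, hF0 _ (Nat.sub_le N j), Nat.sub_sub_self hj', h2]
  · refine tsum_congr fun i => ?_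
    have : (N : ℤ) - ((i + (N + 1) : ℕ) : ℤ) = -((i : ℤ) + 1) := by push_cast; ring
    rw [this]

theorem exists_estimate (hT : 0 < T) (G : ℕ → SeqL2) (hG : Summable fun i => ‖G i‖) :
    ∃ Bhat ∈ Estimates μ T d τ P, ∀ ξ (hξ : MemY μ T d τ P ξ),
      Bhat ξ = -∑' i : ℕ, genOp hT hξ (-((i : ℤ) + 1)) (G i) := by
  classical
  -- The value outside the class is immaterial, since an estimate is constrained only on the class.
  refine ⟨fun ξ => if hξ : MemY μ T d τ P ξ then
      -∑' i : ℕ, genOp hT hξ (-((i : ℤ) + 1)) (G i) else 0,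
    ⟨fun n => -ruleApprox G n, fun ξ hξ => ?_⟩, fun ξ hξ => dif_pos hξ⟩
  simp only [dif_pos hξ]
  refine (tendsto_finiteRule hT hξ G hG).neg.congr fun n => ?_
  rw [finiteRule_eq_linearCombination, finiteRule_eq_linearCombination, map_neg]

theorem exists_extension_bSeq (hb : CoefCondition T d τ N a) :
    ∃ F : ℕ → SeqL2, (∀ j ≤ N, F j = bSeq hb (N - j)) ∧ (Summable fun j => ‖F j‖) ∧
      ∀ (n : ℕ) (p : ℕ → ℂ),
        ∑ m ∈ Finset.range n, ‖∑ i ∈ Finset.range (m + 1), p i • F (m - i)‖ ^ 2 ≤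
          ‖hankel N (bSeq hb)‖ ^ 2 * ∑ i ∈ Finset.range n, ‖p i‖ ^ 2 := by
  refine exists_summable_extension N (bSeq hb) (bSeq_of_lt hb) _ fun p => ?_
  rw [← norm_sq_hankel_apply]
  have h := (hankel N (bSeq hb)).le_opNorm (WithLp.toLp 2 p)
  have h2 := pow_le_pow_left₀ (norm_nonneg _) h 2
  rwa [mul_pow, EuclideanSpace.norm_sq_eq] at h2

/-- The minimax estimate. -/
theorem exists_minimax_estimate (hT : 0 < T) (hτ : 0 < τ) (hP : 0 < P)
    (ha : IntegrableOn a (Set.Icc 0 ((N + 1 : ℝ) * T))) (hb : CoefCondition T d τ N a) :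
    ∃ B₀ ∈ Estimates μ T d τ P, ∀ ξ, MemY μ T d τ P ξ →
      mse μ T d τ N a ξ B₀ ≤ P * ‖hankel N (bSeq hb)‖ ^ 2 := by
  obtain ⟨F, hF0, hFs, hFop⟩ := exists_extension_bSeq hb
  -- The estimate is minus the tail of the filter, so that its error is the whole filter output.
  obtain ⟨B₀, hB, h⟩ := exists_estimate (μ := μ) (d := d) (τ := τ) (P := P) hT
    (fun i => F (i + (N + 1))) ((summable_nat_add_iff (f := fun j => ‖F j‖) (N + 1)).mpr hFs)
  refine ⟨B₀, hB, fun ξ hξ => ?_⟩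
  rw [mse, h ξ hξ, sub_neg_eq_add, BFunctional_eq_functional hT hτ ha hb hξ,
    ← tsum_genOp_eq hT hξ _ F hF0 hFs]
  exact norm_sq_tsum_genOp_le hT hP hξ F hFs _ (sq_nonneg _) hFop N

theorem optError_le_of_memY (hT : 0 < T) (hτ : 0 < τ) (hP : 0 < P)
    (ha : IntegrableOn a (Set.Icc 0 ((N + 1 : ℝ) * T))) (hb : CoefCondition T d τ N a)
    (hξ : MemY μ T d τ P ξ) :
    optError μ T d τ N a ξ ≤ P * ‖hankel N (bSeq hb)‖ ^ 2 := by
  obtain ⟨B₀, hB, h⟩ := exists_minimax_estimate (μ := μ) hT hτ hP ha hb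
  exact (optError_le_mse hB hξ).trans (h ξ hξ)

/-- The eigenvector equation makes the innovation energy of each column exactly `ν² ‖g m‖²`. These
energies add up to `P ν²`, below the error of any prediction from the past. -/
theorem le_optError_of_isMovingAverage (hT : 0 < T) (hτ : 0 < τ)
    (ha : IntegrableOn a (Set.Icc 0 ((N + 1 : ℝ) * T))) (hb : CoefCondition T d τ N a)
    (hξ : MemY μ T d τ P ξ) {M : ℕ} {g : Fin M → BlockL2 N} {ε : ℤ → Fin M → Lp ℂ 2 μ}
    (hg : IsEigenCoef N M P (‖hankel N (bSeq hb)‖ ^ 2) (QOp N (bSeq hb)) g)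
    (hε : IsWhiteNoise μ M ε) (hma : IsMovingAverage μ T d τ N M g ε ξ) :
    P * ‖hankel N (bSeq hb)‖ ^ 2 ≤ optError μ T d τ N a ξ := by
  obtain ⟨x, hx, h⟩ := exists_optError_eq (μ := μ) (T := T) (d := d) (τ := τ) (N := N) (a := a) (ξ := ξ)
  rw [h, BFunctional_eq_functional hT hτ ha hb hξ]
  rw [pastSpace_eq_past hT hξ] at hx
  have hX := fun j k => (genOp_unitSeq hT hξ j k).trans (hma j k)
  refine le_trans (le_of_eq ?_) (le_norm_sq_functional_sub (genOp hT hξ) (bSeq hb) (bSeq_of_lt hb)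
    g ε hε.2 hX x (inner_eq_zero_of_movingAverage _ g ε hε.2 hX hx))
  have h1 : ∀ m, ∑ s : Fin (N + 1), ‖inner ℂ (shiftVec N (bSeq hb) s) (star (g m))‖ ^ 2 =
      ‖hankel N (bSeq hb)‖ ^ 2 * ‖g m‖ ^ 2 := by
    intro m
    rw [(QOp_apply_eq_smul_iff (bSeq hb) (star (g m))).mp (hg.1 m), norm_star]
  simp only [h1]
  rw [← Finset.mul_sum, hg.2, mul_comm]

theorem integral_eq_inner_one [IsFiniteMeasure μ] (y : Lp ℂ 2 μ) :
    ∫ ω, y ω ∂μ = inner ℂ ((memLp_const (1 : ℂ) : MemLp (fun _ : Ω => (1 : ℂ)) 2 μ).toLp) y := by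
  rw [L2.inner_def]
  refine integral_congr_ae ?_
  filter_upwards [(memLp_const (1 : ℂ) : MemLp (fun _ : Ω => (1 : ℂ)) 2 μ).coeFn_toLp] with ω hω
  rw [hω, RCLike.inner_apply, map_one, mul_one]

/-- Expectation is the inner product with the constant `1`, hence continuous; its kernel is closed
and contains all generating elements. -/
theorem integral_eq_zero_of_mem_total [IsProbabilityMeasure μ] (hT : 0 < T)
    (hξ : MemY μ T d τ P ξ) {x : Lp ℂ 2 μ} (hx : x ∈ total (genOp hT hξ)) :
    ∫ ω, x ω ∂μ = 0 := by
  set one : Lp ℂ 2 μ := (memLp_const (1 : ℂ) : MemLp (fun _ : Ω => (1 : ℂ)) 2 μ).toLp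
  have h : total (genOp hT hξ) ≤ LinearMap.ker (innerSL ℂ one).toLinearMap := by
    refine Submodule.topologicalClosure_minimal _ ?_ (innerSL ℂ one).isClosed_ker
    rw [Submodule.span_le]
    rintro _ ⟨j, f, rfl⟩
    change inner ℂ one (genOp hT hξ j f) = 0
    rw [genOp_apply]
    refine (integral_inner (𝕜 := ℂ) (integrable_smul_of_memLp (Lp.memLp _) (hξ.memLp j)) _).symm.trans ?_
    refine integral_eq_zero_of_ae (Eventually.of_forall fun u => ?_)
    simp only [Pi.zero_apply]
    rw [inner_smul_right, ← integral_eq_inner_one, hξ.mean_zero, mul_zero]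
  rw [integral_eq_inner_one]
  exact h hx

theorem exists_movingAverage_of_isLeastFavorable [IsProbabilityMeasure μ] (hT : 0 < T) (hτ : 0 < τ)
    (ha : IntegrableOn a (Set.Icc 0 ((N + 1 : ℝ) * T))) (hb : CoefCondition T d τ N a)
    (hν : 0 < ‖hankel N (bSeq hb)‖ ^ 2) (hξ : MemY μ T d τ P ξ)
    (herr : P * ‖hankel N (bSeq hb)‖ ^ 2 ≤ optError μ T d τ N a ξ) :
    ∃ (M : ℕ) (g : Fin M → BlockL2 N) (ε : ℤ → Fin M → Lp ℂ 2 μ),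
      IsEigenCoef N M P (‖hankel N (bSeq hb)‖ ^ 2) (QOp N (bSeq hb)) g ∧ IsWhiteNoise μ M ε ∧
      IsMovingAverage μ T d τ N M g ε ξ := by
  obtain ⟨M, g, ε, hg, hgP, hε, hεt, hma⟩ := exists_movingAverage_of_isStationary
    (isStationary_genOp hT hξ) (bSeq hb) (bSeq_of_lt hb) P (summable_norm_sq_genOp hT hξ 0)
    (tsum_norm_sq_genOp_le hT hξ 0) hν fun x hx => by
      rw [← BFunctional_eq_functional hT hτ ha hb hξ]
      rw [← pastSpace_eq_past hT hξ] at hx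
      exact herr.trans (optError_le hx)
  exact ⟨M, g, ε, ⟨hg, hgP⟩, ⟨fun s m => integral_eq_zero_of_mem_total hT hξ (hεt s m), hε⟩,
    fun j k => (genOp_unitSeq hT hξ j k).symm.trans (hma j k)⟩

end Estimate

/-! ### Processes with a given increment -/

section Increment

theorem one_sub_pow_apply {V : Type*} [AddCommGroup V] [Module ℂ V] (S : Module.End ℂ V) (d : ℕ)
    (v : V) : ((1 - S) ^ d) v =
      ∑ l ∈ Finset.range (d + 1), ((-1 : ℂ) ^ l * (d.choose l : ℂ)) • (S ^ l) v := by
  rw [sub_eq_neg_add, (Commute.one_right (-S)).add_pow, LinearMap.sum_apply]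
  refine Finset.sum_congr rfl fun l _ => ?_
  rw [one_pow, mul_one, ← nsmul_eq_mul', LinearMap.smul_apply, neg_pow, mul_comm, mul_smul,
    Nat.cast_smul_eq_nsmul]
  congr 1
  rcases Nat.even_or_odd l with h | h <;> simp [h.neg_one_pow]

/-- The backward shift `ξ ↦ ξ(· - h)`. -/
def timeShift (V : Type*) [AddCommGroup V] [Module ℂ V] {A : Type*} [AddGroup A] (h : A) :
    Module.End ℂ (A → V) :=
  LinearMap.funLeft ℂ V fun t => t - h

theorem timeShift_pow_apply {V : Type*} [AddCommGroup V] [Module ℂ V] {A : Type*} [AddGroup A]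
    (h : A) (ξ : A → V) (l : ℕ) (t : A) : (timeShift V h ^ l) ξ t = ξ (t - l • h) := by
  induction l generalizing t with
  | zero => simp
  | succ l ih =>
    rw [pow_succ', Module.End.mul_apply]
    change (timeShift V h ^ l) ξ (t - h) = _
    rw [ih, sub_eq_add_neg, sub_eq_add_neg, sub_eq_add_neg, add_assoc, ← neg_add_rev,
      ← succ_nsmul]

variable {Ω : Type*} [MeasurableSpace Ω] {μ : Measure Ω}

theorem incr_eq_pow_apply (d : ℕ) (h : ℝ) (ξ : ℝ → Lp ℂ 2 μ) :
    incr μ d h ξ = ((1 - timeShift (Lp ℂ 2 μ) h) ^ d) ξ := by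
  ext1 t
  rw [one_sub_pow_apply, incr, Finset.sum_apply]
  refine Finset.sum_congr rfl fun l _ => ?_
  rw [Pi.smul_apply, timeShift_pow_apply, nsmul_eq_mul]

theorem exists_int_difference_eq {V : Type*} [AddCommGroup V] (x : ℤ → V) :
    ∃ y : ℤ → V, ∀ n, y n - y (n - 1) = x n := by
  refine ⟨fun n => ∑ i ∈ Finset.range n.toNat, x (i + 1) -
    ∑ i ∈ Finset.range (-n).toNat, x (-i), fun n => ?_⟩
  rcases lt_or_ge 0 n with h | h
  · obtain ⟨k, rfl⟩ : ∃ k : ℕ, n = k + 1 := ⟨(n - 1).toNat, by omega⟩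
    have h1 : ((k : ℤ) + 1).toNat = k + 1 := by omega
    have h2 : (-((k : ℤ) + 1)).toNat = 0 := by omega
    have h3 : ((k : ℤ) + 1 - 1).toNat = k := by omega
    have h4 : (-((k : ℤ) + 1 - 1)).toNat = 0 := by omega
    simp only [h1, h2, h3, h4, Finset.sum_range_succ, Finset.range_zero, Finset.sum_empty]
    abel
  · obtain ⟨k, rfl⟩ : ∃ k : ℕ, n = -k := ⟨(-n).toNat, by omega⟩
    have h1 : (-(k : ℤ)).toNat = 0 := by omega
    have h2 : (-(-(k : ℤ))).toNat = k := by omega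
    have h3 : (-(k : ℤ) - 1).toNat = 0 := by omega
    have h4 : (-(-(k : ℤ) - 1)).toNat = k + 1 := by omega
    simp only [h1, h2, h3, h4, Finset.sum_range_succ, Finset.range_zero, Finset.sum_empty]
    abel

/-- The equation `ξ(t) - ξ(t - h) = X(t)` decouples into difference equations along the cosets of `h
ℤ`, each solved by partial sums. No regularity in `t` is kept, and none is required in the class
`Y`. -/
theorem one_sub_timeShift_surjective (V : Type*) [AddCommGroup V] [Module ℂ V] {h : ℝ}
    (hh : 0 < h) : Function.Surjective ⇑(1 - timeShift V h) := by
  intro X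
  choose Y hY using fun u : ℝ => exists_int_difference_eq fun n : ℤ => X (u + n * h)
  refine ⟨fun t => Y (t - ⌊t / h⌋ * h) ⌊t / h⌋, ?_⟩
  ext1 t
  change Y (t - ⌊t / h⌋ * h) ⌊t / h⌋ - Y (t - h - ⌊(t - h) / h⌋ * h) ⌊(t - h) / h⌋ = X t
  have h1 : ⌊(t - h) / h⌋ = ⌊t / h⌋ - 1 := by
    rw [sub_div, div_self hh.ne', Int.floor_sub_one]
  have h2 : t - h - ((⌊t / h⌋ - 1 : ℤ) : ℝ) * h = t - ⌊t / h⌋ * h := by push_cast; ring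
  rw [h1, h2, hY]
  congr 1
  ring

theorem exists_incr_eq (d : ℕ) {h : ℝ} (hh : 0 < h) (X : ℝ → Lp ℂ 2 μ) :
    ∃ ξ, incr μ d h ξ = X := by
  simp only [incr_eq_pow_apply]
  have : Function.Surjective ⇑((1 - timeShift (Lp ℂ 2 μ) h) ^ d) := by
    rw [Module.End.coe_pow]
    exact (one_sub_timeShift_surjective _ hh).iterate d
  exact this X

end Increment

/-! ### Moving averages as increments -/

section MovingAverageProcess

variable {N M : ℕ} {T : ℝ}

/-- The process with the values `∑_{p,m} conj(f_{pm}(u)) ψ_m(j-p)` at `t = u + jT`. -/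
def maProcess {V : Type*} [AddCommGroup V] [Module ℂ V] (T : ℝ)
    (f : Fin (N + 1) → Fin M → ℝ → ℂ) (ψ : ℤ → Fin M → V) (t : ℝ) : V :=
  ∑ p : Fin (N + 1), ∑ m, (starRingEnd ℂ) (f p m (t - ⌊t / T⌋ * T)) •
    ψ (⌊t / T⌋ - ((p : ℕ) : ℤ)) m

theorem maProcess_add {V : Type*} [AddCommGroup V] [Module ℂ V] (hT : 0 < T)
    (f : Fin (N + 1) → Fin M → ℝ → ℂ) (ψ : ℤ → Fin M → V) (t : ℝ) (j : ℤ) :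
    maProcess T f ψ (t + j * T) = maProcess T f (fun s => ψ (s + j)) t := by
  have h1 : ⌊(t + j * T) / T⌋ = ⌊t / T⌋ + j := by
    rw [add_div, mul_div_cancel_right₀ _ hT.ne', Int.floor_add_intCast]
  have h2 : t + j * T - ((⌊t / T⌋ + j : ℤ) : ℝ) * T = t - ⌊t / T⌋ * T := by push_cast; ring
  simp only [maProcess, h1, h2]
  simp only [sub_add_eq_add_sub]

theorem maProcess_add_of_mem {V : Type*} [AddCommGroup V] [Module ℂ V] (hT : 0 < T)
    (f : Fin (N + 1) → Fin M → ℝ → ℂ) (ψ : ℤ → Fin M → V) {u : ℝ} (hu : u ∈ Set.Ico 0 T) (j : ℤ) :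
    maProcess T f ψ (u + j * T) =
      ∑ p : Fin (N + 1), ∑ m, (starRingEnd ℂ) (f p m u) • ψ (j - ((p : ℕ) : ℤ)) m := by
  have h1 : ⌊u / T⌋ = 0 :=
    Int.floor_eq_zero_iff.mpr ⟨div_nonneg hu.1 hT.le, (div_lt_one hT).mpr hu.2⟩
  rw [maProcess_add hT]
  simp only [maProcess, h1, Int.cast_zero, zero_mul, sub_zero]
  refine Finset.sum_congr rfl fun p _ => Finset.sum_congr rfl fun m _ => ?_
  rw [zero_sub, neg_add_eq_sub]

theorem inner_maProcess_add {H : Type*} [NormedAddCommGroup H] [InnerProductSpace ℂ H] (hT : 0 < T)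
    (f f' : Fin (N + 1) → Fin M → ℝ → ℂ) (ψ φ : ℤ → Fin M → H)
    (hψ : ∀ r s m n, inner ℂ (ψ (r + 1) m) (φ (s + 1) n) = inner ℂ (ψ r m) (φ s n)) (t s : ℝ) :
    inner ℂ (maProcess T f ψ (s + T)) (maProcess T f' φ (t + T)) =
      inner ℂ (maProcess T f ψ s) (maProcess T f' φ t) := by
  have h1 := maProcess_add hT f ψ s 1
  have h2 := maProcess_add hT f' φ t 1
  rw [Int.cast_one, one_mul] at h1 h2
  rw [h1, h2]
  simp only [maProcess, sum_inner, inner_sum, inner_smul_left, inner_smul_right, hψ]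

variable {Ω : Type*} [MeasurableSpace Ω] {μ : Measure Ω} {P : ℝ} {d τ : ℕ}
  {ξ : ℝ → Lp ℂ 2 μ} {f : Fin (N + 1) → Fin M → ℝ → ℂ} {ψ : ℤ → Fin M → Lp ℂ 2 μ}

theorem integral_maProcess [IsFiniteMeasure μ] (h0 : ∀ s m, ∫ ω, ψ s m ω ∂μ = 0) (t : ℝ) :
    ∫ ω, maProcess T f ψ t ω ∂μ = 0 := by
  simp only [integral_eq_inner_one] at h0 ⊢
  simp only [maProcess, inner_sum, inner_smul_right, h0, mul_zero, Finset.sum_const_zero]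

theorem memLp_conj_smul {f : ℝ → ℂ} (hf : MemLp f 2 (volume.restrict (Set.Ico 0 T)))
    (y : Lp ℂ 2 μ) :
    MemLp (fun u => (starRingEnd ℂ) (f u) • y) 2 (volume.restrict (Set.Ico 0 T)) :=
  (memLp_top_const y).smul hf.star (r := 2)

theorem memY_of_incr_eq_maProcess [IsFiniteMeasure μ] (hT : 0 < T)
    (hξ : incr μ d (τ * T) ξ = maProcess T f ψ)
    (hf : ∀ p m, MemLp (f p m) 2 (volume.restrict (Set.Ico 0 T)))
    (hψ : ∀ r s m n, inner ℂ (ψ (r + 1) m) (ψ (s + 1) n) = inner ℂ (ψ r m) (ψ s n))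
    (h0 : ∀ s m, ∫ ω, ψ s m ω ∂μ = 0)
    (hP : ∀ j : ℤ, ∫ u in Set.Ico 0 T, ‖∑ p : Fin (N + 1), ∑ m,
      (starRingEnd ℂ) (f p m u) • ψ (j - ((p : ℕ) : ℤ)) m‖ ^ 2 ≤ P) :
    MemY μ T d τ P ξ := by
  refine ⟨fun t => ?_, fun t s => ?_, fun j => ?_, fun j => ?_⟩
  · rw [hξ, integral_maProcess h0]
  · rw [hξ, inner_maProcess_add hT _ _ _ _ hψ]
  · rw [hξ]
    have h1 : MemLp (fun u => ∑ p : Fin (N + 1), ∑ m,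
        (starRingEnd ℂ) (f p m u) • ψ (j - ((p : ℕ) : ℤ)) m) 2 (volume.restrict (Set.Ico 0 T)) :=
      memLp_finsetSum _ fun p _ => memLp_finsetSum _ fun m _ => memLp_conj_smul (hf p m) _
    refine (memLp_congr_ae ?_).mpr h1
    filter_upwards [ae_restrict_mem measurableSet_Ico] with u hu
    exact maProcess_add_of_mem hT f ψ hu j
  · refine le_trans (le_of_eq ?_) (hP j)
    rw [hξ]
    refine setIntegral_congr_fun measurableSet_Ico fun u hu => ?_
    simp only [maProcess_add_of_mem hT f ψ hu j]

theorem genCoef_of_incr_eq_maProcess (hT : 0 < T)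
    (hξ : incr μ d (τ * T) ξ = maProcess T f ψ)
    (hf : ∀ p m, MemLp (f p m) 2 (volume.restrict (Set.Ico 0 T))) (j : ℤ) (k : ℕ) :
    genCoef μ T d τ ξ j k = ∑ p : Fin (N + 1), ∑ m,
      (starRingEnd ℂ) ((conjBasis hT).repr (hf p m).toLp k) • ψ (j - ((p : ℕ) : ℤ)) m := by
  have h1 : genCoef μ T d τ ξ j k = ∫ u in Set.Ico 0 T, ∑ p : Fin (N + 1), ∑ m,
      (starRingEnd ℂ) (basisFun T k u) •
        (starRingEnd ℂ) (f p m u) • ψ (j - ((p : ℕ) : ℤ)) m := by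
    rw [genCoef, hξ]
    refine setIntegral_congr_fun measurableSet_Ico fun u hu => ?_
    simp only [maProcess_add_of_mem hT f ψ hu j, Finset.smul_sum]
  have hi : ∀ p m, Integrable (fun u => (starRingEnd ℂ) (basisFun T k u) •
        (starRingEnd ℂ) (f p m u) • ψ (j - ((p : ℕ) : ℤ)) m) (volume.restrict (Set.Ico 0 T)) :=
    fun p m => integrable_smul_of_memLp (memLp_conj_basisFun T k) (memLp_conj_smul (hf p m) _)
  rw [h1, integral_finsetSum _ fun p _ => integrable_finsetSum _ fun m _ => hi p m]
  refine Finset.sum_congr rfl fun p _ => ?_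
  rw [integral_finsetSum _ fun m _ => hi p m]
  refine Finset.sum_congr rfl fun m _ => ?_
  rw [conjBasis_repr_apply, ← integral_conj]
  simp only [smul_smul]
  rw [integral_smul_const]
  congr 1
  refine integral_congr_ae ?_
  filter_upwards [(hf p m).coeFn_toLp] with u hu
  rw [hu, map_mul, mul_comm]

theorem norm_sq_sum_smul_orthonormal {ι H : Type*} [Fintype ι] [NormedAddCommGroup H]
    [InnerProductSpace ℂ H] {e : ι → H} (he : Orthonormal ℂ e) (c : ι → ℂ) :
    ‖∑ i, c i • e i‖ ^ 2 = ∑ i, ‖c i‖ ^ 2 := by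
  have h : ((‖∑ i, c i • e i‖ ^ 2 : ℝ) : ℂ) = ((∑ i, ‖c i‖ ^ 2 : ℝ) : ℂ) := by
    rw [Complex.ofReal_pow, ← Complex.coe_algebraMap, ← inner_self_eq_norm_sq_to_K (𝕜 := ℂ),
      he.inner_sum]
    push_cast
    exact Finset.sum_congr rfl fun i _ => Complex.conj_mul' _
  exact Complex.ofReal_injective h

theorem exists_movingAverage [IsFiniteMeasure μ] (hT : 0 < T) (hτ : 0 < τ) (g : Fin M → BlockL2 N)
    (hg : ∑ m, ‖g m‖ ^ 2 = P) {ε : ℤ → Fin M → Lp ℂ 2 μ} (hε : IsWhiteNoise μ M ε) :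
    ∃ ξ, MemY μ T d τ P ξ ∧ IsMovingAverage μ T d τ N M g ε ξ := by
  -- Coefficients are conjugated because `maProcess` conjugates its functions and taking components
  -- conjugates the coordinates of those functions. The blocks of `star (g m)` thus reproduce `g m`.
  let F : Fin (N + 1) → Fin M → PeriodL2 T :=
    fun p m => (conjBasis hT).repr.symm (blockPart (star (g m)) p)
  have hF : ∀ p m, MemLp (F p m) 2 (volume.restrict (Set.Ico 0 T)) := fun p m => Lp.memLp _
  obtain ⟨ξ, hξ⟩ := exists_incr_eq (μ := μ) d (mul_pos (Nat.cast_pos.mpr hτ) hT)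
    (maProcess T (fun p m => F p m) ε)
  refine ⟨ξ, memY_of_incr_eq_maProcess hT hξ hF (fun r s m n => ?_) hε.1 fun j => le_of_eq ?_,
    fun j k => ?_⟩
  · have h := orthonormal_iff_ite.mp hε.2
    have h1 := h (r + 1, m) (s + 1, n)
    have h2 := h (r, m) (s, n)
    simp only [Prod.mk.injEq, add_left_inj] at h1 h2
    rw [h1, h2]
  · have ho : Orthonormal ℂ fun i : Fin (N + 1) × Fin M => ε (j - ((i.1 : ℕ) : ℤ)) i.2 :=
      hε.2.comp (fun i : Fin (N + 1) × Fin M => (j - ((i.1 : ℕ) : ℤ), i.2)) (by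
        rintro ⟨p, m⟩ ⟨q, n⟩ h
        simp only [Prod.mk.injEq] at h
        ext <;> simp only [h.2]
        omega)
    have h1 : ∀ u, ‖∑ p : Fin (N + 1), ∑ m,
        (starRingEnd ℂ) (F p m u) • ε (j - ((p : ℕ) : ℤ)) m‖ ^ 2 = ∑ p, ∑ m, ‖F p m u‖ ^ 2 := by
      intro u
      have := norm_sq_sum_smul_orthonormal ho fun i => (starRingEnd ℂ) (F i.1 i.2 u)
      simp only [Fintype.sum_prod_type, RCLike.norm_conj] at this
      exact this
    have hi : ∀ p m, Integrable (fun u => ‖F p m u‖ ^ 2) (volume.restrict (Set.Ico 0 T)) :=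
      fun p m => (hF p m).integrable_norm_pow (by norm_num)
    simp only [h1]
    rw [integral_finsetSum _ fun p _ => integrable_finsetSum _ fun m _ => hi p m]
    have h2 : ∀ p, ∫ u in Set.Ico 0 T, ∑ m, ‖F p m u‖ ^ 2 = ∑ m, ‖F p m‖ ^ 2 := by
      intro p
      rw [integral_finsetSum _ fun m _ => hi p m]
      exact Finset.sum_congr rfl fun m _ => (norm_sq_eq_integral _).symm
    simp only [h2]
    rw [← hg, Finset.sum_comm]
    refine Finset.sum_congr rfl fun m _ => ?_
    rw [← norm_star (g m), norm_sq_eq_sum_blockPart]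
    refine Finset.sum_congr rfl fun p _ => ?_
    rw [LinearIsometryEquiv.norm_map]
  · rw [genCoef_of_incr_eq_maProcess hT hξ hF]
    refine Finset.sum_congr rfl fun p _ => Finset.sum_congr rfl fun m _ => ?_
    rw [Lp.toLp_coeFn, LinearIsometryEquiv.apply_symm_apply, blockPart_apply, lp.star_apply,
      ← starRingEnd_apply, Complex.conj_conj]

end MovingAverageProcess

/-! ### Existence of white noise and of the coefficients -/

section WhiteNoise

/-- Extend the constant `1` to an orthonormal basis, which is infinite by hypothesis, and remove
`1`. The other basis vectors have mean zero, being orthogonal to it, and infinitely many of them can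
be indexed by `ℤ`. -/
theorem exists_whiteNoise {Ω : Type*} [MeasurableSpace Ω] (μ : Measure Ω) [IsProbabilityMeasure μ]
    (hΩ : ¬ FiniteDimensional ℂ (Lp ℂ 2 μ)) :
    ∃ ε : ℤ → Fin 1 → Lp ℂ 2 μ, IsWhiteNoise μ 1 ε := by
  set one : Lp ℂ 2 μ := (memLp_const (1 : ℂ) : MemLp (fun _ : Ω => (1 : ℂ)) 2 μ).toLp with hone
  have h1 : ‖one‖ = 1 := by
    have h2 := norm_sq_toLp (memLp_const (1 : ℂ) : MemLp (fun _ : Ω => (1 : ℂ)) 2 μ)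
    rw [← hone] at h2
    simp only [norm_one, one_pow, integral_const, probReal_univ, smul_eq_mul, mul_one] at h2
    exact (pow_eq_one_iff_of_nonneg (norm_nonneg _) two_ne_zero).mp h2
  have ho : Orthonormal ℂ ((↑) : ({one} : Set (Lp ℂ 2 μ)) → Lp ℂ 2 μ) := by
    refine ⟨?_, ?_⟩
    · rintro ⟨x, rfl⟩
      exact h1
    · rintro ⟨x, rfl⟩ ⟨y, rfl⟩ h
      exact absurd rfl h
  obtain ⟨w, b, hw, hb⟩ := ho.exists_hilbertBasis_extension
  have hinf : w.Infinite := by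
    intro hfin
    refine hΩ ?_
    have hd := b.dense_span
    rw [hb, Subtype.range_coe] at hd
    have : FiniteDimensional ℂ (Submodule.span ℂ w) := FiniteDimensional.span_of_finite ℂ hfin
    rw [(Submodule.closed_of_finiteDimensional (Submodule.span ℂ w)).submodule_topologicalClosure_eq] at hd
    have : FiniteDimensional ℂ (⊤ : Submodule ℂ (Lp ℂ 2 μ)) := hd ▸ this
    exact Module.finite_def.mpr (Module.Finite.iff_fg.mp this)
  have hinf' := (hinf.sdiff (Set.finite_singleton one)).to_subtype
  let φ : ℤ → (w \ {one} : Set (Lp ℂ 2 μ)) :=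
    fun n => Infinite.natEmbedding (w \ {one} : Set (Lp ℂ 2 μ)) (Encodable.encode n)
  have hφ : Function.Injective φ :=
    (Infinite.natEmbedding _).injective.comp Encodable.encode_injective
  have hbo := b.orthonormal
  rw [hb] at hbo
  refine ⟨fun s _ => φ s, fun s _ => ?_, ?_⟩
  · rw [integral_eq_inner_one, ← hone]
    have := hbo.2 (i := ⟨one, hw rfl⟩) (j := ⟨φ s, (φ s).2.1⟩) fun h =>
      (φ s).2.2 (congrArg Subtype.val h).symm
    exact this
  · refine hbo.comp (fun i : ℤ × Fin 1 => (⟨φ i.1, (φ i.1).2.1⟩ : w)) ?_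
    rintro ⟨s, m⟩ ⟨r, n⟩ h
    have h2 : φ s = φ r := Subtype.ext (congrArg (fun x : w => (x : Lp ℂ 2 μ)) h)
    rw [hφ h2, Subsingleton.elim m n]

theorem exists_eigenvector_QOp {N : ℕ} (b : ℕ → SeqL2) {P : ℝ} (hP : 0 < P) :
    ∃ v : BlockL2 N, QOp N b v = ((‖hankel N b‖ ^ 2 : ℝ) : ℂ) • v ∧ ‖v‖ ^ 2 = P := by
  obtain ⟨v, hv⟩ := (isGreatest_eigenvalue_QOp (N := N) b).1.exists_hasEigenvector
  have hv0 : ‖v‖ ≠ 0 := norm_ne_zero_iff.mpr hv.2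
  refine ⟨((Real.sqrt P / ‖v‖ : ℝ) : ℂ) • v, ?_, ?_⟩
  · have h := hv.apply_eq_smul
    rw [ContinuousLinearMap.coe_coe] at h
    rw [map_smul, h, smul_comm]
  · rw [norm_smul, Complex.norm_real, Real.norm_of_nonneg (by positivity), div_mul_cancel₀ _ hv0,
      Real.sq_sqrt hP.le]

theorem exists_isEigenCoef {N : ℕ} (b : ℕ → SeqL2) {P : ℝ} (hP : 0 < P) :
    ∃ g : Fin 1 → BlockL2 N, IsEigenCoef N 1 P (‖hankel N b‖ ^ 2) (QOp N b) g := by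
  obtain ⟨v, hv, hvP⟩ := exists_eigenvector_QOp (N := N) b hP
  refine ⟨fun _ => star v, fun _ => ?_, ?_⟩
  · rw [star_star, hv]
  · rw [Fin.sum_univ_one, norm_star, hvP]

end WhiteNoise

/-! ### Smoothed white noise -/

section Smoothing

open Polynomial

/-- The average of the monomials `X, …, X^n`. -/
def averagePoly (n : ℕ) : ℂ[X] := C (1 / (n : ℂ)) * ∑ k ∈ Finset.range n, X ^ (k + 1)

/-- The average takes the value `1` at `X = 1`, so `1 - averagePoly n` is divisible by `1 - X`. It
can thus be formed from an increment, although it is close to the identity on noise. -/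
theorem exists_one_sub_averagePoly_eq {n : ℕ} (hn : n ≠ 0) :
    ∃ R : ℂ[X], (1 - X) * R = 1 - averagePoly n := by
  refine ⟨C (1 / (n : ℂ)) * ∑ k ∈ Finset.range n, ∑ i ∈ Finset.range (k + 1), X ^ i, ?_⟩
  rw [mul_left_comm, Finset.mul_sum]
  simp only [mul_neg_geom_sum]
  rw [Finset.sum_sub_distrib, Finset.sum_const, Finset.card_range, mul_sub, averagePoly,
    nsmul_one, ← map_natCast C, ← map_mul, one_div_mul_cancel (Nat.cast_ne_zero.mpr hn), map_one]

theorem aeval_apply_mem {V : Type*} [AddCommGroup V] [Module ℂ V] {B : Module.End ℂ V}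
    {W : Submodule ℂ V} (hW : W ≤ W.comap B) (q : ℂ[X]) {v : V} (hv : v ∈ W) :
    aeval B q v ∈ W := by
  rw [aeval_eq_sum_range, LinearMap.sum_apply]
  exact Submodule.sum_mem _ fun i _ =>
    Submodule.smul_mem _ _ (Submodule.le_comap_pow_of_le_comap W hW i hv)

variable {H : Type*} [NormedAddCommGroup H] [InnerProductSpace ℂ H]

theorem aeval_averagePoly_apply (h : ℤ) (n : ℕ) (φ : ℤ → H) (j : ℤ) :
    aeval (timeShift H h) (averagePoly n) φ j =
      (1 / (n : ℂ)) • ∑ k ∈ Finset.range n, φ (j - (k + 1) • h) := by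
  simp only [averagePoly, map_mul, aeval_C, map_sum, map_pow, aeval_X, Module.End.mul_apply,
    Module.algebraMap_end_apply, Pi.smul_apply, LinearMap.sum_apply, Finset.sum_apply,
    timeShift_pow_apply, Finset.smul_sum]

theorem norm_aeval_averagePoly_le {h : ℤ} {n : ℕ} (hn : n ≠ 0) {φ : ℤ → H} {c : ℝ}
    (hφ : ∀ j, ‖φ j‖ ≤ c) (j : ℤ) : ‖aeval (timeShift H h) (averagePoly n) φ j‖ ≤ c := by
  have hn' : (n : ℝ) ≠ 0 := Nat.cast_ne_zero.mpr hn
  rw [aeval_averagePoly_apply, norm_smul, norm_div, norm_one, Complex.norm_natCast]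
  have := norm_sum_le_of_le (Finset.range n) fun k _ => hφ (j - (k + 1) • h)
  rw [Finset.sum_const, Finset.card_range, nsmul_eq_mul] at this
  calc _ ≤ 1 / (n : ℝ) * (n * c) := by gcongr
    _ = c := by field_simp

theorem norm_aeval_one_sub_averagePoly_pow_le {h : ℤ} {n : ℕ} (hn : n ≠ 0) {φ : ℤ → H} {c : ℝ}
    (hφ : ∀ j, ‖φ j‖ ≤ c) (i : ℕ) (j : ℤ) :
    ‖aeval (timeShift H h) ((1 - averagePoly n) ^ i) φ j‖ ≤ 2 ^ i * c := by
  induction i generalizing j with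
  | zero => simpa using hφ j
  | succ i ih =>
    rw [pow_succ', map_mul, Module.End.mul_apply, map_sub, map_one, LinearMap.sub_apply,
      Module.End.one_apply, Pi.sub_apply]
    refine (norm_sub_le _ _).trans ?_
    have := norm_aeval_averagePoly_le (h := h) hn ih j
    rw [pow_succ]
    linarith [ih j]

/-- An average of `n` orthonormal vectors has norm `1 / √n`; the nonzero step keeps the vectors
distinct. -/
theorem norm_aeval_averagePoly_orthonormal {h : ℤ} (hh : h ≠ 0) {n : ℕ} (hn : n ≠ 0) {ε : ℤ → H}
    (hε : Orthonormal ℂ ε) (j : ℤ) :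
    ‖aeval (timeShift H h) (averagePoly n) ε j‖ = 1 / Real.sqrt n := by
  have ho : Orthonormal ℂ fun k : Fin n => ε (j - ((k : ℕ) + 1) • h) := by
    refine hε.comp _ fun k l hkl => ?_
    have h1 : (((k : ℕ) + 1 : ℕ) : ℤ) * h = (((l : ℕ) + 1 : ℕ) : ℤ) * h := by
      simpa only [sub_right_inj, nsmul_eq_mul] using hkl
    have := mul_right_cancel₀ hh h1
    ext
    omega
  have h2 := norm_sq_sum_smul_orthonormal ho fun _ => 1 / (n : ℂ)
  rw [aeval_averagePoly_apply, ← Fin.sum_univ_eq_sum_range (fun k => ε (j - (k + 1) • h)),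
    Finset.smul_sum]
  rw [← Real.sqrt_sq (norm_nonneg _), h2]
  have hn' : (n : ℝ) ≠ 0 := Nat.cast_ne_zero.mpr hn
  rw [Finset.sum_const, Finset.card_univ, Fintype.card_fin, nsmul_eq_mul, norm_div, norm_one,
    Complex.norm_natCast, ← Real.sqrt_one, ← Real.sqrt_div zero_le_one, Real.sqrt_one]
  congr 1
  field_simp

/-- There are polynomials `R` for which `((1 - B) R(B))^d` is almost the identity on the
orthonormal sequence, where `B` is the shift. -/
theorem exists_polynomial_norm_aeval_sub_le (d : ℕ) {h : ℤ} (hh : h ≠ 0) {ε : ℤ → H}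
    (hε : Orthonormal ℂ ε) {δ : ℝ} (hδ : 0 < δ) :
    ∃ R : ℂ[X], ∀ j, ‖aeval (timeShift H h) (((1 - X) * R) ^ d) ε j - ε j‖ ≤ δ := by
  have hlim : Tendsto (fun n : ℕ => (∑ i ∈ Finset.range d, (2 : ℝ) ^ i) * (1 / Real.sqrt n)) atTop
      (𝓝 0) := by
    have h1 : Tendsto (fun n : ℕ => 1 / Real.sqrt n) atTop (𝓝 0) := by
      simp only [one_div]
      exact (Real.tendsto_sqrt_atTop.comp tendsto_natCast_atTop_atTop).inv_tendsto_atTop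
    simpa using h1.const_mul (∑ i ∈ Finset.range d, (2 : ℝ) ^ i)
  obtain ⟨n, hn, hn0⟩ := ((hlim.eventually (gt_mem_nhds hδ)).and (eventually_ne_atTop 0)).exists
  obtain ⟨R, hR⟩ := exists_one_sub_averagePoly_eq hn0
  refine ⟨R, fun j => ?_⟩
  -- The geometric sum leaves a factor `averagePoly n`, which makes the noise of size `1 / √n`. The
  -- remaining factor multiplies uniform bounds by at most `∑ 2 ^ i` over `i < d`, independently of
  -- `n`.
  have h1 : (1 - averagePoly n) ^ d = 1 - (∑ i ∈ Finset.range d, (1 - averagePoly n) ^ i) *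
      averagePoly n := by
    have := mul_neg_geom_sum (1 - averagePoly n) d
    rw [sub_sub_cancel, mul_comm] at this
    rw [this, sub_sub_cancel]
  rw [hR, h1, map_sub, map_one, LinearMap.sub_apply, Module.End.one_apply, Pi.sub_apply,
    sub_sub_cancel_left, norm_neg, map_mul, Module.End.mul_apply, map_sum, LinearMap.sum_apply,
    Finset.sum_apply]
  refine le_trans ?_ hn.le
  rw [Finset.sum_mul]
  exact norm_sum_le_of_le _ fun i _ => norm_aeval_one_sub_averagePoly_pow_le hn0
    (fun j => (norm_aeval_averagePoly_orthonormal hh hn0 hε j).le) i j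

/-- The sequences which are jointly stationary with `ψ`. -/
def jointlyStationary (ψ : ℤ → H) : Submodule ℂ (ℤ → H) where
  carrier := {φ | ∀ r s, inner ℂ (ψ (r + 1)) (φ (s + 1)) = inner ℂ (ψ r) (φ s)}
  add_mem' := fun h1 h2 r s => by
    simp only [Pi.add_apply, inner_add_right]
    rw [h1, h2]
  zero_mem' := fun r s => by simp
  smul_mem' := fun c φ h r s => by
    simp only [Pi.smul_apply, inner_smul_right]
    rw [h]

theorem jointlyStationary_le_comap (ψ : ℤ → H) (h : ℤ) :
    jointlyStationary ψ ≤ (jointlyStationary ψ).comap (timeShift H h) := by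
  intro φ hφ r s
  change inner ℂ (ψ (r + 1)) (φ (s + 1 - h)) = inner ℂ (ψ r) (φ (s - h))
  rw [add_sub_right_comm, hφ]

theorem mem_jointlyStationary_comm {φ ψ : ℤ → H} :
    φ ∈ jointlyStationary ψ ↔ ψ ∈ jointlyStationary φ := by
  have h : ∀ φ ψ : ℤ → H, φ ∈ jointlyStationary ψ → ψ ∈ jointlyStationary φ := by
    intro φ ψ h r s
    rw [← inner_conj_symm, h, inner_conj_symm]
  exact ⟨h φ ψ, h ψ φ⟩

theorem aeval_mem_jointlyStationary {φ ψ : ℤ → H} (hφ : φ ∈ jointlyStationary ψ) (h h' : ℤ)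
    (q q' : ℂ[X]) :
    aeval (timeShift H h) q φ ∈ jointlyStationary (aeval (timeShift H h') q' ψ) := by
  refine aeval_apply_mem (jointlyStationary_le_comap _ h) q ?_
  rw [mem_jointlyStationary_comm] at hφ ⊢
  exact aeval_apply_mem (jointlyStationary_le_comap _ h') q' hφ

theorem mem_jointlyStationary_self {ε : ℤ → H} (hε : Orthonormal ℂ ε) :
    ε ∈ jointlyStationary ε := by
  intro r s
  simp only [orthonormal_iff_ite.mp hε, add_left_inj]

/-- The sequences whose values are orthogonal to `y`. -/
def valuesOrthogonal (y : H) : Submodule ℂ (ℤ → H) where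
  carrier := {φ | ∀ s, inner ℂ y (φ s) = 0}
  add_mem' := fun h1 h2 s => by rw [Pi.add_apply, inner_add_right, h1, h2, add_zero]
  zero_mem' := fun s => by simp
  smul_mem' := fun c φ h s => by rw [Pi.smul_apply, inner_smul_right, h, mul_zero]

theorem valuesOrthogonal_le_comap (y : H) (h : ℤ) :
    valuesOrthogonal y ≤ (valuesOrthogonal y).comap (timeShift H h) :=
  fun _ hφ s => hφ (s - h)

/-- The sequences whose values are orthogonal to the later values of `ε`. -/
def adapted (ε : ℤ → H) : Submodule ℂ (ℤ → H) where
  carrier := {φ | ∀ r s, s < r → inner ℂ (ε r) (φ s) = 0}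
  add_mem' := fun h1 h2 r s h => by rw [Pi.add_apply, inner_add_right, h1 r s h, h2 r s h, add_zero]
  zero_mem' := fun r s _ => by simp
  smul_mem' := fun c φ h r s hrs => by rw [Pi.smul_apply, inner_smul_right, h r s hrs, mul_zero]

theorem adapted_le_comap (ε : ℤ → H) {h : ℤ} (hh : 0 ≤ h) :
    adapted ε ≤ (adapted ε).comap (timeShift H h) :=
  fun _ hφ r s hrs => hφ r (s - h) (by omega)

theorem mem_adapted_self {ε : ℤ → H} (hε : Orthonormal ℂ ε) : ε ∈ adapted ε :=
  fun _ _ h => hε.2 h.ne'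

end Smoothing

/-! ### Mean-square continuous processes -/

section ContinuousProcess

open Polynomial

variable {N : ℕ} {T : ℝ}

/-- The one-dimensional moving average as a linear map of the sequence `φ`. -/
def maLinear (V : Type*) [AddCommGroup V] [Module ℂ V] (T : ℝ) (f : Fin (N + 1) → ℝ → ℂ) :
    (ℤ → V) →ₗ[ℂ] (ℝ → V) where
  toFun φ := maProcess T (fun p (_ : Fin 1) => f p) fun s _ => φ s
  map_add' φ ψ := by
    ext1 t
    simp only [maProcess, Pi.add_apply, smul_add, Finset.sum_add_distrib]
  map_smul' c φ := by
    ext1 t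
    simp only [maProcess, Pi.smul_apply, Finset.smul_sum, RingHom.id_apply]
    refine Finset.sum_congr rfl fun p _ => Finset.sum_congr rfl fun m _ => smul_comm _ _ _

theorem maLinear_apply {V : Type*} [AddCommGroup V] [Module ℂ V] (f : Fin (N + 1) → ℝ → ℂ)
    (φ : ℤ → V) :
    maLinear V T f φ = maProcess T (fun p (_ : Fin 1) => f p) fun s _ => φ s := rfl

theorem maLinear_timeShift {V : Type*} [AddCommGroup V] [Module ℂ V] (hT : 0 < T)
    (f : Fin (N + 1) → ℝ → ℂ) (φ : ℤ → V) (σ : ℤ) :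
    maLinear V T f (timeShift V σ φ) = timeShift V (σ * T) (maLinear V T f φ) := by
  ext1 t
  have h := maProcess_add hT (fun p (_ : Fin 1) => f p) (fun s _ => φ s) t (-σ)
  rw [Int.cast_neg, neg_mul, ← sub_eq_add_neg] at h
  exact h.symm

variable {Ω : Type*} [MeasurableSpace Ω] {μ : Measure Ω}

/-- A time shift by `σ T` of a moving average is a shift by `σ` of its driving sequence. Increments
with any integer step are therefore moving averages with the same coefficient functions, driven by a
polynomial in the shift applied to `φ`. -/
theorem incr_maLinear (hT : 0 < T) (f : Fin (N + 1) → ℝ → ℂ) (φ : ℤ → Lp ℂ 2 μ) (d : ℕ) (σ : ℤ) :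
    incr μ d (σ * T) (maLinear _ T f φ) =
      maLinear _ T f (aeval (timeShift (Lp ℂ 2 μ) σ) ((1 - X : ℂ[X]) ^ d) φ) := by
  rw [incr_eq_pow_apply, map_pow (aeval _), map_sub, map_one, aeval_X]
  induction d with
  | zero => simp
  | succ d ih =>
    rw [pow_succ', Module.End.mul_apply, ih, pow_succ', Module.End.mul_apply, LinearMap.sub_apply,
      LinearMap.sub_apply, map_sub, maLinear_timeShift hT, Module.End.one_apply,
      Module.End.one_apply]

theorem inner_maLinear_add {H : Type*} [NormedAddCommGroup H] [InnerProductSpace ℂ H] (hT : 0 < T)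
    (f : Fin (N + 1) → ℝ → ℂ) {φ ψ : ℤ → H} (h : φ ∈ jointlyStationary ψ) (s t : ℝ) :
    inner ℂ (maLinear H T f ψ (s + T)) (maLinear H T f φ (t + T)) =
      inner ℂ (maLinear H T f ψ s) (maLinear H T f φ t) := by
  simp only [maLinear_apply]
  exact inner_maProcess_add hT _ _ _ _ (fun r s _ _ => h r s) t s

theorem continuous_maLinear {V : Type*} [NormedAddCommGroup V] [NormedSpace ℂ V] (hT : 0 < T)
    {f : Fin (N + 1) → ℝ → ℂ} (hf : ∀ p, Continuous (f p))
    (hf0 : ∀ p, ∀ u ∉ Set.Ioo 0 T, f p u = 0) (φ : ℤ → V) : Continuous (maLinear V T f φ) := by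
  let G : ℤ → ℝ → V := fun i t =>
    ∑ p : Fin (N + 1), (starRingEnd ℂ) (f p (t - i * T)) • φ (i - ((p : ℕ) : ℤ))
  have hG : ∀ i, Continuous (G i) := fun i => by
    refine continuous_finsetSum _ fun p _ => Continuous.smul ?_ continuous_const
    exact Complex.continuous_conj.comp ((hf p).comp (by fun_prop))
  have hG0 : ∀ i t, i ≠ ⌊t / T⌋ → G i t = 0 := by
    intro i t h
    refine Finset.sum_eq_zero fun p _ => ?_
    rw [hf0, map_zero, zero_smul]
    rintro ⟨h1, h2⟩
    refine h (Int.floor_eq_iff.mpr ⟨?_, ?_⟩).symm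
    · rw [le_div_iff₀ hT]; linarith
    · rw [div_lt_iff₀ hT]; linarith
  have hval : ∀ t, maLinear V T f φ t = G ⌊t / T⌋ t := fun t => by
    rw [maLinear_apply, maProcess]
    simp only [Fin.sum_univ_one]
    rfl
  rw [continuous_iff_continuousAt]
  intro t₀
  set i := ⌊t₀ / T⌋ with hi
  have h1 : (i : ℝ) * T ≤ t₀ := by
    have := Int.floor_le (t₀ / T)
    rwa [le_div_iff₀ hT] at this
  have h2 : t₀ < (i + 1) * T := by
    have := Int.lt_floor_add_one (t₀ / T)
    rwa [div_lt_iff₀ hT] at this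
  -- Near `t₀` only two periods matter, and each piece vanishes outside its own period. The process
  -- is locally the sum of two continuous functions, even at a junction.
  refine ((hG (i - 1)).add (hG i)).continuousAt.congr ?_
  filter_upwards [Ioo_mem_nhds (show (i - 1) * T < t₀ by linarith) h2] with t ht
  have h3 : ((i - 1 : ℤ) : ℝ) ≤ t / T := by
    rw [le_div_iff₀ hT]; push_cast; exact ht.1.le
  have h4 : t / T < ((i + 1 : ℤ) : ℝ) := by
    rw [div_lt_iff₀ hT]; push_cast; exact ht.2
  have h5 := Int.le_floor.mpr h3
  have h6 := Int.floor_lt.mpr h4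
  rw [hval, Pi.add_apply]
  rcases eq_or_ne ⌊t / T⌋ i with h | h
  · rw [h, hG0 (i - 1) t (by omega), zero_add]
  · rw [show ⌊t / T⌋ = i - 1 by omega, hG0 i t h.symm, add_zero]

theorem memLp_of_continuous_of_eq_zero {f : ℝ → ℂ} (hf : Continuous f)
    (hf0 : ∀ u ∉ Set.Ioo 0 T, f u = 0) : MemLp f 2 (volume.restrict (Set.Ico 0 T)) := by
  have hc : HasCompactSupport f := HasCompactSupport.intro isCompact_Icc fun u hu =>
    hf0 u fun h => hu (Set.Ioo_subset_Icc_self h)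
  exact (hf.memLp_of_hasCompactSupport hc).restrict _

/-- The families of functions which are continuous and vanish outside `(0,T)`, as elements of the
space of families of sequences. -/
def continuousBlocks (N : ℕ) (hT : 0 < T) : Set (BlockL2 N) :=
  {v | ∃ f : Fin (N + 1) → ℝ → ℂ, (∀ p, Continuous (f p)) ∧
    (∀ p, ∀ u ∉ Set.Ioo 0 T, f p u = 0) ∧
    ∃ hf : ∀ p, MemLp (f p) 2 (volume.restrict (Set.Ico 0 T)),
      ∀ p, blockPart v p = (conjBasis hT).repr (hf p).toLp}

/-- The continuous functions which vanish outside `(0,T)`, as elements of `L₂([0,T))`. -/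
def continuousSubmodule (T : ℝ) : Submodule ℂ (PeriodL2 T) where
  carrier := {x | ∃ f : ℝ → ℂ, Continuous f ∧ (∀ u ∉ Set.Ioo 0 T, f u = 0) ∧
    x =ᵐ[volume.restrict (Set.Ico 0 T)] f}
  add_mem' := by
    rintro x y ⟨f, hf, hf0, hx⟩ ⟨g, hg, hg0, hy⟩
    refine ⟨f + g, hf.add hg, fun u hu => ?_, (Lp.coeFn_add x y).trans (hx.add hy)⟩
    rw [Pi.add_apply, hf0 u hu, hg0 u hu, add_zero]
  zero_mem' := ⟨0, continuous_const, fun _ _ => rfl, Lp.coeFn_zero _ _ _⟩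
  smul_mem' := by
    rintro c x ⟨f, hf, hf0, hx⟩
    refine ⟨c • f, hf.const_smul c, fun u hu => ?_, (Lp.coeFn_smul c x).trans (hx.const_smul c)⟩
    rw [Pi.smul_apply, hf0 u hu, smul_zero]

/-- A function orthogonal to all smooth functions with compact support in `(0,T)` vanishes almost
everywhere. -/
theorem dense_continuousSubmodule (T : ℝ) :
    Dense (continuousSubmodule T : Set (PeriodL2 T)) := by
  rw [Submodule.dense_iff_topologicalClosure_eq_top, Submodule.topologicalClosure_eq_top_iff,
    Submodule.eq_bot_iff]
  intro x hx
  have hxi : IntegrableOn (x : ℝ → ℂ) (Set.Ico 0 T) := (Lp.memLp x).integrable (by norm_num)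
  have h := IsOpen.ae_eq_zero_of_integral_contDiff_smul_eq_zero (μ := volume) (f := (x : ℝ → ℂ))
    (isOpen_Ioo (a := (0 : ℝ)) (b := T))
    (hxi.mono_set Set.Ioo_subset_Ico_self).locallyIntegrableOn fun g hg hgc hgs => by
      have hg1 : Continuous fun u => (g u : ℂ) := Complex.continuous_ofReal.comp hg.continuous
      have hg0 : ∀ u ∉ Set.Ioo 0 T, g u = 0 := fun u hu =>
        image_eq_zero_of_notMem_tsupport fun h => hu (hgs h)
      have hg0' : ∀ u ∉ Set.Ioo 0 T, (g u : ℂ) = 0 := fun u hu => by rw [hg0 u hu]; rfl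
      have hm := memLp_of_continuous_of_eq_zero hg1 hg0'
      have h0 := (Submodule.mem_orthogonal _ _).mp hx hm.toLp ⟨_, hg1, hg0', hm.coeFn_toLp⟩
      rw [L2.inner_def] at h0
      rw [← setIntegral_eq_integral_of_forall_compl_eq_zero (s := Set.Ico 0 T), ← h0]
      · refine integral_congr_ae ?_
        filter_upwards [hm.coeFn_toLp] with u hu
        rw [hu, RCLike.inner_apply, Complex.conj_ofReal, Complex.real_smul, mul_comm]
      · intro u hu
        rw [hg0 u fun h => hu (Set.Ioo_subset_Ico_self h), zero_smul]
  have h2 : ∀ y : ℝ → ℂ, (∀ᵐ u, u ∈ Set.Ioo 0 T → y u = 0) →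
      y =ᵐ[volume.restrict (Set.Ico 0 T)] 0 := by
    intro y hy
    rw [Filter.EventuallyEq, Measure.restrict_congr_set Ioo_ae_eq_Ico.symm,
      ae_restrict_iff' measurableSet_Ioo]
    exact hy
  exact (Lp.eq_zero_iff_ae_eq_zero).mpr (h2 x h)

theorem dense_continuousBlocks (N : ℕ) (hT : 0 < T) : Dense (continuousBlocks N hT) := by
  let Φ : (Fin (N + 1) → PeriodL2 T) → BlockL2 N := fun x => blockMk fun p => (conjBasis hT).repr (x p)
  have hΦ : Continuous Φ := by
    rw [continuous_iff_continuousAt]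
    intro x
    rw [ContinuousAt, tendsto_iff_norm_sub_tendsto_zero]
    have h1 : ∀ y, ‖Φ y - Φ x‖ = Real.sqrt (∑ p, ‖y p - x p‖ ^ 2) := by
      intro y
      rw [← Real.sqrt_sq (norm_nonneg (Φ y - Φ x)), norm_sq_eq_sum_blockPart]
      congr 1
      refine Finset.sum_congr rfl fun p _ => ?_
      rw [← (conjBasis hT).repr.norm_map, map_sub]
      rfl
    simp only [h1]
    have h2 : Continuous fun y : Fin (N + 1) → PeriodL2 T => Real.sqrt (∑ p, ‖y p - x p‖ ^ 2) := by
      fun_prop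
    have h3 := h2.tendsto x
    simpa using h3
  have hs : Function.Surjective Φ := fun v =>
    ⟨fun p => (conjBasis hT).repr.symm (blockPart v p), by
      ext i
      simp only [Φ, LinearIsometryEquiv.apply_symm_apply]
      rfl⟩
  refine (hs.denseRange.dense_image hΦ
    (dense_pi Set.univ fun (_ : Fin (N + 1)) _ => dense_continuousSubmodule T)).mono ?_
  rintro _ ⟨x, hx, rfl⟩
  choose f hf hf0 hfx using fun p => hx p (Set.mem_univ p)
  have hm : ∀ p, MemLp (f p) 2 (volume.restrict (Set.Ico 0 T)) :=
    fun p => memLp_of_continuous_of_eq_zero (hf p) (hf0 p)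
  refine ⟨f, hf, hf0, hm, fun p => ?_⟩
  simp only [Φ, blockPart_blockMk]
  congr 1
  exact Lp.ext ((hfx p).trans (hm p).coeFn_toLp.symm)

end ContinuousProcess

/-! ### The mean-square continuous processes approximate the least favorable ones -/

section Approximation

open Polynomial

variable {N : ℕ}

/-- The one-dimensional moving average of `φ` with the coefficients `conj v`. -/
def maOperator {H : Type*} [NormedAddCommGroup H] [InnerProductSpace ℂ H] (v : BlockL2 N)
    (φ : ℤ → H) (j : ℤ) : SeqL2 →L[ℂ] H :=
  ∑ p : Fin (N + 1), (innerSL ℂ (blockPart v p)).smulRight (φ (j - ((p : ℕ) : ℤ)))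

theorem maOperator_apply {H : Type*} [NormedAddCommGroup H] [InnerProductSpace ℂ H] (v : BlockL2 N)
    (φ : ℤ → H) (j : ℤ) (f : SeqL2) :
    maOperator v φ j f = ∑ p : Fin (N + 1), inner ℂ (blockPart v p) f • φ (j - ((p : ℕ) : ℤ)) := by
  rw [maOperator, _root_.sum_apply]
  rfl

theorem maOperator_unitSeq {H : Type*} [NormedAddCommGroup H] [InnerProductSpace ℂ H]
    (v : BlockL2 N) (φ : ℤ → H) (j : ℤ) (k : ℕ) :
    maOperator v φ j (unitSeq k) =
      ∑ p : Fin (N + 1), (starRingEnd ℂ) (v (p, k)) • φ (j - ((p : ℕ) : ℤ)) := by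
  simp only [maOperator_apply, inner_unitSeq_right, blockPart_apply]

theorem norm_sum_smul_sub_le {H : Type*} [NormedAddCommGroup H] [InnerProductSpace ℂ H]
    {ε η : ℤ → H} {δ : ℝ} (hη : ∀ j, ‖η j - ε j‖ ≤ δ) (c : Fin (N + 1) → ℂ) (j : ℤ) :
    ‖∑ p : Fin (N + 1), c p • η (j - ((p : ℕ) : ℤ)) -
      ∑ p : Fin (N + 1), c p • ε (j - ((p : ℕ) : ℤ))‖ ≤ δ * ∑ p, ‖c p‖ := by
  rw [← Finset.sum_sub_distrib, Finset.mul_sum]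
  refine norm_sum_le_of_le _ fun p _ => ?_
  rw [← smul_sub, norm_smul, mul_comm]
  exact mul_le_mul_of_nonneg_right (hη _) (norm_nonneg _)

/-- Each `‖c p‖` is at most the norm of the combination of `ε`, so replacing `ε` by `η` changes that
combination by at most `δ (N + 1)` times its norm. This controls the power after perturbation of the
noise. -/
theorem norm_sq_sum_smul_le {H : Type*} [NormedAddCommGroup H] [InnerProductSpace ℂ H]
    {ε η : ℤ → H} (hε : Orthonormal ℂ ε) {δ : ℝ} (hδ : 0 ≤ δ) (hη : ∀ j, ‖η j - ε j‖ ≤ δ)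
    (c : Fin (N + 1) → ℂ) (j : ℤ) :
    ‖∑ p : Fin (N + 1), c p • η (j - ((p : ℕ) : ℤ))‖ ^ 2 ≤
      (1 + δ * (N + 1)) ^ 2 * ∑ p, ‖c p‖ ^ 2 := by
  have ho : Orthonormal ℂ fun p : Fin (N + 1) => ε (j - ((p : ℕ) : ℤ)) :=
    hε.comp _ fun p q h => by
      have : j - ((p : ℕ) : ℤ) = j - ((q : ℕ) : ℤ) := h
      ext
      omega
  have h1 := norm_sq_sum_smul_orthonormal ho c
  set s := ‖∑ p : Fin (N + 1), c p • ε (j - ((p : ℕ) : ℤ))‖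
  rw [← h1, ← mul_pow]
  refine pow_le_pow_left₀ (norm_nonneg _) ?_ 2
  have h2 : ∀ p, ‖c p‖ ≤ s := fun p => by
    refine le_of_sq_le_sq ?_ (norm_nonneg _)
    rw [h1]
    exact Finset.single_le_sum (f := fun p => ‖c p‖ ^ 2) (fun _ _ => sq_nonneg _)
      (Finset.mem_univ p)
  have h3 : ∑ p, ‖c p‖ ≤ (N + 1) * s := by
    refine (Finset.sum_le_sum fun p _ => h2 p).trans (le_of_eq ?_)
    simp
  have h4 := norm_le_norm_add_norm_sub' (∑ p : Fin (N + 1), c p • η (j - ((p : ℕ) : ℤ)))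
    (∑ p : Fin (N + 1), c p • ε (j - ((p : ℕ) : ℤ)))
  have h5 := (norm_sum_smul_sub_le hη c j).trans (mul_le_mul_of_nonneg_left h3 hδ)
  calc _ ≤ s + δ * ((N + 1) * s) := h4.trans (add_le_add_right h5 s)
    _ = _ := by ring

/-- A stable version of the lower bound. Smoothed noise `η` that is adapted to `ε` keeps the past
orthogonal to `ε s` for `s ≥ 0`, so the bound for the exact noise applies to the same predictor `x`.
Replacing `ε` by `η` in the functional costs at most a multiple of `δ`. -/
theorem norm_adjoint_hankel_le {H : Type*} [NormedAddCommGroup H] [InnerProductSpace ℂ H]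
    {ε η : ℤ → H} (hε : Orthonormal ℂ ε) {δ : ℝ} (hη : ∀ j, ‖η j - ε j‖ ≤ δ)
    (hηε : η ∈ adapted ε) (b : ℕ → SeqL2) (hb0 : ∀ j, N < j → b j = 0) (v : BlockL2 N)
    {x : H} (hx : x ∈ past (maOperator v η) 0) :
    ‖ContinuousLinearMap.adjoint (hankel N b) v‖ ≤ ‖functional (maOperator v η) b N - x‖ +
      δ * ∑ j ∈ Finset.range (N + 1), ∑ p, ‖blockPart v p‖ * ‖b j‖ := by
  have h1 : ‖functional (maOperator v η) b N - functional (maOperator v ε) b N‖ ≤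
      δ * ∑ j ∈ Finset.range (N + 1), ∑ p, ‖blockPart v p‖ * ‖b j‖ := by
    have hδ : 0 ≤ δ := (norm_nonneg _).trans (hη 0)
    rw [functional, functional, ← Finset.sum_sub_distrib, Finset.mul_sum]
    refine norm_sum_le_of_le _ fun j _ => ?_
    rw [maOperator_apply, maOperator_apply]
    refine (norm_sum_smul_sub_le hη _ _).trans (mul_le_mul_of_nonneg_left ?_ hδ)
    exact Finset.sum_le_sum fun p _ => norm_inner_le_norm _ _
  have hx' : ∀ s : ℕ, inner ℂ (ε s) x = 0 := fun s => by
    refine inner_eq_zero_of_mem_past (fun j hj k => ?_) hx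
    rw [maOperator_unitSeq, inner_sum]
    refine Finset.sum_eq_zero fun p _ => ?_
    rw [inner_smul_right, hηε _ _ (by omega), mul_zero]
  have hε' : Orthonormal ℂ fun i : ℤ × Fin 1 => ε i.1 :=
    hε.comp (fun i : ℤ × Fin 1 => i.1) fun i j h => Prod.ext h (Subsingleton.elim _ _)
  have h2 := le_norm_sq_functional_sub (maOperator v ε) b hb0 (fun _ : Fin 1 => star v)
    (fun s _ => ε s) hε' (fun j k => by
      simp only [maOperator_unitSeq, Fin.sum_univ_one, lp.star_apply, starRingEnd_apply]) x
    fun s _ => hx' s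
  simp only [Fin.sum_univ_one, star_star] at h2
  rw [sum_norm_sq_inner_shiftVec] at h2
  have h3 := le_of_sq_le_sq h2 (norm_nonneg _)
  have h4 : ‖functional (maOperator v ε) b N - x‖ ≤ ‖functional (maOperator v ε) b N -
      functional (maOperator v η) b N‖ + ‖functional (maOperator v η) b N - x‖ :=
    norm_sub_le_norm_sub_add_norm_sub _ _ _
  rw [norm_sub_rev (functional (maOperator v ε) b N) (functional (maOperator v η) b N)] at h4
  linarith

variable {Ω : Type*} [MeasurableSpace Ω] {μ : Measure Ω} {T P : ℝ} {d τ : ℕ} {a : ℝ → ℂ}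

theorem integral_norm_sq_le_of_continuousBlocks {H : Type*} [NormedAddCommGroup H]
    [InnerProductSpace ℂ H] (hT : 0 < T) {ε η : ℤ → H} (hε : Orthonormal ℂ ε) {δ : ℝ} (hδ : 0 ≤ δ)
    (hη : ∀ j, ‖η j - ε j‖ ≤ δ) {v : BlockL2 N} {f : Fin (N + 1) → ℝ → ℂ}
    (hf : ∀ p, MemLp (f p) 2 (volume.restrict (Set.Ico 0 T)))
    (hv : ∀ p, blockPart v p = (conjBasis hT).repr (hf p).toLp) (j : ℤ) :
    ∫ u in Set.Ico 0 T, ‖∑ p : Fin (N + 1), (starRingEnd ℂ) (f p u) •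
      η (j - ((p : ℕ) : ℤ))‖ ^ 2 ≤ (1 + δ * (N + 1)) ^ 2 * ‖v‖ ^ 2 := by
  have hi : ∀ p, Integrable (fun u => ‖f p u‖ ^ 2) (volume.restrict (Set.Ico 0 T)) :=
    fun p => (hf p).integrable_norm_pow (by norm_num)
  have h1 : ‖v‖ ^ 2 = ∫ u in Set.Ico 0 T, ∑ p, ‖f p u‖ ^ 2 := by
    rw [integral_finsetSum _ fun p _ => hi p, norm_sq_eq_sum_blockPart]
    refine Finset.sum_congr rfl fun p _ => ?_
    rw [hv, LinearIsometryEquiv.norm_map, norm_sq_toLp]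
  rw [h1, ← integral_const_mul]
  refine integral_mono_of_nonneg (Eventually.of_forall fun u => sq_nonneg _)
    ((integrable_finsetSum _ fun p _ => hi p).const_mul _) (Eventually.of_forall fun u => ?_)
  refine (norm_sq_sum_smul_le hε hδ hη _ j).trans (le_of_eq ?_)
  simp only [RCLike.norm_conj]

/-- Driving the process by `R(B)^d ε`, with `B` the shift by `τ`, makes its increment with step `τ
T` a moving average of `((1 - B) R(B))^d ε`, which is near `ε` for a suitable `R`. -/
theorem incr_smoothed (hT : 0 < T) (f : Fin (N + 1) → ℝ → ℂ) (ε : ℤ → Lp ℂ 2 μ) (R : ℂ[X]) :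
    incr μ d (τ * T) (maLinear _ T f (aeval (timeShift (Lp ℂ 2 μ) (τ : ℤ)) (R ^ d) ε)) =
      maLinear _ T f (aeval (timeShift (Lp ℂ 2 μ) (τ : ℤ)) (((1 - X) * R) ^ d) ε) := by
  have h := incr_maLinear hT f (aeval (timeShift (Lp ℂ 2 μ) (τ : ℤ)) (R ^ d) ε) d τ
  rwa [Int.cast_natCast, ← Module.End.mul_apply, ← map_mul, ← mul_pow] at h

/-- Here the process itself is a moving average of a stationary sequence, not an arbitrary solution
of the difference equation. All its increments come from polynomials in shifts of one noise, hence
are jointly periodically correlated with mean zero. -/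
theorem memYCont_maLinear [IsFiniteMeasure μ] (hT : 0 < T) {ε : ℤ → Lp ℂ 2 μ}
    (hε : Orthonormal ℂ ε) (h0 : ∀ s, ∫ ω, ε s ω ∂μ = 0) {R : ℂ[X]} {δ : ℝ} (hδ : 0 ≤ δ)
    (hR : ∀ j, ‖aeval (timeShift (Lp ℂ 2 μ) (τ : ℤ)) (((1 - X) * R) ^ d) ε j - ε j‖ ≤ δ)
    {v : BlockL2 N} {f : Fin (N + 1) → ℝ → ℂ} (hfc : ∀ p, Continuous (f p))
    (hf0 : ∀ p, ∀ u ∉ Set.Ioo 0 T, f p u = 0)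
    (hf : ∀ p, MemLp (f p) 2 (volume.restrict (Set.Ico 0 T)))
    (hv : ∀ p, blockPart v p = (conjBasis hT).repr (hf p).toLp)
    (hP : (1 + δ * (N + 1)) ^ 2 * ‖v‖ ^ 2 ≤ P) :
    MemYCont μ T d τ P
      (maLinear _ T f (aeval (timeShift (Lp ℂ 2 μ) (τ : ℤ)) (R ^ d) ε)) := by
  have hst := mem_jointlyStationary_self hε
  have hmean : ∀ (σ : ℤ) (q : ℂ[X]) s, ∫ ω, aeval (timeShift (Lp ℂ 2 μ) σ) q
      (aeval (timeShift (Lp ℂ 2 μ) (τ : ℤ)) (R ^ d) ε) s ω ∂μ = 0 := by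
    simp only [integral_eq_inner_one] at h0 ⊢
    intro σ q
    have h1 := aeval_apply_mem (valuesOrthogonal_le_comap _ (τ : ℤ)) (R ^ d)
      (show ε ∈ valuesOrthogonal _ from h0)
    exact aeval_apply_mem (valuesOrthogonal_le_comap _ σ) q h1
  have hincr := incr_smoothed (μ := μ) (d := d) (τ := τ) hT f ε R
  have hY : MemY μ T d τ P
      (maLinear _ T f (aeval (timeShift (Lp ℂ 2 μ) (τ : ℤ)) (R ^ d) ε)) := by
    refine memY_of_incr_eq_maProcess hT (hincr.trans (maLinear_apply _ _)) (fun p _ => hf p)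
      (fun r s _ _ => aeval_mem_jointlyStationary hst _ _ _ _ r s) (fun s _ => ?_) fun j => ?_
    · have := hmean τ ((1 - X) ^ d) s
      rwa [← Module.End.mul_apply, ← map_mul, ← mul_pow] at this
    · simp only [Fin.sum_univ_one]
      exact (integral_norm_sq_le_of_continuousBlocks hT hε hδ hR hf hv j).trans hP
  refine ⟨hY, ?_, fun σ t => ?_, fun σ₁ σ₂ t s => ?_⟩
  · rw [hincr]
    exact continuous_maLinear hT hfc hf0 _
  · rw [incr_maLinear hT, maLinear_apply, integral_maProcess fun s _ => hmean _ _ s,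
      integral_maProcess fun s _ => hmean _ _ s]
  · rw [incr_maLinear hT, incr_maLinear hT]
    exact inner_maLinear_add hT f (aeval_mem_jointlyStationary
      (aeval_mem_jointlyStationary hst _ _ _ _) _ _ _ _) s t

theorem exists_memYCont_norm_adjoint_hankel_le [IsFiniteMeasure μ] (hT : 0 < T) (hτ : 0 < τ)
    (ha : IntegrableOn a (Set.Icc 0 ((N + 1 : ℝ) * T))) (hb : CoefCondition T d τ N a)
    {ε : ℤ → Lp ℂ 2 μ} (hε : Orthonormal ℂ ε) (h0 : ∀ s, ∫ ω, ε s ω ∂μ = 0)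
    {v : BlockL2 N} (hv : v ∈ continuousBlocks N hT) (hvP : ‖v‖ ^ 2 < P) {ρ : ℝ} (hρ : 0 < ρ) :
    ∃ ξ, MemYCont μ T d τ P ξ ∧
      ‖ContinuousLinearMap.adjoint (hankel N (bSeq hb)) v‖ ≤
        Real.sqrt (optError μ T d τ N a ξ) + ρ := by
  obtain ⟨f, hfc, hf0, hf, hvf⟩ := hv
  set C := ∑ j ∈ Finset.range (N + 1), ∑ p, ‖blockPart v p‖ * ‖bSeq hb j‖
  -- Strict inequality in `‖v‖² < P` leaves room for the power lost to smoothing, and `δ C < ρ`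
  -- controls the loss in the error bound.
  obtain ⟨δ, ⟨hδP, hδC⟩, hδ⟩ : ∃ δ : ℝ, ((1 + δ * (N + 1)) ^ 2 * ‖v‖ ^ 2 < P ∧ δ * C < ρ) ∧ 0 < δ := by
    have h1 : Continuous fun δ : ℝ => (1 + δ * (N + 1)) ^ 2 * ‖v‖ ^ 2 := by fun_prop
    have h2 : Continuous fun δ : ℝ => δ * C := by fun_prop
    have h3 := (h1.tendsto 0).eventually_lt_const (u := P) (by simpa using hvP)
    have h4 := (h2.tendsto 0).eventually_lt_const (u := ρ) (by simpa using hρ)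
    exact (((h3.and h4).filter_mono nhdsWithin_le_nhds).and
      (self_mem_nhdsWithin : Set.Ioi (0 : ℝ) ∈ 𝓝[>] 0)).exists
  obtain ⟨R, hR⟩ := exists_polynomial_norm_aeval_sub_le d
    (h := (τ : ℤ)) (by exact_mod_cast hτ.ne') hε hδ
  have hξ := memYCont_maLinear (P := P) (τ := τ) hT hε h0 hδ.le hR hfc hf0 hf hvf hδP.le
  refine ⟨_, hξ, ?_⟩
  obtain ⟨x, hx, h⟩ := exists_optError_eq (μ := μ) (T := T) (d := d) (τ := τ) (N := N) (a := a)
    (ξ := maLinear _ T f (aeval (timeShift (Lp ℂ 2 μ) (τ : ℤ)) (R ^ d) ε))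
  have hX : genOp hT hξ.toMemY = maOperator v
      (aeval (timeShift (Lp ℂ 2 μ) (τ : ℤ)) (((1 - X) * R) ^ d) ε) := by
    ext1 j
    refine clm_ext_unitSeq fun k => ?_
    rw [genOp_unitSeq, maOperator_unitSeq, genCoef_of_incr_eq_maProcess hT
      ((incr_smoothed hT f ε R).trans (maLinear_apply _ _)) fun p _ => hf p]
    simp only [Fin.sum_univ_one, ← hvf, blockPart_apply]
  rw [h, Real.sqrt_sq (norm_nonneg _), BFunctional_eq_functional hT hτ ha hb hξ.toMemY, hX]
  rw [pastSpace_eq_past hT hξ.toMemY, hX] at hx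
  have had := aeval_apply_mem (adapted_le_comap ε (Int.natCast_nonneg τ)) (((1 - X) * R) ^ d)
    (mem_adapted_self hε)
  have := norm_adjoint_hankel_le hε hR had (bSeq hb) (bSeq_of_lt hb) v hx
  linarith

/-- A bound `z` on the optimal errors gives `‖Γ* v‖ ≤ √z` for continuous coefficient families of
norm below `√P`. Such families approximate a top eigenvector of norm `√P`, where `‖Γ* v‖² = P ν²`.
-/
theorem le_of_optError_le_of_memYCont [IsProbabilityMeasure μ]
    (hΩ : ¬ FiniteDimensional ℂ (Lp ℂ 2 μ)) (hT : 0 < T) (hτ : 0 < τ) (hP : 0 < P)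
    (ha : IntegrableOn a (Set.Icc 0 ((N + 1 : ℝ) * T))) (hb : CoefCondition T d τ N a) {z : ℝ}
    (hz : ∀ ξ, MemYCont μ T d τ P ξ → optError μ T d τ N a ξ ≤ z) :
    P * ‖hankel N (bSeq hb)‖ ^ 2 ≤ z := by
  obtain ⟨ε, hε0, hε⟩ := exists_whiteNoise μ hΩ
  have hε' : Orthonormal ℂ fun s => ε s 0 :=
    hε.comp (fun s : ℤ => (s, (0 : Fin 1))) fun s r h => congrArg Prod.fst h
  have h1 : ∀ v ∈ continuousBlocks N hT ∩ Metric.ball 0 (Real.sqrt P),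
      ‖ContinuousLinearMap.adjoint (hankel N (bSeq hb)) v‖ ≤ Real.sqrt z := by
    rintro v ⟨hv, hvP⟩
    rw [mem_ball_zero_iff, Real.lt_sqrt (norm_nonneg _)] at hvP
    refine le_of_forall_pos_le_add fun ρ hρ => ?_
    obtain ⟨ξ, hξ, h⟩ := exists_memYCont_norm_adjoint_hankel_le hT hτ ha hb hε'
      (fun s => hε0 s 0) hv hvP hρ
    exact h.trans (add_le_add_left (Real.sqrt_le_sqrt (hz ξ hξ)) ρ)
  obtain ⟨v, hv, hvP⟩ := exists_eigenvector_QOp (N := N) (bSeq hb) hP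
  have hcl : IsClosed {v : BlockL2 N |
      ‖ContinuousLinearMap.adjoint (hankel N (bSeq hb)) v‖ ≤ Real.sqrt z} :=
    isClosed_le (by fun_prop) continuous_const
  have hmem : v ∈ closure (continuousBlocks N hT ∩ Metric.ball 0 (Real.sqrt P)) := by
    have h4 := (dense_continuousBlocks N hT).open_subset_closure_inter
      (Metric.isOpen_ball (x := (0 : BlockL2 N)) (ε := Real.sqrt P))
    rw [Set.inter_comm]
    refine closure_minimal h4 isClosed_closure ?_
    rw [closure_ball _ (Real.sqrt_pos.mpr hP).ne', mem_closedBall_zero_iff, ← hvP,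
      Real.sqrt_sq (norm_nonneg _)]
  have h2 := hcl.closure_subset_iff.mpr h1 hmem
  have h3 := (QOp_apply_eq_smul_iff (bSeq hb) v).mp hv
  rw [sum_norm_sq_inner_shiftVec, hvP, mul_comm] at h3
  rw [← h3]
  -- Since `Real.sqrt` is `0` at negative arguments, the sign of `z` has to be found separately. It
  -- follows because the continuous class is nonempty and errors are nonnegative.
  have hz0 : 0 ≤ z := by
    obtain ⟨w, hw, hwP⟩ := (dense_continuousBlocks N hT).exists_mem_open Metric.isOpen_ball
      ⟨0, Metric.mem_ball_self (Real.sqrt_pos.mpr hP)⟩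
    rw [mem_ball_zero_iff, Real.lt_sqrt (norm_nonneg _)] at hwP
    obtain ⟨ξ, hξ, -⟩ := exists_memYCont_norm_adjoint_hankel_le hT hτ ha hb hε'
      (fun s => hε0 s 0) hw hwP one_pos
    exact (sq_nonneg _).trans (hz ξ hξ)
  rw [← Real.sq_sqrt hz0]
  exact pow_le_pow_left₀ (norm_nonneg _) h2 2

end Approximation

end

end PCIncrements

/-! ### The saddle point, the minimax values and the least favorable processes. -/

theorem mainTheorem3 {Ω : Type*} [MeasurableSpace Ω] (μ : Measure Ω) [IsProbabilityMeasure μ]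
    (hΩ : ¬ FiniteDimensional ℂ (Lp ℂ 2 μ))
    (T : ℝ) (hT : 0 < T) (d τ N : ℕ) (hτ : 0 < τ) (P : ℝ) (hP : 0 < P)
    (a : ℝ → ℂ) (ha : IntegrableOn a (Set.Icc 0 ((N + 1 : ℝ) * T)))
    (hb : PCIncrements.CoefCondition T d τ N a) :
    ∃ (Q : PCIncrements.BlockL2 N →L[ℂ] PCIncrements.BlockL2 N) (ν2 : ℝ),
      -- the operator determined by the matrix, and its greatest eigenvalue
      PCIncrements.IsQOperator T d τ N a Q ∧
      IsCompactOperator Q ∧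
      IsSelfAdjoint Q ∧
      IsGreatest {x : ℝ | Module.End.HasEigenvalue
        (Q : PCIncrements.BlockL2 N →ₗ[ℂ] PCIncrements.BlockL2 N) (x : ℂ)} ν2 ∧
      -- the least error for a given process is that of its optimal linear estimate
      (∀ ξ, PCIncrements.MemY μ T d τ P ξ →
        IsLeast ((fun x => ‖PCIncrements.BFunctional μ T d τ N a ξ - x‖ ^ 2) ''
          (PCIncrements.pastSpace μ T d τ ξ : Set (Lp ℂ 2 μ)))
          (PCIncrements.optError μ T d τ N a ξ) ∧
        IsGLB (PCIncrements.mse μ T d τ N a ξ '' PCIncrements.Estimates μ T d τ P)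
          (PCIncrements.optError μ T d τ N a ξ)) ∧
      -- saddle point
      (∃ ξ₀, PCIncrements.MemY μ T d τ P ξ₀ ∧ ∃ B₀ ∈ PCIncrements.Estimates μ T d τ P,
        PCIncrements.mse μ T d τ N a ξ₀ B₀ = P * ν2 ∧
        (∀ ξ, PCIncrements.MemY μ T d τ P ξ →
          PCIncrements.mse μ T d τ N a ξ B₀ ≤ PCIncrements.mse μ T d τ N a ξ₀ B₀) ∧
        (∀ Bhat ∈ PCIncrements.Estimates μ T d τ P,
          PCIncrements.mse μ T d τ N a ξ₀ B₀ ≤ PCIncrements.mse μ T d τ N a ξ₀ Bhat)) ∧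
      -- min max and max min
      IsLeast {C : ℝ | ∃ Bhat ∈ PCIncrements.Estimates μ T d τ P,
        IsLUB ((fun ξ => PCIncrements.mse μ T d τ N a ξ Bhat) ''
          {ξ | PCIncrements.MemY μ T d τ P ξ}) C} (P * ν2) ∧
      IsGreatest (PCIncrements.optError μ T d τ N a '' {ξ | PCIncrements.MemY μ T d τ P ξ})
        (P * ν2) ∧
      -- the same value for the mean-square continuous processes of the class
      IsLeast {C : ℝ | ∃ Bhat ∈ PCIncrements.Estimates μ T d τ P,
        IsLUB ((fun ξ => PCIncrements.mse μ T d τ N a ξ Bhat) ''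
          {ξ | PCIncrements.MemYCont μ T d τ P ξ}) C} (P * ν2) ∧
      IsLUB (PCIncrements.optError μ T d τ N a '' {ξ | PCIncrements.MemYCont μ T d τ P ξ})
        (P * ν2) ∧
      -- the least favorable sequences are the moving averages built from the eigenvectors
      (∃ (g : Fin 1 → PCIncrements.BlockL2 N) (ε : ℤ → Fin 1 → Lp ℂ 2 μ),
        PCIncrements.IsEigenCoef N 1 P ν2 Q g ∧ PCIncrements.IsWhiteNoise μ 1 ε) ∧
      (∀ (M : ℕ) (g : Fin M → PCIncrements.BlockL2 N) (ε : ℤ → Fin M → Lp ℂ 2 μ),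
        PCIncrements.IsEigenCoef N M P ν2 Q g → PCIncrements.IsWhiteNoise μ M ε →
        (∃ ξ, PCIncrements.MemY μ T d τ P ξ ∧ PCIncrements.IsMovingAverage μ T d τ N M g ε ξ) ∧
        ∀ ξ, PCIncrements.MemY μ T d τ P ξ → PCIncrements.IsMovingAverage μ T d τ N M g ε ξ →
          PCIncrements.IsLeastFavorable μ T d τ N P a ξ) ∧
      (0 < ν2 → ∀ ξ, PCIncrements.IsLeastFavorable μ T d τ N P a ξ →
        ∃ (M : ℕ) (g : Fin M → PCIncrements.BlockL2 N) (ε : ℤ → Fin M → Lp ℂ 2 μ),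
          PCIncrements.IsEigenCoef N M P ν2 Q g ∧ PCIncrements.IsWhiteNoise μ M ε ∧
          PCIncrements.IsMovingAverage μ T d τ N M g ε ξ) := by
  open PCIncrements in
  set ν2 : ℝ := ‖hankel N (bSeq hb)‖ ^ 2 with hν2
  obtain ⟨B₀, hB₀, hle⟩ := exists_minimax_estimate (μ := μ) hT hτ hP ha hb
  obtain ⟨ε, hε⟩ := exists_whiteNoise μ hΩ
  obtain ⟨g, hg⟩ := exists_isEigenCoef (N := N) (bSeq hb) hP
  obtain ⟨ξ₀, hξ₀, hma⟩ := exists_movingAverage (d := d) hT hτ g hg.2 hε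
  have hopt : optError μ T d τ N a ξ₀ = P * ν2 :=
    le_antisymm (optError_le_of_memY hT hτ hP ha hb hξ₀)
      (le_optError_of_isMovingAverage hT hτ ha hb hξ₀ hg hε hma)
  have hmin : ∀ Bhat ∈ Estimates μ T d τ P, P * ν2 ≤ mse μ T d τ N a ξ₀ Bhat := fun Bhat hB =>
    hopt.symm.le.trans (optError_le_mse hB hξ₀)
  have hmse : mse μ T d τ N a ξ₀ B₀ = P * ν2 := le_antisymm (hle ξ₀ hξ₀) (hmin B₀ hB₀)
  -- In the continuous class the value is only approached, so every lower bound there passes through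
  -- upper bounds `z` instead of an extremal process.
  have hcont : ∀ z, (∀ ξ, MemYCont μ T d τ P ξ → optError μ T d τ N a ξ ≤ z) → P * ν2 ≤ z :=
    fun z hz => le_of_optError_le_of_memYCont hΩ hT hτ hP ha hb hz
  refine ⟨QOp N (bSeq hb), ν2, isQOperator_QOp _ (fun j hj k => bSeq_apply hb hj k) (bSeq_of_lt hb),
    isCompactOperator_QOp _, isSelfAdjoint_QOp _, isGreatest_eigenvalue_QOp _,
    fun ξ hξ => ⟨isLeast_optError, isGLB_mse hξ⟩, ⟨ξ₀, hξ₀, B₀, hB₀, hmse, fun ξ hξ => ?_,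
      fun Bhat hB => ?_⟩, ⟨⟨B₀, hB₀, ?_, fun z hz => ?_⟩, ?_⟩, ⟨⟨ξ₀, hξ₀, hopt⟩, ?_⟩,
    ⟨⟨B₀, hB₀, ?_, fun z hz => ?_⟩, ?_⟩, ⟨?_, fun z hz => ?_⟩, ⟨g, ε, hg, hε⟩,
    fun M g ε hg hε => ⟨exists_movingAverage hT hτ g hg.2 hε, fun ξ hξ hma => ⟨hξ, fun η hη => ?_⟩⟩,
    fun hν ξ hξ => ?_⟩
  · exact hmse ▸ hle ξ hξ
  · exact hmse ▸ hmin Bhat hB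
  · rintro _ ⟨ξ, hξ, rfl⟩
    exact hle ξ hξ
  · exact hmse ▸ hz ⟨ξ₀, hξ₀, rfl⟩
  · rintro C ⟨Bhat, hB, hC⟩
    exact (hmin Bhat hB).trans (hC.1 ⟨ξ₀, hξ₀, rfl⟩)
  · rintro _ ⟨ξ, hξ, rfl⟩
    exact optError_le_of_memY hT hτ hP ha hb hξ
  · rintro _ ⟨ξ, hξ, rfl⟩
    exact hle ξ hξ.toMemY
  · exact hcont z fun ξ hξ => (optError_le_mse hB₀ hξ.toMemY).trans (hz ⟨ξ, hξ, rfl⟩)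
  · rintro C ⟨Bhat, hB, hC⟩
    exact hcont C fun ξ hξ => (optError_le_mse hB hξ.toMemY).trans (hC.1 ⟨ξ, hξ, rfl⟩)
  · rintro _ ⟨ξ, hξ, rfl⟩
    exact optError_le_of_memY hT hτ hP ha hb hξ.toMemY
  · exact hcont z fun ξ hξ => hz ⟨ξ, hξ, rfl⟩
  · exact (optError_le_of_memY hT hτ hP ha hb hη).trans
      (le_optError_of_isMovingAverage hT hτ ha hb hξ hg hε hma)
  · exact exists_movingAverage_of_isLeastFavorable hT hτ ha hb hν hξ.1
      (hopt.symm.le.trans (hξ.2 ξ₀ hξ₀))
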